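/- Let $\mathbb K$ be a field of characteristic $0$ and let $(\mathfrak g,\nu,\delta,\alpha,\alpha)$ be a Hom-Lie bialgebra over $\mathbb K$ (of any dimension) whose two structure maps coincide. That is, $\alpha:\mathfrak g\to\mathfrak g$ is linear; $\nu=[\cdot,\cdot]$ is a skew-symmetric bilinear bracket with $[[x,y],\alpha(z)]+[[y,z],\alpha(x)]+[[z,x],\alpha(y)]=0$ and $\alpha([x,y])=[\alpha(x),\alpha(y)]$; $\delta:\mathfrak g\to\mathfrak g\otimes\mathfrak g$, $\delta(x)=x^{(1)}\otimes x^{(2)}$, is a skew-symmetric cobracket with $(\mathrm{id}+\sigma+\sigma^2)(\delta\otimes\alpha)\delta=0$ (where $\sigma(x\otimes y\otimes z)=z\otimes x\otimes y$) and $\delta\alpha=(\alpha\otimes\alpha)\delta$; and $$\delta([x,y])=\alpha(x^{(1)})\otimes[x^{(2)},\alpha(y)]+[x^{(1)},\alpha(y)]\otimes\alpha(x^{(2)})+[\alpha(x),y^{(1)}]\otimes\alpha(y^{(2)})+\alpha(y^{(1)})\otimes[\alpha(x),y^{(2)}].$$ **Conventions.** $\Lambda\mathfrak g$ is the Grassmann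 Hopf algebra with product $\mu$ and coproduct $\Delta$, the algebra morphism into the graded tensor square with $\Delta(x)=x\otimes1+1\otimes x$ for $x\in\mathfrak g$; $\mathrm{pr}:\Lambda\mathfrak g\to\mathfrak g$ is the projection, $\Delta^3=(\mathrm{id}\otimes\Delta)\Delta$, $\mu^3=\mu(\mathrm{id}\otimes\mu)$, and $\alpha$ is extended to an algebra endomorphism of $\Lambda\mathfrak g$. Elements of $\mathrm{Hom}(\Lambda^i\mathfrak g,\Lambda^j\mathfrak g)$ are extended by $0$ to $\Lambda\mathfrak g$ and have degree $j-i$. The Koszul rule $(\phi\otimes\psi)(x\otimes y)=(-1)^{\deg\psi\deg x}\phi(x)\otimes\psi(y)$ is used. $\nu$ is regarded as a map $\Lambda^2\mathfrak g\to\mathfrak g$, $x\wedge y\mapsto[x,y]$, and $\delta$ as the map $\mathfrak g\to\Lambda^2\mathfrak g$, $x\mapsto\frac12x^{(1)}\wedge x^{(2)}$. For $k\ge0$ set $$\widetilde{\mathfrak C}^k(\mathfrak g)=\mathfrak C^k_\nu\oplus\mathfrak C^k_\alpha=\bigoplus_{l=1}^{k}\mathrm{Hom}(\Lambda^l\mathfrak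 g,\Lambda^{k-l+1}\mathfrak g)\ \oplus\ \bigoplus_{l=1}^{k-1}\mathrm{Hom}(\Lambda^l\mathfrak g,\Lambda^{k-l}\mathfrak g).$$ All elements of $\mathfrak C^k_\nu$ and of $\mathfrak C^k_\alpha$ have height $|\cdot|=k-1$ (that is, $i+j-2$ on $\mathrm{Hom}(\Lambda^i\mathfrak g,\Lambda^j\mathfrak g)\subset\mathfrak C_\nu$ and $i+j-1$ on $\mathrm{Hom}(\Lambda^i\mathfrak g,\Lambda^j\mathfrak g)\subset\mathfrak C_\alpha$), and $|\nu|=|\delta|=1$. For maps with height let $$\psi\circ\phi=\mu(\psi\otimes\alpha^{|\psi|})\,Q\,(\alpha^{|\phi|}\otimes\phi)\Delta,\qquad Q=(\mu\otimes\mathrm{id})(\mathrm{id}\otimes\mathrm{pr}\otimes\mathrm{id})(\mathrm{id}\otimes\Delta),$$ $$[[\phi,\psi]]=\phi\circ\psi-(-1)^{\deg\phi\deg\psi}\,\psi\circ\phi .$$ For $\phi\in\mathfrak C^k_\nu$ let $\partial_{\nu\nu}\phi=[[\nu,\phi]]$, $\partial^c_{\nu\nu}\phi=[[\delta,\phi]]$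 and $\partial_{\nu\alpha}\phi=\alpha\phi-\phi\alpha$. For $\psi\in\mathfrak C^k_\alpha$ let $h=|\psi|=k-1$, $\partial_{\alpha\alpha}\psi=[[\nu,\psi]]$, $\partial^c_{\alpha\alpha}\psi=[[\delta,\psi]]$. For $\psi\in\mathrm{Hom}(\Lambda^i\mathfrak g,\Lambda^j\mathfrak g)\subset\mathfrak C_\alpha^{k}$, $k=i+j$, let $$\partial_{\alpha\nu}\psi(x_1,\dots,x_{i+2})=\sum_{a<b}(-1)^{a+b-1}\,\alpha^{h-1}([x_a,x_b])\cdot\psi(x_1,\dots,\hat x_a,\dots,\hat x_b,\dots,x_{i+2}),$$ $$\partial^c_{\alpha\nu}\psi(x_1,\dots,x_i)=\sum_a(-1)^{a-1}\,\alpha^{h-1}\delta(x_a^{(1)})\wedge\psi\big(x_a^{(2)},\alpha(x_1),\dots,\widehat{\alpha(x_a)},\dots,\alpha(x_i)\big),$$ where $x\cdot(y_1\wedge\dots\wedge y_j)=\sum_b\alpha(y_1)\wedge\dots\wedge[x,y_b]\wedge\dots\wedge\alpha(y_j)$ and, in the second formula, $\delta(x_a^{(1)})\in\Lambda^2\mathfrak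 g$. Extend these linearly to $\mathfrak C^k_\alpha$. Finally, let the mixed term be $$\partial_b\psi=\mu^3(\alpha\otimes\nu\otimes\alpha)(\mathrm{pr}\otimes\mu\otimes\mathrm{id})(\Delta\otimes\Delta)(\delta\alpha^{h-1}\otimes\psi)\Delta+(-1)^{\deg\psi}\mu(\alpha^{h-1}\nu\otimes\psi)(\mu\otimes\mu)(\mathrm{pr}\otimes\Delta\otimes\mathrm{id})(\alpha\otimes\delta\otimes\alpha)\Delta^3 .$$ **Theorem.** The formula $$\partial(\phi,\psi)=\big(\partial_{\nu\nu}\phi+\partial^c_{\nu\nu}\phi+\partial_{\alpha\nu}\psi+\partial_b\psi+\partial^c_{\alpha\nu}\psi,\ \ \partial_{\nu\alpha}\phi-\partial_{\alpha\alpha}\psi-\partial^c_{\alpha\alpha}\psi\big)$$ defines linear maps $\partial:\widetilde{\mathfrak C}^k(\mathfrak g)\to\widetilde{\mathfrak C}^{k+1}(\mathfrak g)$ for all $k\ge0$, and $\partial\circ\partial=0$. -/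

import Mathlib

open scoped TensorProduct

noncomputable section

namespace HomLie

variable {K : Type*} [Field K] {g : Type*} [AddCommGroup g] [Module K g]

/-! ### Hom-Lie algebras, coalgebras and bialgebras -/

/-- `(g, ν, α)` is a (multiplicative) Hom-Lie algebra. -/
structure IsHomLieAlgebra (ν : g →ₗ[K] g →ₗ[K] g) (α : g →ₗ[K] g) : Prop where
  skew : ∀ x y, ν x y = -ν y x
  jacobi : ∀ x y z, ν (ν x y) (α z) + ν (ν y z) (α x) + ν (ν z x) (α y) = 0
  multiplicative : ∀ x y, ν (α x) (α y) = α (ν x y)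

/-- The cyclic permutation `x ⊗ y ⊗ z ↦ z ⊗ x ⊗ y`. -/
def cyc : (g ⊗[K] g) ⊗[K] g →ₗ[K] (g ⊗[K] g) ⊗[K] g :=
  (TensorProduct.assoc K g g g).symm.toLinearMap ∘ₗ (TensorProduct.comm K (g ⊗[K] g) g).toLinearMap

/-- `(g, δ, β)` is a (multiplicative) Hom-Lie coalgebra. -/
structure IsHomLieCoalgebra (δ : g →ₗ[K] g ⊗[K] g) (β : g →ₗ[K] g) : Prop where
  skew : ∀ x, δ x = -TensorProduct.comm K g g (δ x)
  cojacobi : (LinearMap.id + cyc + cyc ∘ₗ cyc) ∘ₗ TensorProduct.map δ β ∘ₗ δ = 0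
  multiplicative : δ ∘ₗ β = TensorProduct.map β β ∘ₗ δ

/-- `(g, ν, δ, α, β)` is a Hom-Lie bialgebra. In Sweedler notation the field `compat` reads
`δ [x, y] = α x₁ ⊗ [x₂, β y] + [x₁, β y] ⊗ α x₂ + [β x, y₁] ⊗ α y₂ + α y₁ ⊗ [β x, y₂]`. -/
structure IsHomLieBialgebra (ν : g →ₗ[K] g →ₗ[K] g) (δ : g →ₗ[K] g ⊗[K] g)
    (α β : g →ₗ[K] g) : Prop where
  algebra : IsHomLieAlgebra ν α
  coalgebra : IsHomLieCoalgebra δ β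
  compat : ∀ x y, δ (ν x y) =
    TensorProduct.map α (ν.flip (β y)) (δ x) + TensorProduct.map (ν.flip (β y)) α (δ x) +
    TensorProduct.map (ν (β x)) α (δ y) + TensorProduct.map α (ν (β x)) (δ y)
  bracket_comm : ∀ x y, β (ν x y) = ν (β x) (β y)
  cobracket_comm : δ ∘ₗ α = TensorProduct.map α α ∘ₗ δ
  comm : β ∘ₗ α = α ∘ₗ β

/-! ### The Hopf algebra `Λ g` -/

/-- The Grassmann algebra `Λ g`. -/
local notation "Λ" => ExteriorAlgebra K g

/-- The linear maps `Λ g → Λ g`. -/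
local notation "EndΛ" => ExteriorAlgebra K g →ₗ[K] ExteriorAlgebra K g

/-- The graded tensor square of `Λ g`, with product
`(a ⊗ b) (a' ⊗ b') = (-1) ^ (deg b * deg a') (a a' ⊗ b b')`. -/
abbrev GradedSquare (K : Type*) [Field K] (g : Type*) [AddCommGroup g] [Module K g] :=
  GradedTensorProduct K (fun i : ℕ => ⋀[K]^i g) (fun i : ℕ => ⋀[K]^i g)

/-- `x ↦ x ⊗ 1 + 1 ⊗ x`, from `g` to the graded tensor square. -/
def primitive : g →ₗ[K] GradedSquare K g :=
  (GradedTensorProduct.includeLeft (fun i : ℕ => ⋀[K]^i g)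
      (fun i : ℕ => ⋀[K]^i g)).toLinearMap ∘ₗ ExteriorAlgebra.ι K +
  (GradedTensorProduct.includeRight (fun i : ℕ => ⋀[K]^i g)
      (fun i : ℕ => ⋀[K]^i g)).toLinearMap ∘ₗ ExteriorAlgebra.ι K

theorem primitive_mul_self (x : g) : primitive x * primitive x = (0 : GradedSquare K g) := by
  have h1 : ExteriorAlgebra.ι K x ∈ ⋀[K]^1 g := by
    change ExteriorAlgebra.ι K x ∈ LinearMap.range (ExteriorAlgebra.ι K (M := g)) ^ 1
    rw [pow_one]
    exact LinearMap.mem_range_self _ x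
  have h := GradedTensorProduct.tmul_coe_mul_coe_tmul (R := K) (fun i : ℕ => ⋀[K]^i g)
    (fun i : ℕ => ⋀[K]^i g) (j₁ := 1) (i₂ := 1) 1 ⟨_, h1⟩ ⟨_, h1⟩ 1
  have h' := GradedTensorProduct.tmul_one_mul_one_tmul (R := K) (fun i : ℕ => ⋀[K]^i g)
    (fun i : ℕ => ⋀[K]^i g) (ExteriorAlgebra.ι K x) (ExteriorAlgebra.ι K x)
  have hl : (GradedTensorProduct.includeLeft (fun i : ℕ => ⋀[K]^i g) (fun i : ℕ => ⋀[K]^i g))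
      (ExteriorAlgebra.ι K x) = GradedTensorProduct.tmul K (ExteriorAlgebra.ι K x) 1 := rfl
  have hr : (GradedTensorProduct.includeRight (fun i : ℕ => ⋀[K]^i g) (fun i : ℕ => ⋀[K]^i g))
      (ExteriorAlgebra.ι K x) = GradedTensorProduct.tmul K 1 (ExteriorAlgebra.ι K x) := rfl
  simp only [primitive, LinearMap.add_apply, LinearMap.comp_apply, AlgHom.toLinearMap_apply]
  rw [add_mul, mul_add, mul_add, ← map_mul (GradedTensorProduct.includeLeft _ _),
    ← map_mul (GradedTensorProduct.includeRight _ _), ExteriorAlgebra.ι_sq_zero, map_zero,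
    map_zero, hl, hr, h', h]
  simp

/-- The coproduct of `Λ g`: the algebra morphism into the graded tensor square with
`Δ x = x ⊗ 1 + 1 ⊗ x` for `x ∈ g`. -/
def comul : Λ →ₗ[K] Λ ⊗[K] Λ :=
  (GradedTensorProduct.of K (fun i : ℕ => ⋀[K]^i g)
      (fun i : ℕ => ⋀[K]^i g)).symm.toLinearMap ∘ₗ
    (ExteriorAlgebra.lift K ⟨primitive, primitive_mul_self⟩).toLinearMap

/-- The product `μ` of `Λ g`. -/
def mul : Λ ⊗[K] Λ →ₗ[K] Λ := LinearMap.mul' K (ExteriorAlgebra K g)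

/-- The projection `pr : Λ g → g ⊆ Λ g`. -/
def pr : EndΛ := ExteriorAlgebra.ι K ∘ₗ ExteriorAlgebra.ιInv

/-- The extension of a linear map `α : g → g` to an algebra endomorphism of `Λ g`. -/
def extMap (α : g →ₗ[K] g) : Module.End K (ExteriorAlgebra K g) :=
  (ExteriorAlgebra.map α).toLinearMap

/-- The sign operator `x ↦ (-1) ^ (deg x) x`. -/
def sgn : Module.End K (ExteriorAlgebra K g) :=
  (CliffordAlgebra.involute (Q := (0 : QuadraticForm K g))).toLinearMap

/-- The tensor product `φ ⊗ ψ` with the Koszul sign rule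
`(φ ⊗ ψ) (x ⊗ y) = (-1) ^ (deg ψ * deg x) φ x ⊗ ψ y`, where `p` is (any number of the parity of)
the degree of `ψ`. -/
def koszul {M N P : Type*} [AddCommGroup M] [Module K M] [AddCommGroup N] [Module K N]
    [AddCommGroup P] [Module K P] (p : ℕ) (φ : Λ →ₗ[K] M) (ψ : N →ₗ[K] P) :
    Λ ⊗[K] N →ₗ[K] M ⊗[K] P :=
  TensorProduct.map (φ ∘ₗ (sgn ^ p)) ψ

/-- The bracket as a map `Λ² g → g`, extended by zero: it sends `x ∧ y` to `[x, y]`.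
(`Δ (x ∧ y)` has the component `x ⊗ y - y ⊗ x` in `g ⊗ g`.) -/
def hatBracket (ν : g →ₗ[K] g →ₗ[K] g) : EndΛ :=
  (2⁻¹ : K) • (ExteriorAlgebra.ι K ∘ₗ TensorProduct.lift ν ∘ₗ
    TensorProduct.map ExteriorAlgebra.ιInv ExteriorAlgebra.ιInv ∘ₗ comul)

/-- The cobracket as a map `g → Λ² g`, extended by zero: if `δ x = x₁ ⊗ x₂` (a skew tensor) it sends
`x` to `(1/2) x₁ ∧ x₂`, i.e. `a ⊗ b - b ⊗ a` is identified with `a ∧ b`. -/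
def hatCobracket (δ : g →ₗ[K] g ⊗[K] g) : EndΛ :=
  (2⁻¹ : K) • (mul ∘ₗ TensorProduct.map (ExteriorAlgebra.ι K) (ExteriorAlgebra.ι K) ∘ₗ
    δ ∘ₗ ExteriorAlgebra.ιInv)

/-! ### The grand crochet -/

/-- `(μ ⊗ id) (id ⊗ pr ⊗ id) (id ⊗ Δ) : a ⊗ b ↦ (a ∧ pr b₁) ⊗ b₂`. -/
def contract : Λ ⊗[K] Λ →ₗ[K] Λ ⊗[K] Λ :=
  TensorProduct.map mul LinearMap.id ∘ₗ
    (TensorProduct.assoc K Λ Λ Λ).symm.toLinearMap ∘ₗ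
    TensorProduct.map LinearMap.id (TensorProduct.map pr LinearMap.id ∘ₗ comul)

/-- The dual of `contract`, `(id ⊗ μ) (pr ⊗ id ⊗ id) (Δ ⊗ id) : a ⊗ b ↦ pr a₁ ⊗ (a₂ ∧ b)`. -/
def cocontract : Λ ⊗[K] Λ →ₗ[K] Λ ⊗[K] Λ :=
  TensorProduct.map LinearMap.id mul ∘ₗ
    (TensorProduct.assoc K Λ Λ Λ).toLinearMap ∘ₗ
    TensorProduct.map (TensorProduct.map pr LinearMap.id ∘ₗ comul) LinearMap.id

/-- The product `ψ ∘ φ = μ (ψ ⊗ α^|ψ|) (μ ⊗ id) (id ⊗ pr ⊗ id) (id ⊗ Δ) (α^|φ| ⊗ φ) Δ`, where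
`hψ = |ψ|` and `hφ = |φ|` are the heights and `dφ` is the degree of `φ` modulo two. -/
def circ (α : g →ₗ[K] g) (hψ : ℕ) (ψ : EndΛ) (hφ dφ : ℕ) (φ : EndΛ) : EndΛ :=
  mul ∘ₗ TensorProduct.map ψ (extMap α ^ hψ) ∘ₗ contract ∘ₗ koszul dφ (extMap α ^ hφ) φ ∘ₗ comul

/-- The grand crochet `[[φ, ψ]] = φ ∘ ψ - (-1) ^ (deg φ * deg ψ) ψ ∘ φ` of maps of heights `hφ`, `hψ`
and degrees `dφ`, `dψ`. -/
def crochet (α : g →ₗ[K] g) (hφ dφ : ℕ) (φ : EndΛ) (hψ dψ : ℕ) (ψ : EndΛ) : EndΛ :=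
  circ α hφ φ hψ dψ ψ - (-1 : K) ^ (dφ * dψ) • circ α hψ ψ hφ dφ φ

/-! ### The components of the differential -/

/-- `[[ν, φ]]` for `φ` of height `h` and degree `d`; here `ν` has height `1` and odd degree.
This is `∂_νν` and `∂_αα`. -/
def dLie (ν : g →ₗ[K] g →ₗ[K] g) (α : g →ₗ[K] g) (h d : ℕ) (φ : EndΛ) : EndΛ :=
  crochet α 1 1 (hatBracket ν) h d φ

/-- `[[δ, φ]]` for `φ` of height `h` and degree `d`; here `δ` has height `1` and odd degree.
This is `∂^c_νν` and `∂^c_αα`. -/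
def dCoLie (δ : g →ₗ[K] g ⊗[K] g) (α : g →ₗ[K] g) (h d : ℕ) (φ : EndΛ) : EndΛ :=
  crochet α 1 1 (hatCobracket δ) h d φ

/-- `∂_να φ = α φ - φ α`. -/
def dAlpha (α : g →ₗ[K] g) (φ : EndΛ) : EndΛ := extMap α ∘ₗ φ - φ ∘ₗ extMap α

/-- The adjoint action `x ⊗ (y₁ ∧ ⋯ ∧ yⱼ) ↦ ∑ₐ α y₁ ∧ ⋯ ∧ [x, yₐ] ∧ ⋯ ∧ α yⱼ` of `g` on `Λ g`
(extended by zero to `Λ g ⊗ Λ g`). -/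
def act (ν : g →ₗ[K] g →ₗ[K] g) (α : g →ₗ[K] g) : Λ ⊗[K] Λ →ₗ[K] Λ :=
  mul ∘ₗ TensorProduct.map (hatBracket ν) (extMap α) ∘ₗ contract

/-- The dual of `act`, the coaction `Λ g → g ⊗ Λ g`,
`x₁ ∧ ⋯ ∧ xᵢ ↦ ∑ₐ (-1) ^ (a - 1) xₐ⁽¹⁾ ⊗ (xₐ⁽²⁾ ∧ α x₁ ∧ ⋯ (omit a) ⋯ ∧ α xᵢ)`. -/
def coact (δ : g →ₗ[K] g ⊗[K] g) (α : g →ₗ[K] g) : Λ →ₗ[K] Λ ⊗[K] Λ :=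
  cocontract ∘ₗ TensorProduct.map (hatCobracket δ) (extMap α) ∘ₗ comul

/-- `∂_αν ψ`, for `ψ` of height `h`:
`∑_{a < b} (-1) ^ (a + b - 1) α^(h-1) [xₐ, x_b] · ψ (x₁, …, omit a, b, …)`. -/
def dAlphaNu (ν : g →ₗ[K] g →ₗ[K] g) (α : g →ₗ[K] g) (h : ℕ) (ψ : EndΛ) : EndΛ :=
  act ν α ∘ₗ TensorProduct.map ((extMap α ^ (h - 1)) ∘ₗ hatBracket ν) ψ ∘ₗ comul

/-- `∂^c_αν ψ`, the dual of `∂_αν ψ`: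
`∑ₐ (-1) ^ (a - 1) α^(h-1) δ(xₐ⁽¹⁾) ∧ ψ (xₐ⁽²⁾, α x₁, …, omit a, …, α xᵢ)`. -/
def dAlphaNuCo (δ : g →ₗ[K] g ⊗[K] g) (α : g →ₗ[K] g) (h : ℕ) (ψ : EndΛ) : EndΛ :=
  mul ∘ₗ TensorProduct.map ((extMap α ^ (h - 1)) ∘ₗ hatCobracket δ) ψ ∘ₗ coact δ α

/-- The first half of the mixed term, for `ψ` of height `h` and degree `d`:
`μ³ (α ⊗ ν ⊗ α) (pr ⊗ μ ⊗ id) (Δ ⊗ Δ) (δ α^(h-1) ⊗ ψ) Δ`. -/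
def dMixed₁ (ν : g →ₗ[K] g →ₗ[K] g) (δ : g →ₗ[K] g ⊗[K] g) (α : g →ₗ[K] g) (h d : ℕ)
    (ψ : EndΛ) : EndΛ :=
  mul ∘ₗ TensorProduct.map LinearMap.id mul ∘ₗ
    koszul 1 (extMap α) (TensorProduct.map (hatBracket ν) (extMap α)) ∘ₗ
    TensorProduct.map pr (TensorProduct.map mul LinearMap.id ∘ₗ
      (TensorProduct.assoc K Λ Λ Λ).symm.toLinearMap) ∘ₗ
    (TensorProduct.assoc K Λ Λ (Λ ⊗[K] Λ)).toLinearMap ∘ₗ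
    TensorProduct.map comul comul ∘ₗ
    koszul d (hatCobracket δ ∘ₗ (extMap α ^ (h - 1))) ψ ∘ₗ comul

/-- The second half of the mixed term, for `ψ` of height `h` and degree `d`:
`(-1)^d μ (α^(h-1) ν ⊗ ψ) (μ ⊗ μ) (pr ⊗ Δ ⊗ id) (α ⊗ δ ⊗ α) Δ³`. -/
def dMixed₂ (ν : g →ₗ[K] g →ₗ[K] g) (δ : g →ₗ[K] g ⊗[K] g) (α : g →ₗ[K] g) (h d : ℕ)
    (ψ : EndΛ) : EndΛ :=
  (-1 : K) ^ d • (mul ∘ₗ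
    koszul d ((extMap α ^ (h - 1)) ∘ₗ hatBracket ν) ψ ∘ₗ
    TensorProduct.map mul mul ∘ₗ
    (TensorProduct.assoc K Λ Λ (Λ ⊗[K] Λ)).symm.toLinearMap ∘ₗ
    TensorProduct.map pr ((TensorProduct.assoc K Λ Λ Λ).toLinearMap ∘ₗ
      TensorProduct.map comul LinearMap.id) ∘ₗ
    koszul 1 (extMap α) (TensorProduct.map (hatCobracket δ) (extMap α)) ∘ₗ
    TensorProduct.map LinearMap.id comul ∘ₗ comul)

/-- The mixed term `∂_b`: the sum of the two halves, which both carry the sign `(-1)^d` times minus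
the sign of the permutation of the arguments. -/
def dMixed (ν : g →ₗ[K] g →ₗ[K] g) (δ : g →ₗ[K] g ⊗[K] g) (α : g →ₗ[K] g) (h d : ℕ)
    (ψ : EndΛ) : EndΛ :=
  dMixed₁ ν δ α h d ψ + dMixed₂ ν δ α h d ψ

/-! ### The complex -/

/-- `Hom(Λⁱ g, Λʲ g)` inside `Hom(Λ g, Λ g)`. -/
def homSub (K : Type*) [Field K] (g : Type*) [AddCommGroup g] [Module K g] (i j : ℕ) :
    Submodule K (ExteriorAlgebra K g →ₗ[K] ExteriorAlgebra K g) where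
  carrier := {f | (∀ x ∈ ⋀[K]^i g, f x ∈ ⋀[K]^j g) ∧ ∀ m, m ≠ i → ∀ x ∈ ⋀[K]^m g, f x = 0}
  add_mem' := by
    rintro f f' ⟨h₁, h₂⟩ ⟨h₁', h₂'⟩
    exact ⟨fun x hx => add_mem (h₁ x hx) (h₁' x hx),
      fun m hm x hx => by simp [h₂ m hm x hx, h₂' m hm x hx]⟩
  zero_mem' := ⟨fun _ _ => zero_mem _, fun _ _ _ _ => rfl⟩
  smul_mem' := by
    rintro c f ⟨h₁, h₂⟩
    exact ⟨fun x hx => Submodule.smul_mem _ c (h₁ x hx),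
      fun m hm x hx => by simp [h₂ m hm x hx]⟩

/-- `homSub K g i j` is the space `Hom(Λⁱ g, Λʲ g)`: restriction to `Λⁱ g` is an isomorphism. -/
def homSubEquiv (K : Type*) [Field K] (g : Type*) [AddCommGroup g] [Module K g] (i j : ℕ) :
    homSub K g i j ≃ₗ[K] (⋀[K]^i g →ₗ[K] ⋀[K]^j g) :=
  LinearEquiv.ofBijective
    { toFun := fun f => f.1.restrict f.2.1
      map_add' := fun _ _ => rfl
      map_smul' := fun _ _ => rfl } (by
    classical
    constructor
    · rintro ⟨f, hf⟩ ⟨f', hf'⟩ h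
      refine Subtype.ext (DirectSum.decompose_lhom_ext (fun m : ℕ => ⋀[K]^m g) fun m => ?_)
      refine LinearMap.ext fun x => ?_
      by_cases hm : m = i
      · subst hm
        exact congrArg Subtype.val (LinearMap.congr_fun h x)
      · exact (hf.2 m hm x x.2).trans (hf'.2 m hm x x.2).symm
    · intro φ
      refine ⟨⟨(⋀[K]^j g).subtype ∘ₗ φ ∘ₗ DirectSum.component K ℕ (fun m => ⋀[K]^m g) i ∘ₗ
        (DirectSum.decomposeLinearEquiv (fun m : ℕ => ⋀[K]^m g)).toLinearMap, ?_, ?_⟩, ?_⟩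
      · intro x _
        exact Subtype.coe_prop _
      · intro m hm x hx
        have h : DirectSum.decompose (fun m : ℕ => ⋀[K]^m g) x i = 0 := by
          rw [DirectSum.decompose_of_mem (fun m : ℕ => ⋀[K]^m g) hx]
          exact DirectSum.of_eq_of_ne _ _ _ (Ne.symm hm)
        change ((φ (DirectSum.decompose (fun m : ℕ => ⋀[K]^m g) x i) : ⋀[K]^j g) : ExteriorAlgebra K g) = 0
        rw [h, map_zero]
        rfl
      · refine LinearMap.ext fun x => ?_
        change φ (DirectSum.decompose (fun m : ℕ => ⋀[K]^m g) (x : ExteriorAlgebra K g) i) = φ x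
        rw [DirectSum.decompose_coe, DirectSum.of_eq_same])

/-- `𝔠_ν^k = ⨁_{l=1}^{k} Hom(Λˡ g, Λ^{k-l+1} g)`. -/
def cochainNu (K : Type*) [Field K] (g : Type*) [AddCommGroup g] [Module K g] (k : ℕ) :
    Submodule K (ExteriorAlgebra K g →ₗ[K] ExteriorAlgebra K g) :=
  ⨆ l ∈ Set.Icc 1 k, homSub K g l (k + 1 - l)

/-- `𝔠_α^k = ⨁_{l=1}^{k-1} Hom(Λˡ g, Λ^{k-l} g)`. -/
def cochainAlpha (K : Type*) [Field K] (g : Type*) [AddCommGroup g] [Module K g] (k : ℕ) :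
    Submodule K (ExteriorAlgebra K g →ₗ[K] ExteriorAlgebra K g) :=
  ⨆ l ∈ Set.Icc 1 (k - 1), homSub K g l (k - l)

/-- The cochains of degree `k`: pairs `(φ, ψ)` with `φ ∈ 𝔠_ν^k` and `ψ ∈ 𝔠_α^k`. -/
def cochain (K : Type*) [Field K] (g : Type*) [AddCommGroup g] [Module K g] (k : ℕ) :
    Submodule K ((ExteriorAlgebra K g →ₗ[K] ExteriorAlgebra K g) ×
      (ExteriorAlgebra K g →ₗ[K] ExteriorAlgebra K g)) :=
  (cochainNu K g k).prod (cochainAlpha K g k)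

/-- The formula for `∂ (φ, ψ)` on cochains of degree `k`.

An element of `Hom(Λⁱ g, Λʲ g)` has degree `j - i ≡ i + j` modulo two; in `𝔠_ν` it has height
`i + j - 2`, in `𝔠_α` it has height `i + j - 1`. As `i + j = k + 1` in `𝔠_ν^k` and `i + j = k` in
`𝔠_α^k`, both heights are `k - 1`, and the degrees are `k + 1` and `k` modulo two. -/
def diff (ν : g →ₗ[K] g →ₗ[K] g) (δ : g →ₗ[K] g ⊗[K] g) (α : g →ₗ[K] g) (k : ℕ)
    (c : EndΛ × EndΛ) : EndΛ × EndΛ :=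
  (dLie ν α (k - 1) (k + 1) c.1 + dCoLie δ α (k - 1) (k + 1) c.1 +
      dAlphaNu ν α (k - 1) c.2 + dMixed ν δ α (k - 1) k c.2 + dAlphaNuCo δ α (k - 1) c.2,
    dAlpha α c.1 - dLie ν α (k - 1) k c.2 - dCoLie δ α (k - 1) k c.2)

end HomLie

end

/-! An operator on `Λ g` that kills `1` is determined by the way it passes left multiplications by
elements `v` of `g`, since these generate `Λ g` from `1`. Every structure map is therefore made into
an operator, and its rule for passing `v` is recorded. An identity holds as soon as the difference
of its two sides kills `1` and passes `v` into a left multiple of a difference of the same family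
(`op_eq_zero`). `OpCalculus` collects these rules, and the algebraic identities use nothing else
about `Λ g`.

The operators are `a` (the extension of `α`), `ad u` (the adjoint action), `N` (the
Hom-Chevalley-Eilenberg boundary), `M` (the cobracket extended as an odd `α`-derivation) and two
contractions. `L F` feeds one argument to a linear operator-valued function `F`. `R F` feeds it the
first leg of the cobracket of one argument and keeps the second leg among the arguments. An
endomorphism `p` stands for a power of `α`, so that heights only enter through the passage from `p`
to `α ∘ₗ p`. In these terms `[[ν, φ]] + [[δ, φ]]` becomes `bd`, the sum of `∂_αν`, `∂_b` and
`∂^c_αν` becomes `conn`, and the differential reads `(φ, ψ) ↦ (bd φ + conn ψ, [a, φ] - bd ψ)`.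

Its square vanishes formally by three facts, in which each factor carries the appropriate twist: `bd
∘ bd = -conn ∘ [a, ·]` (`bd_bd`), `bd ∘ conn = conn ∘ bd` (`bd_conn`), and both `bd` and `conn`
commute with `[a, ·]`. Without a twist `bd` would square to zero. Here each correction term occurs
once with `a T` and once with `T a`, and the differences assemble to `conn`.

The Hom-Jacobi identity enters through `ad_mul_ad` and `L_A_jacobi`, the co-Jacobi identity through
`sw_d_mul_e`, `sw_e_mul_k` and `R_R`, and the compatibility through `d_bracket`, `k_bracket`,
`M_mul_ad` and `R_mul_ad`. The hardest point is `bd_conn`, which splits by bidegree: the two pure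
components need only Jacobi or co-Jacobi, the two mixed ones are `mixed_nuA` and `mixed_coA`.

That cochains go to cochains is checked with the operator that scales degree `n` by `2 ^ n`. In
characteristic zero its eigenvalues separate degrees, so that membership in `homSub K g i j` is a
pair of commutation rules (`mem_homSub_iff`). -/

open scoped TensorProduct

noncomputable section

namespace HomLie

variable {K : Type*} [Field K] {g : Type*} [AddCommGroup g] [Module K g]

/-! ### Linear functions and evaluation of functions on tensors -/

section Linear

variable {V W U : Type*} [AddCommGroup V] [Module K V] [AddCommGroup W] [Module K W]
  [AddCommGroup U] [Module K U]

/-- A linear function, as a predicate that `fun_prop` can prove. -/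
@[fun_prop]
structure Lin (K : Type*) [Field K] {V W : Type*} [AddCommGroup V] [Module K V] [AddCommGroup W]
    [Module K W] (f : V → W) : Prop where
  add : ∀ x y, f (x + y) = f x + f y
  smul : ∀ (c : K) x, f (c • x) = c • f x

namespace Lin

@[fun_prop] theorem id : Lin K (fun x : V => x) := ⟨fun _ _ => rfl, fun _ _ => rfl⟩

@[fun_prop] theorem comp {f : W → U} {h : V → W} (hf : Lin K f) (hh : Lin K h) :
    Lin K (fun x => f (h x)) :=
  ⟨fun x y => by rw [hh.add, hf.add], fun c x => by rw [hh.smul, hf.smul]⟩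

@[fun_prop] theorem coe (f : V →ₗ[K] W) : Lin K (fun x => f x) := ⟨map_add f, map_smul f⟩

@[fun_prop] theorem coe₂ (f : V →ₗ[K] W →ₗ[K] U) (y : W) : Lin K (fun x => f x y) :=
  ⟨by simp, by simp⟩

@[fun_prop] theorem fun_add {f h : V → W} (hf : Lin K f) (hh : Lin K h) :
    Lin K (fun x => f x + h x) :=
  ⟨fun x y => by rw [hf.add, hh.add]; abel, fun c x => by rw [hf.smul, hh.smul, smul_add]⟩

@[fun_prop] theorem fun_sub {f h : V → W} (hf : Lin K f) (hh : Lin K h) :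
    Lin K (fun x => f x - h x) :=
  ⟨fun x y => by rw [hf.add, hh.add]; abel, fun c x => by rw [hf.smul, hh.smul, smul_sub]⟩

@[fun_prop] theorem const_smul {f : V → W} (hf : Lin K f) (c : K) : Lin K (fun x => c • f x) :=
  ⟨fun x y => by rw [hf.add, smul_add], fun d x => by rw [hf.smul, smul_comm]⟩

variable {E : Type*} [Ring E] [Algebra K E]

@[fun_prop] theorem mul_const {f : V → E} (hf : Lin K f) (T : E) : Lin K (fun x => f x * T) :=
  ⟨fun x y => by rw [hf.add, add_mul], fun c x => by rw [hf.smul, smul_mul_assoc]⟩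

@[fun_prop] theorem const_mul {f : V → E} (hf : Lin K f) (T : E) : Lin K (fun x => T * f x) :=
  ⟨fun x y => by rw [hf.add, mul_add], fun c x => by rw [hf.smul, mul_smul_comm]⟩

end Lin

/-- The linear map with the values of `F` on a fixed basis. -/
def lin (F : g → W) : g →ₗ[K] W :=
  (Module.Basis.ofVectorSpace K g).constr K fun i => F (Module.Basis.ofVectorSpace K g i)

theorem lin_basis (F : g → W) (i) :
    lin (K := K) F (Module.Basis.ofVectorSpace K g i) = F (Module.Basis.ofVectorSpace K g i) :=
  Module.Basis.constr_basis _ _ _ _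

theorem lin_apply {F : g → W} (hF : Lin K F) (x : g) : lin (K := K) F x = F x := by
  let F' : g →ₗ[K] W := ⟨⟨F, hF.add⟩, hF.smul⟩
  have : lin (K := K) F = F' := (Module.Basis.ofVectorSpace K g).ext fun i => lin_basis F i
  rw [this]; rfl

theorem lin_comp (T : W →ₗ[K] U) (F : g → W) : lin (K := K) (fun x => T (F x)) = T ∘ₗ lin F :=
  (Module.Basis.ofVectorSpace K g).ext fun i => by
    rw [lin_basis, LinearMap.comp_apply, lin_basis]

/-- Both sides agree on the basis, so no linearity of `F` and `G` is needed. For this reason `sw`,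
`Lop` and `Rop` can be rearranged without side conditions. -/
theorem lin_add (F G : g → W) : lin (K := K) (fun x => F x + G x) = lin F + lin G :=
  (Module.Basis.ofVectorSpace K g).ext fun i => by
    rw [LinearMap.add_apply, lin_basis, lin_basis, lin_basis]

theorem lin_smul (c : K) (F : g → W) : lin (K := K) (fun x => c • F x) = c • lin F :=
  (Module.Basis.ofVectorSpace K g).ext fun i => by
    rw [LinearMap.smul_apply, lin_basis, lin_basis]

/-- The value of a bilinear function `B` on a tensor: `u ⊗ w ↦ B u w`. -/
def sw (t : g ⊗[K] g) (B : g → g → W) : W :=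
  TensorProduct.lift (lin fun x => lin fun y => B x y) t

theorem sw_add (t : g ⊗[K] g) (B C : g → g → W) :
    sw t (fun u w => B u w + C u w) = sw t B + sw t C := by
  simp only [sw, lin_add]
  induction t with
  | zero => simp
  | tmul => simp
  | add s t hs ht => simp only [map_add, hs, ht]; abel

theorem sw_smul (t : g ⊗[K] g) (c : K) (B : g → g → W) :
    sw t (fun u w => c • B u w) = c • sw t B := by
  simp only [sw, lin_smul]
  induction t with
  | zero => simp
  | tmul => simp
  | add s t hs ht => simp only [map_add, hs, ht, smul_add]

theorem sw_neg (t : g ⊗[K] g) (B : g → g → W) : sw t (fun u w => -B u w) = -sw t B := by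
  simpa using sw_smul t (-1) B

theorem sw_sub (t : g ⊗[K] g) (B C : g → g → W) :
    sw t (fun u w => B u w - C u w) = sw t B - sw t C := by
  simp only [sub_eq_add_neg, sw_add, sw_neg]

@[simp] theorem sw_zero (t : g ⊗[K] g) : sw t (fun _ _ => (0 : W)) = 0 := by
  simpa using sw_smul t 0 (fun _ _ => (0 : W))

@[fun_prop] theorem Lin.sw_left {t : V → g ⊗[K] g} (ht : Lin K t) (B : g → g → W) :
    Lin K (fun x => sw (t x) B) :=
  ⟨fun x y => by simp [sw, ht.add], fun c x => by simp [sw, ht.smul]⟩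

@[fun_prop] theorem Lin.sw_right (t : g ⊗[K] g) {B : V → g → g → W}
    (hB : ∀ u w, Lin K (fun x => B x u w)) : Lin K (fun x => sw t (fun u w => B x u w)) :=
  ⟨fun x y => by simp only [(hB _ _).add, sw_add], fun c x => by simp only [(hB _ _).smul, sw_smul]⟩

theorem sw_comp (T : W →ₗ[K] U) (t : g ⊗[K] g) (B : g → g → W) :
    sw t (fun u w => T (B u w)) = T (sw t B) := by
  simp only [sw, lin_comp]
  rw [show (fun x => T ∘ₗ lin (K := K) (B x)) = fun x => LinearMap.compRight K T (lin (B x)) from rfl,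
    lin_comp]
  induction t with
  | zero => simp
  | tmul => simp
  | add s t hs ht => simp only [map_add, hs, ht]

theorem sw_congr (t : g ⊗[K] g) {B C : g → g → W} (h : ∀ u w, B u w = C u w) :
    sw t B = sw t C := by
  rw [show B = C from funext fun u => funext fun w => h u w]

section

variable {E : Type*} [Ring E] [Algebra K E]

theorem mul_sw (T : E) (t : g ⊗[K] g) (B : g → g → E) :
    T * sw t B = sw t (fun u w => T * B u w) :=
  (sw_comp (LinearMap.mulLeft K T) t B).symm

theorem sw_mul (T : E) (t : g ⊗[K] g) (B : g → g → E) :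
    sw t B * T = sw t (fun u w => B u w * T) :=
  (sw_comp (LinearMap.mulRight K T) t B).symm

end

/-- Bilinearity matters only for evaluation on a pure tensor; the formal rules for `sw` above hold
for arbitrary `B`. -/
theorem sw_tmul {B : g → g → W} (hu : ∀ w, Lin K fun u => B u w)
    (hw : ∀ u, Lin K fun w => B u w) (u w : g) : sw (u ⊗ₜ[K] w) B = B u w := by
  have h1 : Lin K fun u => lin (K := K) (fun w => B u w) :=
    ⟨fun x y => LinearMap.ext fun z => by simp [lin_apply (hw _), (hu z).add],
     fun c y => LinearMap.ext fun z => by simp [lin_apply (hw _), (hu z).smul]⟩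
  rw [sw, TensorProduct.lift.tmul, lin_apply h1, lin_apply (hw u)]

theorem sw_map {B : g → g → W} (hu : ∀ w, Lin K fun u => B u w)
    (hw : ∀ u, Lin K fun w => B u w) (f h : g →ₗ[K] g) (t : g ⊗[K] g) :
    sw (TensorProduct.map f h t) B = sw t (fun u w => B (f u) (h w)) := by
  induction t with
  | zero => simp [sw]
  | tmul u w =>
    rw [TensorProduct.map_tmul, sw_tmul hu hw, sw_tmul (B := fun u w => B (f u) (h w))]
    · intro w; exact (hu (h w)).comp (Lin.coe f)
    · intro u; exact (hw (f u)).comp (Lin.coe h)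
  | add s t hs ht =>
    rw [map_add, (Lin.sw_left Lin.id _).add, hs, ht, (Lin.sw_left Lin.id _).add]

theorem sw_comm {B : g → g → W} (hu : ∀ w, Lin K fun u => B u w)
    (hw : ∀ u, Lin K fun w => B u w) (t : g ⊗[K] g) :
    sw (TensorProduct.comm K g g t) B = sw t (fun u w => B w u) := by
  induction t with
  | zero => simp [sw]
  | tmul u w =>
    rw [TensorProduct.comm_tmul, sw_tmul hu hw, sw_tmul (B := fun u w => B w u) hw hu]
  | add s t hs ht =>
    rw [map_add, (Lin.sw_left Lin.id _).add, hs, ht, (Lin.sw_left Lin.id _).add]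

end Linear

/-! ### Left multiplications, the coproduct and the induction principle -/

/-- The algebra of linear endomorphisms of `Λ g`. -/
abbrev Op (K : Type*) [Field K] (g : Type*) [AddCommGroup g] [Module K g] :=
  Module.End K (ExteriorAlgebra K g)

/-- Left multiplication by an element of `g`. -/
def wedge : g →ₗ[K] Op K g := LinearMap.mul K (ExteriorAlgebra K g) ∘ₗ ExteriorAlgebra.ι K

theorem wedge_apply (v : g) (x : ExteriorAlgebra K g) :
    wedge v x = ExteriorAlgebra.ι K v * x := rfl

theorem wedge_mul_self (v : g) : wedge (K := K) v * wedge v = 0 := by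
  refine LinearMap.ext fun x => ?_
  simp [wedge_apply, Module.End.mul_apply, ← mul_assoc]

theorem wedge_mul_wedge (u v : g) : wedge (K := K) u * wedge v = -(wedge v * wedge u) := by
  have h := wedge_mul_self (K := K) (u + v)
  simp only [map_add, mul_add, add_mul, wedge_mul_self, zero_add, add_zero] at h
  exact eq_neg_of_add_eq_zero_right h

theorem ext_induction {P : ExteriorAlgebra K g → Prop} (h1 : P 1)
    (smul : ∀ (c : K) x, P x → P (c • x)) (add : ∀ x y, P x → P y → P (x + y))
    (mul : ∀ v x, P x → P (wedge v x)) (x : ExteriorAlgebra K g) : P x := by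
  induction x using CliffordAlgebra.left_induction with
  | algebraMap r => rw [Algebra.algebraMap_eq_smul_one]; exact smul _ _ h1
  | add x y hx hy => exact add x y hx hy
  | ι_mul x v hx => exact mul v x hx

/-- A family of operators that kills `1` and is stable under right multiplication by `wedge v` up to
left factors is zero. -/
theorem op_eq_zero {I : Type*} (T : I → Op K g) (h1 : ∀ i, T i 1 = 0)
    (h : ∀ i v, ∃ (j : I) (B : Op K g), T i * wedge v = B * T j) (i : I) : T i = 0 := by
  refine LinearMap.ext fun x => ?_
  -- Passing `wedge v` may change the index, so all members of the family are treated at once.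
  induction x using ext_induction generalizing i with
  | h1 => exact h1 i
  | smul c x hx => rw [map_smul, hx, LinearMap.zero_apply, LinearMap.zero_apply, smul_zero]
  | add x y hx hy => rw [map_add, hx, hy]; simp
  | mul v x hx =>
    obtain ⟨j, B, hj⟩ := h i v
    rw [← Module.End.mul_apply, hj, Module.End.mul_apply, hx]; simp

theorem ι_mem (v : g) : ExteriorAlgebra.ι K v ∈ ⋀[K]^1 g := by
  change ExteriorAlgebra.ι K v ∈ LinearMap.range (ExteriorAlgebra.ι K (M := g)) ^ 1
  rw [pow_one]
  exact LinearMap.mem_range_self _ v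

theorem sgn_one : sgn (K := K) (g := g) 1 = 1 := map_one CliffordAlgebra.involute

theorem sgn_mul (x y : ExteriorAlgebra K g) : sgn (x * y) = sgn x * sgn y :=
  map_mul CliffordAlgebra.involute x y

theorem sgn_ι (v : g) : sgn (ExteriorAlgebra.ι K v) = -ExteriorAlgebra.ι K v :=
  CliffordAlgebra.involute_ι v

theorem sgn_mul_wedge (v : g) : sgn * wedge (K := K) v = -(wedge v * sgn) := by
  refine LinearMap.ext fun x => ?_
  simp [Module.End.mul_apply, wedge_apply, sgn_mul, sgn_ι]

theorem sgn_mul_sgn : sgn * sgn = (1 : Op K g) :=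
  LinearMap.ext fun x => CliffordAlgebra.involute_involutive x

theorem sgn_of_mem {n : ℕ} {x : ExteriorAlgebra K g} (hx : x ∈ ⋀[K]^n g) :
    sgn x = (-1 : K) ^ n • x := by
  induction hx using Submodule.pow_induction_on_left' with
  | algebraMap r => simp [Algebra.algebraMap_eq_smul_one, sgn_one]
  | add x y i _ _ hx hy => rw [map_add, hx, hy, smul_add]
  | mem_mul m hm i x _ hx =>
    obtain ⟨v, rfl⟩ := hm
    rw [sgn_mul, hx, sgn_ι, pow_succ]
    simp

theorem comul_one : comul (K := K) (g := g) 1 = 1 ⊗ₜ 1 := by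
  rw [comul, LinearMap.comp_apply, AlgHom.toLinearMap_apply, map_one]
  rfl

/-- This is multiplication by `v ⊗ 1 + 1 ⊗ v`; moving `v` past the first factor costs the Koszul
sign, recorded by `sgn`. From here on the graded tensor product is no longer needed. -/
theorem comul_wedge (v : g) (x : ExteriorAlgebra K g) :
    comul (wedge v x) = TensorProduct.map (wedge v) LinearMap.id (comul x) +
      TensorProduct.map sgn (wedge v) (comul x) := by
  have key : ∀ t : GradedSquare K g,
      (GradedTensorProduct.of K (fun i : ℕ => ⋀[K]^i g) (fun i : ℕ => ⋀[K]^i g)).symm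
        (primitive v * t) =
      TensorProduct.map (wedge v) LinearMap.id
        ((GradedTensorProduct.of K (fun i : ℕ => ⋀[K]^i g) (fun i : ℕ => ⋀[K]^i g)).symm t) +
      TensorProduct.map sgn (wedge v)
        ((GradedTensorProduct.of K (fun i : ℕ => ⋀[K]^i g) (fun i : ℕ => ⋀[K]^i g)).symm t) := by
    intro t
    obtain ⟨t, rfl⟩ := (GradedTensorProduct.of K (fun i : ℕ => ⋀[K]^i g)
      (fun i : ℕ => ⋀[K]^i g)).surjective t
    induction t with
    | zero => simp
    | add s t hs ht => simp only [map_add, mul_add, hs, ht]; abel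
    | tmul a b =>
      induction a using DirectSum.Decomposition.inductionOn fun i : ℕ => ⋀[K]^i g with
      | zero => simp
      | add a a' ha ha' =>
        simp only [TensorProduct.add_tmul, map_add, mul_add, ha, ha']; abel
      | @homogeneous n a =>
        have h1 := GradedTensorProduct.tmul_coe_mul_coe_tmul (R := K) (fun i : ℕ => ⋀[K]^i g)
          (fun i : ℕ => ⋀[K]^i g) (j₁ := 1) (i₂ := n) 1 ⟨_, ι_mem v⟩ a b
        have h2 := GradedTensorProduct.tmul_one_mul_coe_tmul (R := K) (fun i : ℕ => ⋀[K]^i g)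
          (fun i : ℕ => ⋀[K]^i g) (i₂ := n) (ExteriorAlgebra.ι K v) a b
        have hp : (primitive v : GradedSquare K g) =
            GradedTensorProduct.tmul K (ExteriorAlgebra.ι K v) 1 +
            GradedTensorProduct.tmul K 1 (ExteriorAlgebra.ι K v) := rfl
        have ht : (GradedTensorProduct.of K (fun i : ℕ => ⋀[K]^i g) (fun i : ℕ => ⋀[K]^i g))
            ((a : ExteriorAlgebra K g) ⊗ₜ b) = GradedTensorProduct.tmul K (a : ExteriorAlgebra K g) b :=
          rfl
        have hs := sgn_of_mem a.2
        rw [hp, ht, add_mul, h1, h2, map_add, one_mul, one_mul]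
        congr 1
        change _ = sgn (a : ExteriorAlgebra K g) ⊗ₜ[K] (ExteriorAlgebra.ι K v * b)
        rw [hs]
        rcases Nat.even_or_odd n with hn | hn
        · rw [hn.neg_one_pow, hn.neg_one_pow, one_smul, one_smul]; rfl
        · rw [hn.neg_one_pow, hn.neg_one_pow, Units.smul_def, Units.val_neg, Units.val_one,
            neg_smul, neg_smul, one_smul, one_smul, map_neg, TensorProduct.neg_tmul]; rfl
  simp only [comul, LinearMap.comp_apply, wedge_apply, AlgHom.toLinearMap_apply, map_mul,
    ExteriorAlgebra.lift_ι_apply]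
  exact key _

/-- The counit of `Λ g`. -/
abbrev counit : ExteriorAlgebra K g →ₗ[K] K := ExteriorAlgebra.algebraMapInv.toLinearMap

theorem counit_wedge (v : g) (x : ExteriorAlgebra K g) : counit (wedge v x) = 0 := by
  simp [counit, wedge_apply, ExteriorAlgebra.algebraMapInv]

theorem counit_sgn (x : ExteriorAlgebra K g) : counit (sgn x) = counit x := by
  induction x using ext_induction with
  | h1 => rw [sgn_one]
  | smul c x hx => simp only [map_smul, hx]
  | add x y hx hy => simp only [map_add, hx, hy]
  | mul v x hx =>
    rw [← Module.End.mul_apply, sgn_mul_wedge, LinearMap.neg_apply, map_neg, Module.End.mul_apply,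
      counit_wedge, counit_wedge, neg_zero]

theorem counit_comul (x : ExteriorAlgebra K g) :
    TensorProduct.map counit LinearMap.id (comul x) = (1 : K) ⊗ₜ[K] x := by
  induction x using ext_induction with
  | h1 => simp [comul_one]
  | smul c x hx => simp only [map_smul, hx, TensorProduct.tmul_smul]
  | add x y hx hy => simp only [map_add, hx, hy, TensorProduct.tmul_add]
  | mul v x hx =>
    have h1 : counit ∘ₗ wedge v = (0 : ExteriorAlgebra K g →ₗ[K] K) :=
      LinearMap.ext (counit_wedge v)
    have h2 : counit ∘ₗ sgn = (counit : ExteriorAlgebra K g →ₗ[K] K) := LinearMap.ext counit_sgn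
    have h3 : TensorProduct.map counit (wedge v) (comul x) =
        TensorProduct.map LinearMap.id (wedge v)
          (TensorProduct.map counit LinearMap.id (comul x)) := by
      rw [TensorProduct.map_map]; rfl
    rw [comul_wedge, map_add, TensorProduct.map_map, TensorProduct.map_map, h1, h2,
      TensorProduct.map_zero_left, LinearMap.zero_apply, zero_add, LinearMap.id_comp, h3, hx,
      TensorProduct.map_tmul, LinearMap.id_apply]

theorem comul_counit (x : ExteriorAlgebra K g) :
    TensorProduct.map LinearMap.id counit (comul x) = x ⊗ₜ[K] (1 : K) := by
  induction x using ext_induction with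
  | h1 => simp [comul_one]
  | smul c x hx => simp only [map_smul, hx, TensorProduct.smul_tmul']
  | add x y hx hy => simp only [map_add, hx, hy, TensorProduct.add_tmul]
  | mul v x hx =>
    have h1 : counit ∘ₗ wedge v = (0 : ExteriorAlgebra K g →ₗ[K] K) :=
      LinearMap.ext (counit_wedge v)
    have h3 : TensorProduct.map (wedge v) counit (comul x) =
        TensorProduct.map (wedge v) LinearMap.id
          (TensorProduct.map LinearMap.id counit (comul x)) := by
      rw [TensorProduct.map_map]; rfl
    rw [comul_wedge, map_add, TensorProduct.map_map, TensorProduct.map_map, h1,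
      TensorProduct.map_zero_right, LinearMap.zero_apply, add_zero, LinearMap.id_comp,
      LinearMap.comp_id, h3, hx, TensorProduct.map_tmul, LinearMap.id_apply]

theorem ιInv_one : ExteriorAlgebra.ιInv (1 : ExteriorAlgebra K g) = 0 := by
  -- `ιInv` is the second component of the map to the trivial square-zero extension, whose ring
  -- structure needs a right action of `K` on `g`.
  let : Module Kᵐᵒᵖ g := Module.compHom _ ((RingHom.id K).fromOpposite mul_comm)
  have : IsCentralScalar K g := ⟨fun r m => rfl⟩
  change (ExteriorAlgebra.toTrivSqZeroExt (1 : ExteriorAlgebra K g)).snd = 0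
  rw [map_one, TrivSqZeroExt.snd_one]

theorem ιInv_ι (v : g) : ExteriorAlgebra.ιInv (ExteriorAlgebra.ι K v) = v :=
  ExteriorAlgebra.ι_leftInverse v

/-- In the square-zero extension `K ⊕ g` the factor `v` is only multiplied by the scalar part of
`x`. -/
theorem ιInv_wedge (v : g) (x : ExteriorAlgebra K g) :
    ExteriorAlgebra.ιInv (wedge v x) = counit x • v := by
  let : Module Kᵐᵒᵖ g := Module.compHom _ ((RingHom.id K).fromOpposite mul_comm)
  have : IsCentralScalar K g := ⟨fun r m => rfl⟩
  have h : (TrivSqZeroExt.fstHom K K g).comp ExteriorAlgebra.toTrivSqZeroExt =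
      ExteriorAlgebra.algebraMapInv := by
    ext; simp [ExteriorAlgebra.algebraMapInv]
  have hx : (ExteriorAlgebra.toTrivSqZeroExt x).fst = counit x := DFunLike.congr_fun h x
  change (ExteriorAlgebra.toTrivSqZeroExt (ExteriorAlgebra.ι K v * x)).snd = _
  rw [map_mul, ExteriorAlgebra.toTrivSqZeroExt_ι, TrivSqZeroExt.snd_mul, TrivSqZeroExt.fst_inr,
    TrivSqZeroExt.snd_inr, zero_smul, zero_add, hx]
  rfl

theorem op_mul_neg (S T : Op K g) : S * -T = -(S * T) := mul_neg S T

theorem op_neg_mul (S T : Op K g) : -S * T = -(S * T) := neg_mul S T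

theorem map_neg_left {V W V' W' : Type*} [AddCommGroup V] [Module K V] [AddCommGroup W] [Module K W]
    [AddCommGroup V'] [Module K V'] [AddCommGroup W'] [Module K W'] (f : V →ₗ[K] V')
    (h : W →ₗ[K] W') (t : V ⊗[K] W) :
    TensorProduct.map (-f) h t = -TensorProduct.map f h t := by
  induction t with
  | zero => simp
  | add s t hs ht => rw [map_add, map_add, hs, ht, neg_add]
  | tmul x y => simp [TensorProduct.neg_tmul]

theorem sgn_sgn (x : ExteriorAlgebra K g) : sgn (sgn x) = x :=
  CliffordAlgebra.involute_involutive x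

theorem sgn_wedge (v : g) (x : ExteriorAlgebra K g) : sgn (wedge v x) = -wedge v (sgn x) := by
  rw [wedge_apply, sgn_mul, sgn_ι, neg_mul, wedge_apply]

theorem mul_ι (x : ExteriorAlgebra K g) (w : g) :
    x * ExteriorAlgebra.ι K w = wedge w (sgn x) := by
  induction x using ext_induction with
  | h1 => rw [sgn_one, one_mul, wedge_apply, mul_one]
  | smul c x hx => rw [smul_mul_assoc, hx, map_smul, map_smul]
  | add x y hx hy => rw [add_mul, hx, hy, map_add, map_add]
  | mul v x hx =>
    rw [wedge_apply v x, mul_assoc, hx, sgn_mul, sgn_ι, neg_mul, map_neg, ← wedge_apply,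
      ← wedge_apply, ← Module.End.mul_apply, wedge_mul_wedge]
    rfl

theorem mul_map_wedge_left (w : g) (f h : Op K g)
    (t : ExteriorAlgebra K g ⊗[K] ExteriorAlgebra K g) :
    mul (TensorProduct.map (wedge w * f) h t) = wedge w (mul (TensorProduct.map f h t)) := by
  induction t with
  | zero => simp
  | add s t hs ht => simp only [map_add, hs, ht]
  | tmul x y => exact mul_assoc (ExteriorAlgebra.ι K w) (f x) (h y)

theorem mul_map_wedge_right (w : g) (f h : Op K g)
    (t : ExteriorAlgebra K g ⊗[K] ExteriorAlgebra K g) :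
    mul (TensorProduct.map f (wedge w * h) t) = wedge w (mul (TensorProduct.map (sgn * f) h t)) := by
  induction t with
  | zero => simp
  | add s t hs ht => simp only [map_add, hs, ht]
  | tmul x y =>
    change f x * (ExteriorAlgebra.ι K w * h y) = wedge w (sgn (f x) * h y)
    rw [← mul_assoc, mul_ι]
    exact mul_assoc _ _ _

/-! ### Contraction of one argument -/

/-- `x ↦ pr x₁ ⊗ x₂`, with values in `g ⊗ Λ g`. -/
def split : ExteriorAlgebra K g →ₗ[K] g ⊗[K] ExteriorAlgebra K g :=
  TensorProduct.map ExteriorAlgebra.ιInv LinearMap.id ∘ₗ comul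

theorem ιInv_sgn (x : ExteriorAlgebra K g) :
    ExteriorAlgebra.ιInv (sgn x) = -ExteriorAlgebra.ιInv x := by
  induction x using ext_induction with
  | h1 => rw [sgn_one, ιInv_one, neg_zero]
  | smul c x hx => rw [map_smul, map_smul, hx, map_smul, smul_neg]
  | add x y hx hy => rw [map_add, map_add, hx, hy, map_add, neg_add]
  | mul v x hx => rw [sgn_wedge, map_neg, ιInv_wedge, ιInv_wedge, counit_sgn]

theorem ιInv_comp_sgn :
    ExteriorAlgebra.ιInv ∘ₗ sgn = -(ExteriorAlgebra.ιInv : ExteriorAlgebra K g →ₗ[K] g) :=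
  LinearMap.ext ιInv_sgn

theorem ιInv_comp_wedge (v : g) :
    ExteriorAlgebra.ιInv ∘ₗ wedge v = LinearMap.toSpanSingleton K g v ∘ₗ counit :=
  LinearMap.ext (ιInv_wedge v)

theorem map_counit_left {W : Type*} [AddCommGroup W] [Module K W] (v : g)
    (h : ExteriorAlgebra K g →ₗ[K] W) (x : ExteriorAlgebra K g) :
    TensorProduct.map (LinearMap.toSpanSingleton K g v ∘ₗ counit) h (comul x) = v ⊗ₜ h x := by
  have : TensorProduct.map (LinearMap.toSpanSingleton K g v ∘ₗ counit) h (comul x) =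
      TensorProduct.map (LinearMap.toSpanSingleton K g v) h
        (TensorProduct.map counit LinearMap.id (comul x)) := by
    rw [TensorProduct.map_map]; rfl
  rw [this, counit_comul, TensorProduct.map_tmul, LinearMap.toSpanSingleton_apply, one_smul]

theorem map_counit_right {W : Type*} [AddCommGroup W] [Module K W] (v : g)
    (h : ExteriorAlgebra K g →ₗ[K] W) (x : ExteriorAlgebra K g) :
    TensorProduct.map h (LinearMap.toSpanSingleton K g v ∘ₗ counit) (comul x) = h x ⊗ₜ v := by
  have : TensorProduct.map h (LinearMap.toSpanSingleton K g v ∘ₗ counit) (comul x) =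
      TensorProduct.map h (LinearMap.toSpanSingleton K g v)
        (TensorProduct.map LinearMap.id counit (comul x)) := by
    rw [TensorProduct.map_map]; rfl
  rw [this, comul_counit, TensorProduct.map_tmul, LinearMap.toSpanSingleton_apply, one_smul]

theorem split_one : split (1 : ExteriorAlgebra K g) = 0 := by
  rw [split, LinearMap.comp_apply, comul_one, TensorProduct.map_tmul, ιInv_one,
    TensorProduct.zero_tmul]

/-- Either `v` itself is split off or it stays behind; in the second case `sgn` acts on the
degree-one part that is split off and gives the minus sign. -/
theorem split_wedge (v : g) (x : ExteriorAlgebra K g) :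
    split (wedge v x) = v ⊗ₜ x - TensorProduct.map LinearMap.id (wedge v) (split x) := by
  rw [split, LinearMap.comp_apply, comul_wedge, map_add, TensorProduct.map_map,
    TensorProduct.map_map, ιInv_comp_wedge, ιInv_comp_sgn, LinearMap.comp_id, map_counit_left,
    LinearMap.comp_apply, TensorProduct.map_map, LinearMap.id_comp, LinearMap.comp_id,
    LinearMap.id_comp, LinearMap.id_apply, sub_eq_add_neg]
  congr 1
  exact map_neg_left _ _ _

section

variable {W V : Type*} [AddCommGroup W] [Module K W] [AddCommGroup V] [Module K V]

theorem lift_lin_map (F : g → W →ₗ[K] V) (T : W →ₗ[K] W) (t : g ⊗[K] W) :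
    TensorProduct.lift (lin F) (TensorProduct.map LinearMap.id T t) =
      TensorProduct.lift (lin fun x => F x ∘ₗ T) t := by
  have h : lin (K := K) (fun x => F x ∘ₗ T) = LinearMap.lcomp K V T ∘ₗ lin F :=
    lin_comp (LinearMap.lcomp K V T) F
  rw [h]
  induction t with
  | zero => simp
  | add s t hs ht => simp only [map_add, hs, ht]
  | tmul x y => simp

end

/-- `x ↦ F (pr x₁) x₂`. -/
def Lop (F : g → Op K g) : Op K g := TensorProduct.lift (lin F) ∘ₗ split

theorem Lop_one (F : g → Op K g) : Lop F 1 = 0 := by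
  rw [Lop, LinearMap.comp_apply, split_one, map_zero]

/-- Together with `Lop_one` this recursion determines `Lop F` for linear `F`: the argument `v` is
either the contracted one or a spectator. -/
theorem Lop_mul_wedge {F : g → Op K g} (hF : Lin K F) (v : g) :
    Lop F * wedge v = F v - Lop fun x => F x * wedge v := by
  refine LinearMap.ext fun x => ?_
  rw [Module.End.mul_apply, Lop, LinearMap.comp_apply, split_wedge, map_sub, lift_lin_map,
    TensorProduct.lift.tmul, lin_apply hF]
  rfl

theorem mul_Lop (T : Op K g) (F : g → Op K g) : T * Lop F = Lop fun x => T * F x := by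
  have h : lin (K := K) (fun x => T * F x) = LinearMap.mulLeft K T ∘ₗ lin F :=
    lin_comp (LinearMap.mulLeft K T) F
  refine LinearMap.ext fun x => ?_
  rw [Lop, Lop, h, Module.End.mul_apply, LinearMap.comp_apply, LinearMap.comp_apply]
  induction split x with
  | zero => simp
  | add s t hs ht => simp only [map_add, hs, ht]
  | tmul x y => simp

theorem Lop_add (F G : g → Op K g) : Lop (fun x => F x + G x) = Lop F + Lop G := by
  rw [Lop, lin_add]
  refine LinearMap.ext fun x => ?_
  rw [LinearMap.add_apply, Lop, Lop, LinearMap.comp_apply, LinearMap.comp_apply,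
    LinearMap.comp_apply]
  induction split x with
  | zero => simp
  | add s t hs ht => simp only [map_add, hs, ht]; abel
  | tmul x y => simp

/-! ### The operators defined by the bracket -/

variable (ν : g →ₗ[K] g →ₗ[K] g) (δ : g →ₗ[K] g ⊗[K] g) (α : g →ₗ[K] g)

theorem extMap_one : extMap α 1 = 1 := map_one (ExteriorAlgebra.map α)

theorem extMap_mul_wedge (v : g) : extMap α * wedge v = wedge (α v) * extMap α := by
  refine LinearMap.ext fun x => ?_
  change ExteriorAlgebra.map α (ExteriorAlgebra.ι K v * x) = _
  rw [map_mul, ExteriorAlgebra.map_apply_ι]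
  rfl

theorem sgn_mul_extMap : sgn * extMap α = extMap α * sgn := by
  rw [← sub_eq_zero]
  refine op_eq_zero (fun _ : Unit => sgn * extMap α - extMap α * sgn) (fun _ => ?_)
    (fun _ v => ⟨(), -wedge (α v), ?_⟩) ()
  · simp [extMap_one, sgn_one]
  · rw [sub_mul, mul_assoc, extMap_mul_wedge, mul_assoc, sgn_mul_wedge, ← mul_assoc, sgn_mul_wedge,
      op_mul_neg, ← mul_assoc, extMap_mul_wedge, op_neg_mul, op_neg_mul, mul_sub, mul_assoc,
      mul_assoc, neg_sub_neg, neg_sub]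

/-- The components `v ⊗ pr x` and `-pr x ⊗ v` of `Δ (v ∧ x)` have the same bracket by skew symmetry,
which cancels the factor `2⁻¹`. -/
theorem hatBracket_wedge [CharZero K] (hν : ∀ x y, ν x y = -ν y x) (v : g) (x : ExteriorAlgebra K g) :
    hatBracket ν (wedge v x) = ExteriorAlgebra.ι K (ν v (ExteriorAlgebra.ιInv x)) := by
  simp only [hatBracket, LinearMap.smul_apply, LinearMap.comp_apply]
  rw [comul_wedge, map_add, TensorProduct.map_map, TensorProduct.map_map, ιInv_comp_wedge,
    ιInv_comp_sgn, LinearMap.comp_id, map_counit_left, map_counit_right, LinearMap.neg_apply,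
    map_add, TensorProduct.lift.tmul, TensorProduct.lift.tmul, map_neg, LinearMap.neg_apply,
    ← hν, ← two_smul K, map_smul, smul_smul, inv_mul_cancel₀ two_ne_zero, one_smul]

theorem hatBracket_mul_ι [CharZero K] (hν : ∀ x y, ν x y = -ν y x) (x : ExteriorAlgebra K g) (w : g) :
    hatBracket ν (x * ExteriorAlgebra.ι K w) = ExteriorAlgebra.ι K (ν (ExteriorAlgebra.ιInv x) w) := by
  rw [mul_ι, hatBracket_wedge ν hν, ιInv_sgn, map_neg, ← hν]

theorem hatBracket_one : hatBracket ν 1 = 0 := by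
  simp only [hatBracket, LinearMap.smul_apply, LinearMap.comp_apply]
  rw [comul_one, TensorProduct.map_tmul, ιInv_one, TensorProduct.zero_tmul, map_zero, map_zero,
    smul_zero]

/-- The adjoint action of an element of `g` on `Λ g`. -/
def ad : g →ₗ[K] Op K g := TensorProduct.curry (act ν α) ∘ₗ ExteriorAlgebra.ι K

theorem act_tmul [CharZero K] (hν : ∀ x y, ν x y = -ν y x) (b c : ExteriorAlgebra K g) :
    act ν α (b ⊗ₜ c) = mul (TensorProduct.map
      (ExteriorAlgebra.ι K ∘ₗ ν (ExteriorAlgebra.ιInv b)) (extMap α) (split c)) := by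
  simp only [act, contract, LinearMap.comp_apply, TensorProduct.map_tmul, LinearMap.id_apply, split]
  induction comul c with
  | zero => simp
  | add s t hs ht => simp only [map_add, TensorProduct.tmul_add, hs, ht]
  | tmul x y =>
    simp only [TensorProduct.map_tmul, LinearEquiv.coe_coe, TensorProduct.assoc_symm_tmul, mul,
      LinearMap.mul'_apply, pr, LinearMap.comp_apply, hatBracket_mul_ι ν hν, LinearMap.id_apply]

theorem act_eq [CharZero K] (hν : ∀ x y, ν x y = -ν y x) (b c : ExteriorAlgebra K g) :
    act ν α (b ⊗ₜ c) = ad ν α (ExteriorAlgebra.ιInv b) c := by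
  change _ = act ν α (_ ⊗ₜ _)
  rw [act_tmul ν α hν, act_tmul ν α hν, ιInv_ι]

theorem ad_apply [CharZero K] (hν : ∀ x y, ν x y = -ν y x) (u : g) (x : ExteriorAlgebra K g) :
    ad ν α u x = mul (TensorProduct.map (ExteriorAlgebra.ι K ∘ₗ ν u) (extMap α) (split x)) := by
  change act ν α (_ ⊗ₜ _) = _
  rw [act_tmul ν α hν, ιInv_ι]

theorem ad_one [CharZero K] (hν : ∀ x y, ν x y = -ν y x) (u : g) : ad ν α u 1 = 0 := by
  rw [ad_apply ν α hν, split_one, map_zero, map_zero]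

/-- The even twisted derivation rule: the sign in `split_wedge` cancels the one from moving `α v`
past the bracket. -/
theorem ad_mul_wedge [CharZero K] (hν : ∀ x y, ν x y = -ν y x) (u v : g) :
    ad ν α u * wedge v = wedge (ν u v) * extMap α + wedge (α v) * ad ν α u := by
  refine LinearMap.ext fun x => ?_
  rw [Module.End.mul_apply, ad_apply ν α hν, split_wedge, map_sub, map_sub, TensorProduct.map_tmul,
    LinearMap.add_apply, Module.End.mul_apply, Module.End.mul_apply, ad_apply ν α hν, sub_eq_add_neg]
  congr 1
  rw [TensorProduct.map_map, LinearMap.comp_id, ← Module.End.mul_eq_comp, extMap_mul_wedge]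
  induction split x with
  | zero => simp
  | add s t hs ht => simp only [map_add, neg_add, hs, ht]
  | tmul y z =>
    change -(ExteriorAlgebra.ι K (ν u y) * (ExteriorAlgebra.ι K (α v) * extMap α z)) =
      ExteriorAlgebra.ι K (α v) * (ExteriorAlgebra.ι K (ν u y) * extMap α z)
    rw [← mul_assoc, mul_ι, sgn_ι, map_neg, neg_mul, neg_neg]
    exact mul_assoc _ _ _

/-- The Hom-Chevalley-Eilenberg boundary operator, `x ↦ ± α x₁ ∧ ν x₂`. -/
def bdry : Op K g := mul ∘ₗ koszul 1 (extMap α) (hatBracket ν) ∘ₗ comul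

theorem bdry_one : bdry ν α 1 = 0 := by
  simp only [bdry, koszul, LinearMap.comp_apply]
  rw [comul_one, TensorProduct.map_tmul, hatBracket_one, TensorProduct.tmul_zero, map_zero]

/-- Contracting the last argument instead of the first gives an operator with the same recursion.
This form is needed because `bdry` has the bracket in the second tensor factor. -/
theorem ad_eq [CharZero K] (hν : ∀ x y, ν x y = -ν y x) (v : g) :
    ad ν α v = mul ∘ₗ TensorProduct.map (extMap α)
      (ExteriorAlgebra.ι K ∘ₗ ν v ∘ₗ ExteriorAlgebra.ιInv) ∘ₗ comul := by
  rw [← sub_eq_zero]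
  refine op_eq_zero (fun _ : Unit => ad ν α v - mul ∘ₗ TensorProduct.map (extMap α)
      (ExteriorAlgebra.ι K ∘ₗ ν v ∘ₗ ExteriorAlgebra.ιInv) ∘ₗ comul) (fun _ => ?_)
    (fun _ w => ⟨(), wedge (α w), ?_⟩) ()
  · rw [LinearMap.sub_apply, ad_one ν α hν, LinearMap.comp_apply, LinearMap.comp_apply, comul_one,
      TensorProduct.map_tmul, LinearMap.comp_apply, LinearMap.comp_apply, ιInv_one]
    simp
  · rw [sub_mul, ad_mul_wedge ν α hν, mul_sub]
    suffices h : (mul ∘ₗ TensorProduct.map (extMap α)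
        (ExteriorAlgebra.ι K ∘ₗ ν v ∘ₗ ExteriorAlgebra.ιInv) ∘ₗ comul) * wedge w =
        wedge (ν v w) * extMap α + wedge (α w) * (mul ∘ₗ TensorProduct.map (extMap α)
        (ExteriorAlgebra.ι K ∘ₗ ν v ∘ₗ ExteriorAlgebra.ιInv) ∘ₗ comul) by
      rw [h]; abel
    refine LinearMap.ext fun x => ?_
    simp only [Module.End.mul_apply, LinearMap.comp_apply, LinearMap.add_apply]
    rw [comul_wedge, map_add, map_add, TensorProduct.map_map, TensorProduct.map_map,
      ← Module.End.mul_eq_comp, extMap_mul_wedge, LinearMap.comp_id, mul_map_wedge_left, add_comm]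
    congr 1
    rw [LinearMap.comp_assoc, LinearMap.comp_assoc, ιInv_comp_wedge]
    have : ExteriorAlgebra.ι K ∘ₗ ν v ∘ₗ LinearMap.toSpanSingleton K g w ∘ₗ counit =
       wedge (ν v w) * (Algebra.linearMap K (ExteriorAlgebra K g) ∘ₗ counit) := by
      refine LinearMap.ext fun y => ?_
      simp [wedge_apply, Module.End.mul_apply, Algebra.algebraMap_eq_smul_one]
    rw [this, mul_map_wedge_right, ← Module.End.mul_eq_comp]
    congr 1
    have : TensorProduct.map (sgn * (extMap α * sgn)) (Algebra.linearMap K (ExteriorAlgebra K g) ∘ₗ counit)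
      (comul x) = TensorProduct.map (sgn * (extMap α * sgn)) (Algebra.linearMap K (ExteriorAlgebra K g)) (TensorProduct.map LinearMap.id counit (comul x)) := by
      rw [TensorProduct.map_map]; rfl
    rw [this, comul_counit, TensorProduct.map_tmul, ← sgn_mul_extMap, ← mul_assoc, sgn_mul_sgn]
    simp [mul]

/-- If `v` stays outside the bracket, the odd degree of `ν` gives a sign. If `v` enters the bracket,
the two signs `sgn` cancel and the sum over the other argument is `ad v`, in the form of `ad_eq`. -/
theorem bdry_mul_wedge [CharZero K] (hν : ∀ x y, ν x y = -ν y x) (v : g) :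
    bdry ν α * wedge v = -(wedge (α v) * bdry ν α) + ad ν α v := by
  refine LinearMap.ext fun x => ?_
  simp only [Module.End.mul_apply, LinearMap.add_apply, LinearMap.neg_apply, bdry, koszul,
    LinearMap.comp_apply, pow_one]
  have h1 : (extMap α ∘ₗ sgn) ∘ₗ sgn = extMap α := by
    change (extMap α * sgn) * sgn = _
    rw [mul_assoc, sgn_mul_sgn, mul_one]
  have h2 : (extMap α ∘ₗ sgn) ∘ₗ wedge v = -(wedge (α v) * (extMap α * sgn)) := by
    change (extMap α * sgn) * wedge v = _
    rw [mul_assoc, sgn_mul_wedge, op_mul_neg, ← mul_assoc, extMap_mul_wedge, mul_assoc]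
  have h3 := ad_eq ν α hν v
  rw [comul_wedge, map_add, map_add, TensorProduct.map_map, TensorProduct.map_map,
    LinearMap.comp_id]
  rw [h1, h2, h3]
  congr 1
  · rw [map_neg_left, map_neg, mul_map_wedge_left]; rfl
  · have : hatBracket ν ∘ₗ wedge v = ExteriorAlgebra.ι K ∘ₗ ν v ∘ₗ ExteriorAlgebra.ιInv :=
      LinearMap.ext (hatBracket_wedge ν hν v)
    rw [this]; rfl

/-! ### The operators defined by the cobracket -/

variable (δ : g →ₗ[K] g ⊗[K] g) (α : g →ₗ[K] g)

/-- `x ↦ (1/2) x₁ ∧ x₂` for `δ x = x₁ ⊗ x₂`, as a left multiplication. -/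
def cowedge : g →ₗ[K] Op K g :=
  LinearMap.mul K (ExteriorAlgebra K g) ∘ₗ hatCobracket δ ∘ₗ ExteriorAlgebra.ι K

theorem cowedge_apply (v : g) (x : ExteriorAlgebra K g) :
    cowedge δ v x = hatCobracket δ (ExteriorAlgebra.ι K v) * x := rfl

theorem lift_eq_sw {W V : Type*} [AddCommGroup W] [Module K W] [AddCommGroup V] [Module K V]
    (F : g →ₗ[K] W →ₗ[K] V) (h : g →ₗ[K] W) (t : g ⊗[K] g) :
    TensorProduct.lift F (TensorProduct.map LinearMap.id h t) = sw t fun u w => F u (h w) := by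
  induction t with
  | zero => simp [sw]
  | add s t hs ht => rw [map_add, map_add, hs, ht, (Lin.sw_left Lin.id _).add]
  | tmul u w =>
    rw [sw_tmul (fun w => by fun_prop) (fun u => by fun_prop), TensorProduct.map_tmul,
      TensorProduct.lift.tmul, LinearMap.id_apply]

theorem sw_apply {V : Type*} [AddCommGroup V] [Module K V] (t : g ⊗[K] g)
    (B : g → g → Module.End K V) (x : V) : sw t B x = sw t fun u w => B u w x :=
  (sw_comp (LinearMap.applyₗ x) t B).symm

theorem hatCobracket_ι (v : g) : hatCobracket δ (ExteriorAlgebra.ι K v) =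
    (2⁻¹ : K) • sw (δ v) fun u w => ExteriorAlgebra.ι K u * ExteriorAlgebra.ι K w := by
  simp only [hatCobracket, LinearMap.smul_apply, LinearMap.comp_apply, ιInv_ι]
  congr 1
  induction δ v with
  | zero => simp [sw]
  | add s t hs ht => rw [map_add, map_add, hs, ht, (Lin.sw_left Lin.id _).add]
  | tmul u w =>
    rw [sw_tmul (fun w => by fun_prop) (fun u => by fun_prop)]
    simp [mul]

theorem cowedge_eq (v : g) :
    cowedge δ v = (2⁻¹ : K) • sw (δ v) fun u w => wedge u * wedge w := by
  refine LinearMap.ext fun x => ?_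
  rw [cowedge_apply, hatCobracket_ι, smul_mul_assoc, sw_mul, LinearMap.smul_apply, sw_apply]
  congr 1
  exact sw_congr _ fun u w => mul_assoc _ _ _

theorem hatCobracket_wedge (v : g) (x : ExteriorAlgebra K g) :
    hatCobracket δ (wedge v x) = counit x • hatCobracket δ (ExteriorAlgebra.ι K v) := by
  simp only [hatCobracket, LinearMap.smul_apply, LinearMap.comp_apply, ιInv_wedge, ιInv_ι, map_smul]
  rw [smul_comm]

theorem hatCobracket_one : hatCobracket δ 1 = 0 := by
  simp only [hatCobracket, LinearMap.smul_apply, LinearMap.comp_apply, ιInv_one, map_zero, smul_zero]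

theorem hatCobracket_sgn (x : ExteriorAlgebra K g) :
    hatCobracket δ (sgn x) = -hatCobracket δ x := by
  simp only [hatCobracket, LinearMap.smul_apply, LinearMap.comp_apply, ιInv_sgn, map_neg, smul_neg]

theorem sgn_hatCobracket (x : ExteriorAlgebra K g) :
    sgn (hatCobracket δ x) = hatCobracket δ x := by
  have : hatCobracket δ x = hatCobracket δ (ExteriorAlgebra.ι K (ExteriorAlgebra.ιInv x)) := by
    simp only [hatCobracket, LinearMap.smul_apply, LinearMap.comp_apply, ιInv_ι]
  rw [this, hatCobracket_ι, map_smul, ← sw_comp]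
  congr 1
  refine sw_congr _ fun u w => ?_
  rw [sgn_mul, sgn_ι, sgn_ι, neg_mul_neg]

/-- The coboundary operator, the extension of `δ` to `Λ g`: `x ↦ δ x₁ ∧ α x₂`. -/
def cobdry : Op K g := mul ∘ₗ TensorProduct.map (hatCobracket δ) (extMap α) ∘ₗ comul

theorem cobdry_one : cobdry δ α 1 = 0 := by
  simp only [cobdry, LinearMap.comp_apply]
  rw [comul_one, TensorProduct.map_tmul, hatCobracket_one, TensorProduct.zero_tmul, map_zero]

theorem map_hatCobracket_wedge {W : Type*} [AddCommGroup W] [Module K W]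
    (h : ExteriorAlgebra K g →ₗ[K] W) (v : g) (x : ExteriorAlgebra K g) :
    TensorProduct.map (hatCobracket δ ∘ₗ wedge v) h (comul x) =
      hatCobracket δ (ExteriorAlgebra.ι K v) ⊗ₜ h x := by
  have h1 : hatCobracket δ ∘ₗ wedge v =
      hatCobracket δ ∘ₗ ExteriorAlgebra.ι K ∘ₗ LinearMap.toSpanSingleton K g v ∘ₗ counit :=
    LinearMap.ext fun y => by simp [hatCobracket_wedge]
  have h2 : TensorProduct.map (hatCobracket δ ∘ₗ wedge v) h (comul x) =
      TensorProduct.map (hatCobracket δ ∘ₗ ExteriorAlgebra.ι K) LinearMap.id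
      (TensorProduct.map (LinearMap.toSpanSingleton K g v ∘ₗ counit) h (comul x)) := by
    rw [TensorProduct.map_map, h1]; rfl
  rw [h2, map_counit_left, TensorProduct.map_tmul]
  rfl

/-- The odd twisted derivation rule: `hatCobracket δ` sees only degree one, where `sgn` is `-1`, and
its values are even, so `α v` moves past them freely. -/
theorem cobdry_mul_wedge (v : g) :
    cobdry δ α * wedge v = -(wedge (α v) * cobdry δ α) + cowedge δ v * extMap α := by
  refine LinearMap.ext fun x => ?_
  simp only [Module.End.mul_apply, LinearMap.add_apply, LinearMap.neg_apply, cobdry,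
    LinearMap.comp_apply]
  have h1 : hatCobracket δ ∘ₗ sgn = -hatCobracket δ := LinearMap.ext (hatCobracket_sgn δ)
  have h2 : sgn * hatCobracket δ = hatCobracket δ := LinearMap.ext (sgn_hatCobracket δ)
  rw [comul_wedge, map_add, map_add, TensorProduct.map_map, TensorProduct.map_map,
    map_hatCobracket_wedge, h1, map_neg_left, ← Module.End.mul_eq_comp _ (wedge v),
    extMap_mul_wedge, map_neg, mul_map_wedge_right, h2, add_comm]
  rfl

/-- `x ↦ pr c₁ ⊗ c₂` for the coaction `x ↦ c₁ ⊗ c₂`. -/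
def cosplit : ExteriorAlgebra K g →ₗ[K] g ⊗[K] ExteriorAlgebra K g :=
  TensorProduct.map ExteriorAlgebra.ιInv LinearMap.id ∘ₗ coact δ α

theorem map_ιInv_cocontract (b c : ExteriorAlgebra K g) :
    TensorProduct.map ExteriorAlgebra.ιInv LinearMap.id (cocontract (b ⊗ₜ c)) =
      TensorProduct.map LinearMap.id (LinearMap.mulRight K c) (split b) := by
  simp only [cocontract, LinearMap.comp_apply, TensorProduct.map_tmul, LinearMap.id_apply, split]
  induction comul b with
  | zero => simp
  | add s t hs ht => simp only [map_add, TensorProduct.add_tmul, hs, ht]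
  | tmul x y =>
    simp [TensorProduct.map_tmul, mul, pr, ιInv_ι]

theorem split_sgn (x : ExteriorAlgebra K g) :
    split (sgn x) = -TensorProduct.map LinearMap.id sgn (split x) := by
  induction x using ext_induction with
  | h1 => rw [sgn_one, split_one, map_zero, neg_zero]
  | smul c x hx => simp only [map_smul, hx, smul_neg]
  | add x y hx hy => simp only [map_add, hx, hy, neg_add]
  | mul v x hx =>
    rw [sgn_wedge, map_neg, split_wedge, split_wedge, hx, map_sub, TensorProduct.map_tmul,
      map_neg, TensorProduct.map_map, TensorProduct.map_map, ← Module.End.mul_eq_comp sgn,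
      sgn_mul_wedge, sub_neg_eq_add]
    have : TensorProduct.map (LinearMap.id : g →ₗ[K] g) (-(wedge v * sgn)) (split x) =
        -TensorProduct.map (LinearMap.id : g →ₗ[K] g) (wedge v ∘ₗ sgn) (split x) := by
      induction split x with
      | zero => simp
      | add s t hs ht => rw [map_add, map_add, hs, ht, neg_add]
      | tmul x y =>
        rw [TensorProduct.map_tmul, TensorProduct.map_tmul, LinearMap.neg_apply,
          TensorProduct.tmul_neg]; rfl
    rw [LinearMap.comp_id, this, sub_neg_eq_add]
    rfl

/-- Splitting `u ∧ w` gives `u ⊗ w - w ⊗ u`, which doubles a skew tensor; the `2⁻¹` in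
`hatCobracket` undoes this. -/
theorem split_hatCobracket [CharZero K] (hδ : ∀ x, δ x = -TensorProduct.comm K g g (δ x)) (v : g) :
    split (hatCobracket δ (ExteriorAlgebra.ι K v)) =
      TensorProduct.map LinearMap.id (ExteriorAlgebra.ι K) (δ v) := by
  have h : ∀ t : g ⊗[K] g, split (sw t fun u w => ExteriorAlgebra.ι K u * ExteriorAlgebra.ι K w) =
      TensorProduct.map LinearMap.id (ExteriorAlgebra.ι K) (t - TensorProduct.comm K g g t) := by
    intro t
    induction t with
    | zero => simp [sw]
    | add s t hs ht =>
      rw [(Lin.sw_left Lin.id _).add, map_add, hs, ht]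
      simp only [map_add, map_sub]; abel
    | tmul u w =>
      rw [sw_tmul (fun w => by fun_prop) (fun u => by fun_prop), ← wedge_apply, split_wedge,
        ← mul_one (ExteriorAlgebra.ι K w), ← wedge_apply, split_wedge, split_one]
      simp [wedge_apply]
  have h2 : δ v - TensorProduct.comm K g g (δ v) = (2 : K) • δ v := by
    rw [two_smul, sub_eq_add_neg, ← hδ]
  rw [hatCobracket_ι, map_smul, h, h2, map_smul, smul_smul, inv_mul_cancel₀ two_ne_zero, one_smul]

theorem cosplit_one : cosplit δ α 1 = 0 := by
  rw [cosplit, coact, LinearMap.comp_apply, LinearMap.comp_apply, LinearMap.comp_apply, comul_one,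
    TensorProduct.map_tmul, hatCobracket_one, TensorProduct.zero_tmul, map_zero, map_zero]

/-- If `v` is a spectator, the sign from the coproduct cancels the one from moving `α v` past the
remaining leg of the cobracket. Hence, unlike in `split_wedge`, no sign is left. -/
theorem cosplit_wedge [CharZero K] (hδ : ∀ x, δ x = -TensorProduct.comm K g g (δ x)) (v : g)
    (x : ExteriorAlgebra K g) :
    cosplit δ α (wedge v x) =
      TensorProduct.map LinearMap.id (LinearMap.mulRight K (extMap α x) ∘ₗ ExteriorAlgebra.ι K)
        (δ v) + TensorProduct.map LinearMap.id (wedge (α v)) (cosplit δ α x) := by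
  have h1 : hatCobracket δ ∘ₗ sgn = -hatCobracket δ := LinearMap.ext (hatCobracket_sgn δ)
  rw [cosplit, coact, LinearMap.comp_apply, LinearMap.comp_apply, LinearMap.comp_apply, comul_wedge,
    map_add, map_add, map_add, TensorProduct.map_map, TensorProduct.map_map,
    LinearMap.comp_id, map_hatCobracket_wedge, map_ιInv_cocontract, split_hatCobracket δ hδ,
    TensorProduct.map_map, h1, ← Module.End.mul_eq_comp _ (wedge v), extMap_mul_wedge]
  congr 1
  simp only [LinearMap.comp_apply]
  induction comul x with
  | zero => simp
  | add s t hs ht => simp only [map_add, hs, ht]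
  | tmul x y =>
    have h3 : split ((-hatCobracket δ) x) =
        TensorProduct.map LinearMap.id sgn (split (hatCobracket δ x)) := by
      have := split_sgn (hatCobracket δ x)
      rw [sgn_hatCobracket] at this
      rw [LinearMap.neg_apply, map_neg]
      exact neg_eq_iff_eq_neg.mpr this
    rw [TensorProduct.map_tmul, TensorProduct.map_tmul, map_ιInv_cocontract, map_ιInv_cocontract,
      h3, TensorProduct.map_map, TensorProduct.map_map]
    congr 2
    refine LinearMap.ext fun z => ?_
    change sgn z * (ExteriorAlgebra.ι K (α v) * extMap α y) = ExteriorAlgebra.ι K (α v) * (z * extMap α y)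
    rw [← mul_assoc, mul_ι, sgn_sgn]
    exact mul_assoc _ _ _

/-- `x ↦ F (pr c₁) c₂` for the coaction `x ↦ c₁ ⊗ c₂`. -/
def Rop (F : g → Op K g) : Op K g := TensorProduct.lift (lin F) ∘ₗ cosplit δ α

theorem Rop_one (F : g → Op K g) : Rop δ α F 1 = 0 := by
  rw [Rop, LinearMap.comp_apply, cosplit_one, map_zero]

theorem Rop_mul_wedge [CharZero K] (hδ : ∀ x, δ x = -TensorProduct.comm K g g (δ x))
    {F : g → Op K g} (hF : Lin K F) (v : g) :
    Rop δ α F * wedge v = sw (δ v) (fun u w => F u * wedge w) * extMap α +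
      Rop δ α fun x => F x * wedge (α v) := by
  refine LinearMap.ext fun x => ?_
  have h1 : TensorProduct.lift (lin F) (TensorProduct.map LinearMap.id
      (LinearMap.mulRight K (extMap α x) ∘ₗ ExteriorAlgebra.ι K) (δ v)) =
      (sw (δ v) (fun u w => F u * wedge w) : Op K g) (extMap α x) := by
    rw [lift_eq_sw, sw_apply]
    exact sw_congr _ fun u w => congrArg (fun f : Op K g => f _) (lin_apply hF u)
  have h2 : TensorProduct.lift (lin F) (TensorProduct.map LinearMap.id (wedge (α v))
      (cosplit δ α x)) = Rop δ α (fun x => F x * wedge (α v)) x := lift_lin_map _ _ _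
  change TensorProduct.lift (lin F) (cosplit δ α (wedge v x)) = _
  rw [cosplit_wedge δ α hδ, map_add, h1, h2]
  rfl

theorem mul_Rop (T : Op K g) (F : g → Op K g) : T * Rop δ α F = Rop δ α fun x => T * F x := by
  have h : lin (K := K) (fun x => T * F x) = LinearMap.mulLeft K T ∘ₗ lin F :=
    lin_comp (LinearMap.mulLeft K T) F
  refine LinearMap.ext fun x => ?_
  rw [Rop, Rop, h, Module.End.mul_apply, LinearMap.comp_apply, LinearMap.comp_apply]
  induction cosplit δ α x with
  | zero => simp
  | add s t hs ht => simp only [map_add, hs, ht]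
  | tmul x y => simp

theorem Rop_add (F G : g → Op K g) : Rop δ α (fun x => F x + G x) = Rop δ α F + Rop δ α G := by
  rw [Rop, lin_add]
  refine LinearMap.ext fun x => ?_
  rw [LinearMap.add_apply, Rop, Rop, LinearMap.comp_apply, LinearMap.comp_apply,
    LinearMap.comp_apply]
  induction cosplit δ α x with
  | zero => simp
  | add s t hs ht => simp only [map_add, hs, ht]; abel
  | tmul x y => simp

/-! ### Sums over the cobracket -/

section Cobracket

variable {W : Type*} [AddCommGroup W] [Module K W] {ν : g →ₗ[K] g →ₗ[K] g}
  {δ : g →ₗ[K] g ⊗[K] g} {α : g →ₗ[K] g}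

theorem sw_skew (hg : IsHomLieBialgebra ν δ α α) (x : g) {B : g → g → W}
    (hu : ∀ w, Lin K fun u => B u w) (hw : ∀ u, Lin K fun w => B u w) :
    sw (δ x) B = -sw (δ x) fun u w => B w u := by
  rw [← sw_comm hu hw, show -sw (TensorProduct.comm K g g (δ x)) B =
    sw (-TensorProduct.comm K g g (δ x)) B by simp [sw]]
  exact congrArg (fun t => sw t B) (hg.coalgebra.skew x)

theorem sw_alpha (hg : IsHomLieBialgebra ν δ α α) (x : g) {B : g → g → W}
    (hu : ∀ w, Lin K fun u => B u w) (hw : ∀ u, Lin K fun w => B u w) :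
    sw (δ (α x)) B = sw (δ x) fun u w => B (α u) (α w) := by
  rw [← sw_map hu hw]
  exact congrArg (fun t => sw t B) (LinearMap.congr_fun hg.cobracket_comm x)

theorem sw_compat (hg : IsHomLieBialgebra ν δ α α) (x y : g) {B : g → g → W}
    (hu : ∀ w, Lin K fun u => B u w) (hw : ∀ u, Lin K fun w => B u w) :
    sw (δ (ν x y)) B = sw (δ x) (fun u w => B (α u) (ν w (α y)) + B (ν u (α y)) (α w)) +
      sw (δ y) fun u w => B (ν (α x) u) (α w) + B (α u) (ν (α x) w) := by
  rw [hg.compat, sw_add, sw_add]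
  simp only [(Lin.sw_left Lin.id B).add, sw_map hu hw, LinearMap.flip_apply]
  abel

/-- The value of a trilinear function on a tensor. -/
def sw₃ (z : (g ⊗[K] g) ⊗[K] g) (T : g → g → g → W) : W :=
  TensorProduct.lift (TensorProduct.lift (lin fun x => lin fun y => lin fun z => T x y z)) z

theorem sw₃_tmul {T : g → g → g → W} (hx : ∀ y z, Lin K fun x => T x y z)
    (hy : ∀ x z, Lin K fun y => T x y z) (hz : ∀ x y, Lin K fun z => T x y z) (x y z : g) :
    sw₃ ((x ⊗ₜ y) ⊗ₜ[K] z) T = T x y z := by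
  have h1 : ∀ x, Lin K fun y => lin (K := K) fun z => T x y z := fun x =>
    ⟨fun y y' => LinearMap.ext fun z => by simp [lin_apply (hz _ _), (hy x z).add],
     fun c y => LinearMap.ext fun z => by simp [lin_apply (hz _ _), (hy x z).smul]⟩
  have h2 : Lin K fun x => lin (K := K) fun y => lin (K := K) fun z => T x y z :=
    ⟨fun x x' => LinearMap.ext fun y => LinearMap.ext fun z => by
      simp [lin_apply (h1 _), lin_apply (hz _ _), (hx y z).add],
     fun c x => LinearMap.ext fun y => LinearMap.ext fun z => by
      simp [lin_apply (h1 _), lin_apply (hz _ _), (hx y z).smul]⟩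
  rw [sw₃, TensorProduct.lift.tmul, TensorProduct.lift.tmul, lin_apply h2, lin_apply (h1 x),
    lin_apply (hz x y)]

theorem sw₃_map (δ : g →ₗ[K] g ⊗[K] g) (α : g →ₗ[K] g) {T : g → g → g → W}
    (hx : ∀ y z, Lin K fun x => T x y z)
    (hy : ∀ x z, Lin K fun y => T x y z) (hz : ∀ x y, Lin K fun z => T x y z) (t : g ⊗[K] g) :
    sw₃ (TensorProduct.map δ α t) T = sw t fun u w => sw (δ u) fun u₁ u₂ => T u₁ u₂ (α w) := by
  induction t with
  | zero => simp [sw, sw₃]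
  | add s t hs ht =>
    rw [(Lin.sw_left Lin.id _).add, ← hs, ← ht]
    simp [sw₃]
  | tmul u w =>
    rw [sw_tmul (fun w => by fun_prop) (fun u => by fun_prop), TensorProduct.map_tmul]
    induction δ u with
    | zero => simp [sw, sw₃]
    | add s t hs ht =>
      rw [(Lin.sw_left Lin.id _).add, ← hs, ← ht]
      simp [sw₃, TensorProduct.add_tmul]
    | tmul x y =>
      rw [sw_tmul (fun w => by fun_prop) (fun u => by fun_prop), sw₃_tmul hx hy hz]

theorem sw₃_cyc {T : g → g → g → W} (hx : ∀ y z, Lin K fun x => T x y z)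
    (hy : ∀ x z, Lin K fun y => T x y z) (hz : ∀ x y, Lin K fun z => T x y z)
    (z : (g ⊗[K] g) ⊗[K] g) : sw₃ (cyc z) T = sw₃ z fun x y z => T z x y := by
  have : TensorProduct.lift (TensorProduct.lift (lin fun x => lin fun y => lin fun z => T x y z)) ∘ₗ
      cyc = TensorProduct.lift (TensorProduct.lift
        (lin fun x => lin fun y => lin (K := K) fun z => T z x y)) := by
    refine TensorProduct.ext_threefold fun x y z => ?_
    have h1 := sw₃_tmul hx hy hz z x y
    have h2 := sw₃_tmul (T := fun x y z => T z x y) (fun y z => hy z y) (fun x z => hz z x)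
      (fun x y => hx x y) x y z
    exact h1.trans h2.symm
  exact LinearMap.congr_fun this z

theorem sw_cojacobi (hg : IsHomLieBialgebra ν δ α α) (x : g) {T : g → g → g → W}
    (hx : ∀ y z, Lin K fun x => T x y z) (hy : ∀ x z, Lin K fun y => T x y z)
    (hz : ∀ x y, Lin K fun z => T x y z) :
    sw (δ x) (fun u w => sw (δ u) fun u₁ u₂ => T u₁ u₂ (α w)) +
      sw (δ x) (fun u w => sw (δ u) fun u₁ u₂ => T (α w) u₁ u₂) +
      sw (δ x) (fun u w => sw (δ u) fun u₁ u₂ => T u₂ (α w) u₁) = 0 := by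
  have h := LinearMap.congr_fun hg.coalgebra.cojacobi x
  simp only [LinearMap.comp_apply, LinearMap.add_apply, LinearMap.id_apply,
    LinearMap.zero_apply] at h
  have h' := congrArg (fun z => sw₃ z T) h
  have hadd : ∀ s t : (g ⊗[K] g) ⊗[K] g, sw₃ (s + t) T = sw₃ s T + sw₃ t T := fun s t => by simp [sw₃]
  simp only [hadd] at h'
  rw [sw₃_cyc hx hy hz, sw₃_cyc hx hy hz,
    sw₃_cyc (T := fun x y z => T z x y) (fun y z => hy z y) (fun x z => hz z x) (fun x y => hx x y),
    sw₃_map δ α hx hy hz,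
    sw₃_map δ α (T := fun x y z => T z x y) (fun y z => hy z y) (fun x z => hz z x)
      (fun x y => hx x y),
    sw₃_map δ α (T := fun x y z => T y z x) (fun y z => hz y z) (fun x z => hx z x)
      (fun x y => hy y x)] at h'
  rw [h']
  simp [sw₃]

/-- For a cyclically invariant `T` the three terms of the co-Jacobi identity coincide, and `3` is
invertible. -/
theorem sw_cojacobi_of_cyclic [CharZero K] (hg : IsHomLieBialgebra ν δ α α) (x : g)
    {T : g → g → g → W} (hx : ∀ y z, Lin K fun x => T x y z) (hy : ∀ x z, Lin K fun y => T x y z)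
    (hz : ∀ x y, Lin K fun z => T x y z) (h : ∀ x y z, T z x y = T x y z) :
    sw (δ x) (fun u w => sw (δ u) fun u₁ u₂ => T u₁ u₂ (α w)) = 0 := by
  have := sw_cojacobi hg x hx hy hz
  have h2 : ∀ x y z, T y z x = T x y z := fun x y z => (h z x y).trans (h x y z)
  simp only [fun w u₁ u₂ => h u₁ u₂ w, fun w u₁ u₂ => h2 u₁ u₂ w] at this
  have h3 : (3 : K) • sw (δ x) (fun u w => sw (δ u) fun u₁ u₂ => T u₁ u₂ (α w)) = 0 := by
    rw [← this]; module
  exact (smul_eq_zero.mp h3).resolve_left three_ne_zero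

/-- When `T` is skew in its first two arguments, skewness of `δ` makes two of the three co-Jacobi
terms equal. The identity then trades a cobracket of the second leg for half a cobracket of the
first. -/
theorem sw_cojacobi_of_skew [CharZero K] (hg : IsHomLieBialgebra ν δ α α) (x : g)
    {T : g → g → g → W} (hx : ∀ y z, Lin K fun x => T x y z) (hy : ∀ x z, Lin K fun y => T x y z)
    (hz : ∀ x y, Lin K fun z => T x y z) (h : ∀ x y z, T x y z = -T y x z) :
    sw (δ x) (fun u w => sw (δ w) fun w₁ w₂ => T (α u) w₁ w₂) =
      (2⁻¹ : K) • sw (δ x) fun u w => sw (δ u) fun u₁ u₂ => T u₁ u₂ (α w) := by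
  have h1 := sw_cojacobi hg x hx hy hz
  have h2 : ∀ u w : g, sw (δ u) (fun u₁ u₂ => T u₂ (α w) u₁) =
      sw (δ u) fun u₁ u₂ => T (α w) u₁ u₂ := fun u w => by
    rw [sw_skew hg u (B := fun u₁ u₂ => T (α w) u₁ u₂) (hy _) (hz _), ← sw_neg]
    exact sw_congr _ fun u₁ u₂ => h _ _ _
  simp only [h2] at h1
  rw [sw_skew hg x (fun w => by fun_prop) (fun u => by fun_prop)]
  have h3 : sw (δ x) (fun u w => sw (δ u) fun u₁ u₂ => T u₁ u₂ (α w)) =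
      -((2 : K) • sw (δ x) (fun u w => sw (δ u) fun u₁ u₂ => T (α w) u₁ u₂)) := by
    rw [two_smul, eq_neg_iff_add_eq_zero, ← h1]; abel
  rw [h3, smul_neg, smul_smul, inv_mul_cancel₀ two_ne_zero, one_smul]

end Cobracket

/-! ### An abstract operator calculus -/

/-- An algebra `E` with the operators on `Λ g` that are used below: `e v` is the multiplication by
`v`, `ad v` the adjoint action, `a`, `N` and `M` extend `α`, the bracket and the cobracket, `L` and
`R` contract one argument with values in `g`, and `vac` is the left ideal of the operators that
vanish at `1`. -/
structure OpCalculus (ν : g →ₗ[K] g →ₗ[K] g) (δ : g →ₗ[K] g ⊗[K] g) (α : g →ₗ[K] g)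
    (E : Type*) [Ring E] [Algebra K E] where
  e : g →ₗ[K] E
  ad : g →ₗ[K] E
  a : E
  N : E
  M : E
  L : (g → E) → E
  R : (g → E) → E
  vac : Submodule K E
  mul_vac : ∀ T {S}, S ∈ vac → T * S ∈ vac
  vac_mul_a : ∀ {S}, S ∈ vac → S * a ∈ vac
  ad_vac : ∀ x, ad x ∈ vac
  N_vac : N ∈ vac
  M_vac : M ∈ vac
  L_vac : ∀ F, L F ∈ vac
  R_vac : ∀ F, R F ∈ vac
  -- The principle `op_eq_zero` in terms of sets, so that no index type and no universe becomes part
  -- of the structure.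
  eq_zero_of_mem : ∀ S : Set E, S ⊆ vac → (∀ T ∈ S, ∀ v, ∃ T' ∈ S, ∃ B, T * e v = B * T') →
    ∀ T ∈ S, T = 0
  e_mul_self : ∀ v, e v * e v = 0
  a_e : ∀ v, a * e v = e (α v) * a
  ad_e : ∀ u v, ad u * e v = e (ν u v) * a + e (α v) * ad u
  N_e : ∀ v, N * e v = -(e (α v) * N) + ad v
  M_e : ∀ v, M * e v = -(e (α v) * M) + ((2⁻¹ : K) • sw (δ v) fun u w => e u * e w) * a
  L_e : ∀ {F : g → E}, Lin K F → ∀ v, L F * e v = F v - L fun x => F x * e v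
  R_e : ∀ {F : g → E}, Lin K F → ∀ v,
    R F * e v = sw (δ v) (fun u w => F u * e w) * a + R fun x => F x * e (α v)
  mul_L : ∀ T F, T * L F = L fun x => T * F x
  mul_R : ∀ T F, T * R F = R fun x => T * F x
  L_add : ∀ F G, L (fun x => F x + G x) = L F + L G
  R_add : ∀ F G, R (fun x => F x + G x) = R F + R G

/-- In the quotient by `S` the function becomes zero, so no linearity of `B` is required. -/
theorem sw_mem {W : Type*} [AddCommGroup W] [Module K W] {S : Submodule K W} (t : g ⊗[K] g)
    {B : g → g → W} (h : ∀ u w, B u w ∈ S) : sw t B ∈ S := by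
  rw [← Submodule.Quotient.mk_eq_zero, ← Submodule.mkQ_apply, ← sw_comp]
  simp only [Submodule.mkQ_apply, (Submodule.Quotient.mk_eq_zero S).mpr (h _ _), sw_zero]

namespace OpCalculus

variable {E : Type*} [Ring E] [Algebra K E] {ν : g →ₗ[K] g →ₗ[K] g}
  {δ : g →ₗ[K] g ⊗[K] g} {α : g →ₗ[K] g} (C : OpCalculus ν δ α E)

/-- The engine of all commutation rules: take the difference of the two sides for `T`, pass `e v`
through it, and read off a left multiple of a member of the same family. -/
theorem eq_zero {I : Type*} (T : I → E) (h1 : ∀ i, T i ∈ C.vac)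
    (h : ∀ i v, ∃ j B, T i * C.e v = B * T j) (i : I) : T i = 0 := by
  refine C.eq_zero_of_mem (Set.range T) ?_ ?_ _ ⟨i, rfl⟩
  · rintro _ ⟨i, rfl⟩; exact h1 i
  · rintro _ ⟨i, rfl⟩ v
    obtain ⟨j, B, hj⟩ := h i v
    exact ⟨T j, ⟨j, rfl⟩, B, hj⟩

/-- The multiplication by `(1/2) x₁ ∧ x₂`, where `δ x = x₁ ⊗ x₂`. -/
def d (x : g) : E := (2⁻¹ : K) • sw (δ x) fun u w => C.e u * C.e w

/-- The operator `α x₁ ∧ [x₂, ·]`, where `δ x = x₁ ⊗ x₂`. -/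
def k (x : g) : E := sw (δ x) fun u w => C.e (α u) * C.ad w

@[fun_prop] theorem lin_d : Lin K fun x => C.d x := by unfold d; fun_prop

@[fun_prop] theorem lin_k : Lin K fun x => C.k x := by unfold k; fun_prop

theorem M_e' (v : g) : C.M * C.e v = -(C.e (α v) * C.M) + C.d v * C.a := C.M_e v

theorem a_e_assoc (v : g) (T : E) : C.a * (C.e v * T) = C.e (α v) * (C.a * T) := by
  rw [← mul_assoc, C.a_e, mul_assoc]

theorem ad_e_assoc (u v : g) (T : E) :
    C.ad u * (C.e v * T) = C.e (ν u v) * (C.a * T) + C.e (α v) * (C.ad u * T) := by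
  rw [← mul_assoc, C.ad_e, add_mul, mul_assoc, mul_assoc]

theorem N_e_assoc (v : g) (T : E) :
    C.N * (C.e v * T) = -(C.e (α v) * (C.N * T)) + C.ad v * T := by
  rw [← mul_assoc, C.N_e, add_mul, neg_mul, mul_assoc]

theorem M_e_assoc (v : g) (T : E) :
    C.M * (C.e v * T) = -(C.e (α v) * (C.M * T)) + C.d v * (C.a * T) := by
  rw [← mul_assoc, C.M_e', add_mul, neg_mul, mul_assoc, mul_assoc]

theorem e_mul_e (u v : g) : C.e u * C.e v = -(C.e v * C.e u) := by
  have h := C.e_mul_self (u + v)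
  simp only [map_add, mul_add, add_mul, C.e_mul_self, zero_add, add_zero] at h
  exact eq_neg_of_add_eq_zero_right h

/-- `d x` is the multiplication by an even element, and moving `e v` past its two factors costs two
signs. -/
theorem d_mul_e (x v : g) : C.d x * C.e v = C.e v * C.d x := by
  rw [d, smul_mul_assoc, mul_smul_comm, sw_mul, mul_sw]
  refine congrArg ((2⁻¹ : K) • ·) (sw_congr _ fun u w => ?_)
  rw [mul_assoc, C.e_mul_e w v, ← mul_assoc, C.e_mul_e v u]; noncomm_ring

theorem d_e_assoc (x v : g) (T : E) : C.d x * (C.e v * T) = C.e v * (C.d x * T) := by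
  rw [← mul_assoc, d_mul_e, mul_assoc]

/-! #### Relations on the algebra side -/

variable (hg : IsHomLieBialgebra ν δ α α)
include hg

theorem a_mul_ad (x : g) : C.a * C.ad x = C.ad (α x) * C.a := by
  rw [← sub_eq_zero]
  refine C.eq_zero (fun x => C.a * C.ad x - C.ad (α x) * C.a)
    (fun x => sub_mem (C.mul_vac _ (C.ad_vac x)) (C.vac_mul_a (C.ad_vac _)))
    (fun x v => ⟨x, C.e (α (α v)), ?_⟩) x
  simp only [sub_mul, mul_sub, mul_add, mul_assoc, C.a_e, C.ad_e, C.a_e_assoc, C.ad_e_assoc,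
    hg.algebra.multiplicative]
  abel

theorem a_mul_N : C.a * C.N = C.N * C.a := by
  rw [← sub_eq_zero]
  refine C.eq_zero (fun _ : Unit => C.a * C.N - C.N * C.a)
    (fun x => sub_mem (C.mul_vac _ C.N_vac) (C.vac_mul_a C.N_vac))
    (fun x v => ⟨x, -C.e (α (α v)), ?_⟩) ()
  simp only [sub_mul, mul_sub, mul_add, neg_mul, mul_neg, mul_assoc, C.a_e, C.N_e, C.a_e_assoc,
    C.N_e_assoc, C.a_mul_ad hg]
  abel

theorem a_mul_d (x : g) : C.a * C.d x = C.d (α x) * C.a := by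
  rw [d, d, sw_alpha hg x (fun w => by fun_prop) (fun u => by fun_prop), mul_smul_comm,
    smul_mul_assoc, mul_sw, sw_mul]
  refine congrArg ((2⁻¹ : K) • ·) (sw_congr _ fun u w => ?_)
  rw [C.a_e_assoc, C.a_e, mul_assoc]

theorem a_mul_k (x : g) : C.a * C.k x = C.k (α x) * C.a := by
  rw [k, k, sw_alpha hg x (fun w => by fun_prop) (fun u => by fun_prop), mul_sw, sw_mul]
  exact sw_congr _ fun u w => by rw [C.a_e_assoc, C.a_mul_ad hg, mul_assoc]

theorem a_mul_M : C.a * C.M = C.M * C.a := by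
  rw [← sub_eq_zero]
  refine C.eq_zero (fun _ : Unit => C.a * C.M - C.M * C.a)
    (fun x => sub_mem (C.mul_vac _ C.M_vac) (C.vac_mul_a C.M_vac))
    (fun x v => ⟨x, -C.e (α (α v)), ?_⟩) ()
  simp only [sub_mul, mul_sub, mul_add, neg_mul, mul_neg, mul_assoc, C.a_e, C.M_e', C.a_e_assoc,
    C.M_e_assoc]
  rw [← mul_assoc C.a (C.d v), C.a_mul_d hg, mul_assoc]
  abel

theorem a_ad_assoc (x : g) (T : E) : C.a * (C.ad x * T) = C.ad (α x) * (C.a * T) := by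
  rw [← mul_assoc, C.a_mul_ad hg, mul_assoc]

theorem bracket_bracket (x y z : g) : ν (α x) (ν y z) - ν (α y) (ν x z) = ν (ν x y) (α z) := by
  have h := hg.algebra.jacobi x y z
  rw [hg.algebra.skew (ν y z), hg.algebra.skew (ν z x), hg.algebra.skew z x, map_neg, neg_neg,
    add_assoc, add_eq_zero_iff_eq_neg] at h
  rw [h]; abel

/-- The Hom-Jacobi identity on `g`, in the form `bracket_bracket`, extended to `Λ g` by the
derivation rule. -/
theorem ad_mul_ad (x y : g) :
    C.ad (α x) * C.ad y - C.ad (α y) * C.ad x = C.ad (ν x y) * C.a := by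
  rw [← sub_eq_zero]
  refine C.eq_zero (fun p : g × g => C.ad (α p.1) * C.ad p.2 - C.ad (α p.2) * C.ad p.1 -
      C.ad (ν p.1 p.2) * C.a)
    (fun p => sub_mem (sub_mem (C.mul_vac _ (C.ad_vac _)) (C.mul_vac _ (C.ad_vac _)))
      (C.vac_mul_a (C.ad_vac _)))
    (fun p v => ⟨p, C.e (α (α v)), ?_⟩) (x, y)
  simp only [sub_mul, mul_sub, mul_add, mul_assoc, C.a_e, C.ad_e, C.ad_e_assoc,
    ← bracket_bracket hg p.1 p.2 v, C.a_mul_ad hg, hg.algebra.multiplicative, map_sub]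
  abel

/-- Invariance of the bracket: after `e v` has been passed, what remains is `ad_mul_ad`. -/
theorem N_mul_ad (x : g) : C.N * C.ad x = C.ad (α x) * C.N := by
  rw [← sub_eq_zero]
  refine C.eq_zero (fun x => C.N * C.ad x - C.ad (α x) * C.N)
    (fun x => sub_mem (C.mul_vac _ (C.ad_vac _)) (C.mul_vac _ C.N_vac))
    (fun x v => ⟨x, -C.e (α (α v)), ?_⟩) x
  have h := C.ad_mul_ad hg x v
  simp only [sub_mul, mul_sub, mul_add, neg_mul, mul_neg, mul_assoc, C.ad_e, C.N_e,
    C.ad_e_assoc, C.N_e_assoc, C.a_mul_N hg, hg.algebra.multiplicative, ← h]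
  abel

/-- Passing `e v` leaves the cross terms `N * ad v` and `-ad (α v) * N`, which cancel by `N_mul_ad`.
-/
theorem N_mul_N : C.N * C.N = 0 := by
  refine C.eq_zero (fun _ : Unit => C.N * C.N) (fun x => C.mul_vac _ C.N_vac)
    (fun x v => ⟨x, C.e (α (α v)), ?_⟩) ()
  simp only [mul_add, mul_neg, mul_assoc, C.N_e, C.N_e_assoc, C.N_mul_ad hg]
  abel

variable [CharZero K]

theorem half_sw {W : Type*} [AddCommGroup W] [Module K W] (x : g) {B : g → g → W}
    (hu : ∀ w, Lin K fun u => B u w) (hw : ∀ u, Lin K fun w => B u w) :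
    (2⁻¹ : K) • sw (δ x) (fun u w => B u w - B w u) = sw (δ x) B := by
  rw [sw_sub, ← neg_eq_iff_eq_neg.mpr (sw_skew hg x hu hw), sub_neg_eq_add, ← two_smul K, smul_smul,
    inv_mul_cancel₀ two_ne_zero, one_smul]

theorem ad_mul_d (x y : g) : C.ad x * C.d y =
    sw (δ y) (fun u w => C.e (α u) * C.e (ν x w)) * C.a + C.d (α y) * C.ad x := by
  rw [← half_sw hg y (fun w => by fun_prop) (fun u => by fun_prop), d, d,
    sw_alpha hg y (fun w => by fun_prop) (fun u => by fun_prop), mul_smul_comm, smul_mul_assoc,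
    smul_mul_assoc, mul_sw, sw_mul, sw_mul, ← smul_add, ← sw_add]
  refine congrArg ((2⁻¹ : K) • ·) (sw_congr _ fun u w => ?_)
  simp only [sub_mul, mul_add, mul_assoc, C.ad_e, C.a_e, C.ad_e_assoc]
  rw [← mul_assoc (C.e (α w)), C.e_mul_e (α w)]
  noncomm_ring

/-- The co-Jacobi identity in `Λ³ g`: a product of three elements of `g` is invariant under cyclic
permutations. -/
theorem sw_d_mul_e (x : g) : sw (δ x) (fun u w => C.d u * C.e (α w)) = 0 := by
  have h := sw_cojacobi_of_cyclic hg x (T := fun x y z => C.e x * C.e y * C.e z)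
    (fun y z => by fun_prop) (fun x z => by fun_prop) (fun x y => by fun_prop)
    (fun x y z => by
      rw [C.e_mul_e z x, neg_mul, mul_assoc, C.e_mul_e z y, mul_neg, neg_neg, mul_assoc])
  have h2 : ∀ u w, C.d u * C.e (α w) =
      (2⁻¹ : K) • sw (δ u) fun u₁ u₂ => C.e u₁ * C.e u₂ * C.e (α w) := fun u w => by
    rw [d, smul_mul_assoc, sw_mul]
  simp only [h2]
  rw [sw_smul, h, smul_zero]

/-- Applying `M` to the two legs of `δ x` gives, after antisymmetrization, the sum that vanishes by
`sw_d_mul_e`. -/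
theorem M_mul_d (x : g) : C.M * C.d x = C.d (α x) * C.M := by
  have h1 : ∀ u w, C.M * (C.e u * C.e w) = C.e (α u) * C.e (α w) * C.M +
      (C.d u * C.e (α w) - C.d w * C.e (α u)) * C.a := fun u w => by
    simp only [C.M_e_assoc, C.M_e', C.a_e, mul_add, mul_neg, sub_mul, mul_assoc, C.d_mul_e,
      C.d_e_assoc]
    abel
  have h2 := half_sw hg x (B := fun u w => C.d u * C.e (α w)) (fun w => by fun_prop)
    (fun u => by fun_prop)
  rw [d, d, sw_alpha hg x (fun w => by fun_prop) (fun u => by fun_prop), mul_smul_comm,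
    smul_mul_assoc, mul_sw, sw_mul]
  simp only [h1]
  rw [sw_add, ← sw_mul C.a, smul_add, ← smul_mul_assoc _ _ C.a, h2, C.sw_d_mul_e hg, zero_mul,
    add_zero]

theorem M_mul_M : C.M * C.M = 0 := by
  refine C.eq_zero (fun _ : Unit => C.M * C.M) (fun x => C.mul_vac _ C.M_vac)
    (fun x v => ⟨x, C.e (α (α v)), ?_⟩) ()
  simp only [mul_add, mul_neg, mul_assoc, C.M_e', C.M_e_assoc, C.a_mul_M hg]
  rw [← mul_assoc C.M (C.d v), C.M_mul_d hg, mul_assoc]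
  abel

/-- The compatibility projected to `Λ² g`; the four terms pair up and the halves disappear by
`half_sw`. -/
theorem d_bracket (x y : g) : C.d (ν x y) =
    sw (δ y) (fun u w => C.e (α u) * C.e (ν (α x) w)) +
      sw (δ x) fun u w => C.e (α u) * C.e (ν w (α y)) := by
  rw [d, sw_compat hg x y (fun w => by fun_prop) (fun u => by fun_prop),
    ← half_sw hg x (B := fun u w => C.e (α u) * C.e (ν w (α y))) (fun w => by fun_prop)
      (fun u => by fun_prop), ← half_sw hg y (B := fun u w => C.e (α u) * C.e (ν (α x) w)) (fun w => by fun_prop)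
      (fun u => by fun_prop), add_comm, smul_add]
  refine congrArg₂ (fun S T : E => (2⁻¹ : K) • S + (2⁻¹ : K) • T) (sw_congr (δ y) fun u w => ?_)
    (sw_congr (δ x) fun u w => ?_)
  · rw [C.e_mul_e (ν (α x) u) (α w)]; abel
  · rw [C.e_mul_e (ν u (α y)) (α w)]; abel

omit [CharZero K] hg in
theorem k_mul_e (x y : g) : C.k x * C.e y =
    sw (δ x) (fun u w => C.e (α u) * C.e (ν w y)) * C.a - C.e (α y) * C.k x := by
  rw [k, sw_mul, sw_mul, mul_sw, ← sw_sub]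
  refine sw_congr _ fun u w => ?_
  rw [mul_assoc, C.ad_e, mul_add, ← mul_assoc (C.e (α u)) (C.e (α y)), C.e_mul_e (α u) (α y)]
  noncomm_ring

/-- The compatibility at the level of operators: `k` measures the failure of the cobracket to be
invariant. The proof matches the two halves of `d_bracket` with `k_mul_e` and `ad_mul_d`. -/
theorem M_mul_ad (x : g) : C.M * C.ad x = C.ad (α x) * C.M + C.k x * C.a := by
  rw [← sub_eq_zero]
  refine C.eq_zero (fun x => C.M * C.ad x - (C.ad (α x) * C.M + C.k x * C.a))
    (fun x => sub_mem (C.mul_vac _ (C.ad_vac _)) (add_mem (C.mul_vac _ C.M_vac) (C.vac_mul_a ?_)))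
    (fun x v => ⟨x, -C.e (α (α v)), ?_⟩) x
  · exact sw_mem _ fun u w => C.mul_vac _ (C.ad_vac w)
  have h1 := C.d_bracket hg x v
  have h2 := C.k_mul_e x (α v)
  have h3 := C.ad_mul_d hg (α x) v
  simp only [sub_mul, mul_sub, mul_add, add_mul, neg_mul, mul_neg, mul_assoc, C.a_e, C.ad_e, C.M_e',
    C.ad_e_assoc, C.M_e_assoc, C.a_mul_M hg, C.a_mul_ad hg,
    hg.algebra.multiplicative, h1]
  rw [← mul_assoc (C.k x) (C.e (α v)), h2, ← mul_assoc (C.ad (α x)) (C.d v), h3]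
  noncomm_ring

omit [CharZero K] in
theorem k_bracket (x y : g) : C.k (ν x y) =
    sw (δ x) (fun u w => C.e (α (α u)) * C.ad (ν w (α y)) +
      C.e (α (ν u (α y))) * C.ad (α w)) +
    sw (δ y) fun u w => C.e (α (ν (α x) u)) * C.ad (α w) + C.e (α (α u)) * C.ad (ν (α x) w) := by
  rw [k, sw_compat hg x y (fun w => by fun_prop) (fun u => by fun_prop)]

/-- Here the cobracket is applied to the second leg; the co-Jacobi identity moves it to the first,
because `e (α x) * e (α y)` is skew. -/
theorem sw_e_mul_k (x : g) : sw (δ x) (fun u w => C.e (α (α u)) * C.k w) =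
    sw (δ x) fun u w => C.d (α u) * C.ad (α w) := by
  have h := sw_cojacobi_of_skew hg x (T := fun x y z => C.e (α x) * C.e (α y) * C.ad z)
    (fun y z => by fun_prop) (fun x z => by fun_prop) (fun x y => by fun_prop)
    (fun x y z => by rw [C.e_mul_e (α x), neg_mul])
  rw [← sw_smul] at h
  calc _ = _ := sw_congr _ fun u w => by rw [k, mul_sw]; simp only [mul_assoc]
    _ = _ := h
    _ = _ := sw_congr _ fun u w => by
      rw [d, sw_alpha hg u (fun w => by fun_prop) (fun u => by fun_prop), smul_mul_assoc, sw_mul]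

/-- `M` produces `d` on the multiplied leg and `k` on the acting leg; `sw_e_mul_k` says that these
cancel. -/
theorem M_mul_k (x : g) : C.M * C.k x = -(C.k (α x) * C.M) := by
  have h1 : ∀ u w, C.M * (C.e (α u) * C.ad w) = -(C.e (α (α u)) * C.ad (α w) * C.M) +
      (C.d (α u) * C.ad (α w) - C.e (α (α u)) * C.k w) * C.a := fun u w => by
    rw [C.M_e_assoc, C.M_mul_ad hg, C.a_mul_ad hg]
    noncomm_ring
  rw [k, k, mul_sw, sw_alpha hg x (fun w => by fun_prop) (fun u => by fun_prop), sw_mul]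
  simp only [h1]
  rw [sw_add, ← sw_mul C.a, sw_sub, C.sw_e_mul_k hg, sub_self, zero_mul, add_zero, sw_neg]

end OpCalculus

namespace OpCalculus

variable {E : Type*} [Ring E] [Algebra K E] {ν : g →ₗ[K] g →ₗ[K] g}
  {δ : g →ₗ[K] g ⊗[K] g} {α : g →ₗ[K] g} (C : OpCalculus ν δ α E)

/-! #### Contractions -/

/-- A scalar is the left factor `c • 1`, so `mul_L` suffices. -/
theorem L_smul (c : K) (F : g → E) : C.L (fun x => c • F x) = c • C.L F := by
  have := C.mul_L (c • 1) F
  simpa only [smul_mul_assoc, one_mul] using this.symm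

theorem R_smul (c : K) (F : g → E) : C.R (fun x => c • F x) = c • C.R F := by
  have := C.mul_R (c • 1) F
  simpa only [smul_mul_assoc, one_mul] using this.symm

theorem L_neg (F : g → E) : C.L (fun x => -F x) = -C.L F := by
  simpa only [neg_smul, one_smul] using C.L_smul (-1) F

theorem R_neg (F : g → E) : C.R (fun x => -F x) = -C.R F := by
  simpa only [neg_smul, one_smul] using C.R_smul (-1) F

theorem L_sub (F G : g → E) : C.L (fun x => F x - G x) = C.L F - C.L G := by
  simp only [sub_eq_add_neg, C.L_add, C.L_neg]

theorem R_sub (F G : g → E) : C.R (fun x => F x - G x) = C.R F - C.R G := by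
  simp only [sub_eq_add_neg, C.R_add, C.R_neg]

theorem L_zero : C.L (fun _ => 0) = 0 := by
  simpa only [zero_smul] using C.L_smul 0 (fun _ => 0)

theorem R_zero : C.R (fun _ => 0) = 0 := by
  simpa only [zero_smul] using C.R_smul 0 (fun _ => 0)

theorem L_congr {F G : g → E} (h : ∀ x, F x = G x) : C.L F = C.L G := by
  rw [funext h]

theorem R_congr {F G : g → E} (h : ∀ x, F x = G x) : C.R F = C.R G := by
  rw [funext h]

section

variable {V : Type*} [AddCommGroup V] [Module K V]

@[fun_prop] theorem lin_L {F : V → g → E} (hF : ∀ y, Lin K fun x => F x y) :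
    Lin K fun x => C.L fun y => F x y :=
  ⟨fun x y => by simp only [(hF _).add, C.L_add], fun c x => by simp only [(hF _).smul, C.L_smul]⟩

@[fun_prop] theorem lin_R {F : V → g → E} (hF : ∀ y, Lin K fun x => F x y) :
    Lin K fun x => C.R fun y => F x y :=
  ⟨fun x y => by simp only [(hF _).add, C.R_add], fun c x => by simp only [(hF _).smul, C.R_smul]⟩

end

/-- The contraction with the bracket of two arguments. -/
def A (P : g → E) : E := C.L fun x => C.L fun y => (2⁻¹ : K) • P (ν x y)

/-- The contraction with the bracket of an argument and a coaction. -/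
def B (G : g → E) : E := C.L fun x => C.R fun c => G (ν (α x) c)

theorem A_add (F G : g → E) : C.A (fun x => F x + G x) = C.A F + C.A G := by
  simp only [A, smul_add, C.L_add]

theorem A_sub (F G : g → E) : C.A (fun x => F x - G x) = C.A F - C.A G := by
  simp only [A, smul_sub, C.L_sub]

theorem A_neg (F : g → E) : C.A (fun x => -F x) = -C.A F := by
  simp only [A, smul_neg, C.L_neg]

theorem A_smul (c : K) (F : g → E) : C.A (fun x => c • F x) = c • C.A F := by
  simp only [A, smul_comm _ c, C.L_smul]

theorem A_congr {F G : g → E} (h : ∀ x, F x = G x) : C.A F = C.A G := by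
  rw [funext h]

theorem mul_A (T : E) (F : g → E) : T * C.A F = C.A fun x => T * F x := by
  simp only [A, C.mul_L, mul_smul_comm]

@[fun_prop] theorem lin_A {V : Type*} [AddCommGroup V] [Module K V] {F : V → g → E}
    (hF : ∀ y, Lin K fun x => F x y) : Lin K fun x => C.A fun y => F x y := by
  unfold A
  have : ∀ y z, Lin K fun x => F x (ν y z) := fun y z => hF _
  fun_prop

theorem L_mul_a {F : g → E} (hF : Lin K F) : C.L F * C.a = C.L fun x => F (α x) * C.a := by
  rw [← sub_eq_zero]
  refine C.eq_zero (fun F : {F : g → E // Lin K F} => C.L F.1 * C.a - C.L fun x => F.1 (α x) * C.a)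
    (fun F => sub_mem (C.vac_mul_a (C.L_vac _)) (C.L_vac _))
    -- The family ranges over all linear `F`: passing `e v` replaces `F` by `F x * e (α v)`, which
    -- is again linear, and the sign comes from `L_e`.
    (fun F v => ⟨⟨fun x => F.1 x * C.e (α v), by have := F.2; fun_prop⟩, -1, ?_⟩) ⟨F, hF⟩
  obtain ⟨F, hF⟩ := F
  simp only [sub_mul, mul_assoc, C.a_e]
  rw [C.L_e (by fun_prop), ← mul_assoc, C.L_e hF]
  simp only [mul_assoc, C.a_e]
  noncomm_ring

theorem LL_e {Q : g → g → E} (hx : ∀ y, Lin K fun x => Q x y) (hy : ∀ x, Lin K fun y => Q x y)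
    (v : g) : (C.L fun x => C.L fun y => Q x y) * C.e v =
      C.L (fun y => Q v y - Q y v) + C.L fun x => C.L fun y => Q x y * C.e v := by
  rw [C.L_e (by fun_prop)]
  simp only [C.L_e (hy _), C.L_sub]
  abel

/-- Two contractions anticommute, the arguments being skew. -/
theorem LL_swap {Q : g → g → E} (hx : ∀ y, Lin K fun x => Q x y) (hy : ∀ x, Lin K fun y => Q x y) :
    (C.L fun x => C.L fun y => Q x y) = -C.L fun x => C.L fun y => Q y x := by
  rw [← sub_eq_zero, sub_neg_eq_add]
  refine C.eq_zero (fun Q : {Q : g → g → E //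
      (∀ y, Lin K fun x => Q x y) ∧ ∀ x, Lin K fun y => Q x y} =>
      (C.L fun x => C.L fun y => Q.1 x y) + C.L fun x => C.L fun y => Q.1 y x)
    (fun Q => add_mem (C.L_vac _) (C.L_vac _))
    (fun Q v => ⟨⟨fun x y => Q.1 x y * C.e v, fun y => ?_, fun x => ?_⟩, 1, ?_⟩) ⟨Q, hx, hy⟩
  · have := Q.2.1 y; fun_prop
  · have := Q.2.2 x; fun_prop
  · obtain ⟨Q, hx, hy⟩ := Q
    rw [add_mul, C.LL_e hx hy, C.LL_e hy hx, C.L_sub, C.L_sub]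
    noncomm_ring

/-- The adjoint action precedes the contraction: it acts either on the remaining arguments or on the
contracted one. -/
theorem L_mul_ad {F : g → E} (hF : Lin K F) (v : g) :
    C.L F * C.ad v = C.L (fun x => F (α x) * C.ad v) + C.L fun x => F (ν v x) * C.a := by
  rw [← sub_eq_zero]
  refine C.eq_zero (fun F : {F : g → E // Lin K F} => C.L F.1 * C.ad v -
      (C.L (fun x => F.1 (α x) * C.ad v) + C.L fun x => F.1 (ν v x) * C.a))
    (fun F => sub_mem (C.mul_vac _ (C.ad_vac _)) (add_mem (C.L_vac _) (C.L_vac _)))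
    (fun F u => ⟨⟨fun x => F.1 x * C.e (α u), by have := F.2; fun_prop⟩, -1, ?_⟩) ⟨F, hF⟩
  obtain ⟨F, hF⟩ := F
  have h := C.L_mul_a (F := fun x => F x * C.e (ν v u)) (by fun_prop)
  simp only [sub_mul, add_mul, mul_assoc, C.ad_e, mul_add]
  rw [C.L_e (by fun_prop), C.L_e (by fun_prop), ← mul_assoc, C.L_e hF, ← mul_assoc, C.L_e hF,
    sub_mul, h]
  simp only [mul_assoc, C.a_e, C.ad_e, mul_add, C.L_add]
  noncomm_ring

theorem sw_L (t : g ⊗[K] g) {F : g → g → g → E} (hu : ∀ x w, Lin K fun u => F x u w)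
    (hw : ∀ x u, Lin K fun w => F x u w) :
    sw t (fun u w => C.L fun x => F x u w) = C.L fun x => sw t fun u w => F x u w := by
  induction t with
  | zero => simp [sw, C.L_zero]
  | add s t hs ht => simp only [(Lin.sw_left Lin.id _).add, hs, ht, C.L_add]
  | tmul u w => simp only [sw_tmul (hu _) (hw _),
      sw_tmul (B := fun u w => C.L fun x => F x u w) (fun w => by fun_prop) (fun u => by fun_prop)]

theorem sw_R (t : g ⊗[K] g) {F : g → g → g → E} (hu : ∀ x w, Lin K fun u => F x u w)
    (hw : ∀ x u, Lin K fun w => F x u w) :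
    sw t (fun u w => C.R fun x => F x u w) = C.R fun x => sw t fun u w => F x u w := by
  induction t with
  | zero => simp [sw, C.R_zero]
  | add s t hs ht => simp only [(Lin.sw_left Lin.id _).add, hs, ht, C.R_add]
  | tmul u w => simp only [sw_tmul (hu _) (hw _),
      sw_tmul (B := fun u w => C.R fun x => F x u w) (fun w => by fun_prop) (fun u => by fun_prop)]

variable (hg : IsHomLieBialgebra ν δ α α)
include hg

theorem R_mul_a {F : g → E} (hF : Lin K F) : C.R F * C.a = C.R fun x => F (α x) * C.a := by
  rw [← sub_eq_zero]
  refine C.eq_zero (fun F : {F : g → E // Lin K F} => C.R F.1 * C.a - C.R fun x => F.1 (α x) * C.a)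
    (fun F => sub_mem (C.vac_mul_a (C.R_vac _)) (C.R_vac _))
    (fun F v => ⟨⟨fun x => F.1 x * C.e (α (α v)), by have := F.2; fun_prop⟩, 1, ?_⟩) ⟨F, hF⟩
  obtain ⟨F, hF⟩ := F
  simp only [sub_mul, mul_assoc, C.a_e]
  rw [C.R_e (by fun_prop), ← mul_assoc, C.R_e hF,
    sw_alpha hg v (fun w => by fun_prop) (fun u => by fun_prop)]
  simp only [mul_assoc, C.a_e, add_mul, sw_mul]
  noncomm_ring

variable [CharZero K]

theorem A_e {P : g → E} (hP : Lin K P) (v : g) :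
    C.A P * C.e v = C.A (fun x => P x * C.e v) + C.L fun y => P (ν v y) := by
  rw [A, C.LL_e (fun y => by fun_prop) (fun x => by fun_prop), add_comm, A]
  simp only [smul_mul_assoc]
  congr 1
  refine C.L_congr fun y => ?_
  rw [hg.algebra.skew y v, ← neg_one_smul K, hP.smul]
  module

omit [CharZero K] in
theorem A_mul_a {P : g → E} (hP : Lin K P) : C.A P * C.a = C.A fun x => P (α x) * C.a := by
  rw [A, C.L_mul_a (by fun_prop)]
  refine C.L_congr fun x => ?_
  rw [C.L_mul_a (by fun_prop)]
  refine C.L_congr fun y => ?_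
  rw [hg.algebra.multiplicative, smul_mul_assoc]

-- By `LL_swap` a double contraction sees only the skew part of `Q`. If this is a function of the
-- bracket, the contraction is `A`; so relations such as `ad_mul_ad` become relations between
-- contractions.
omit hg in
theorem LL_eq_A {Q : g → g → E} (hx : ∀ y, Lin K fun x => Q x y) (hy : ∀ x, Lin K fun y => Q x y)
    {P : g → E} (h : ∀ x y, Q x y - Q y x = P (ν x y)) :
    (C.L fun x => C.L fun y => Q x y) = C.A P := by
  simp only [A, ← h, smul_sub, C.L_sub, C.L_smul]
  rw [C.LL_swap hy hx]
  module

/-- The contracted argument is either an argument untouched by `N`, with the sign of two odd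
operations, or the bracket formed by `N`, which gives `A`. -/
theorem L_mul_N {F : g → E} (hF : Lin K F) :
    C.L F * C.N = -C.L (fun x => F (α x) * C.N) + C.A fun x => F x * C.a := by
  rw [← sub_eq_zero]
  refine C.eq_zero (fun F : {F : g → E // Lin K F} => C.L F.1 * C.N -
      (-C.L (fun x => F.1 (α x) * C.N) + C.A fun x => F.1 x * C.a))
    (fun F => sub_mem (C.mul_vac _ C.N_vac) (add_mem (neg_mem (C.L_vac _)) (C.L_vac _)))
    (fun F u => ⟨⟨fun x => F.1 x * C.e (α u), by have := F.2; fun_prop⟩, 1, ?_⟩) ⟨F, hF⟩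
  obtain ⟨F, hF⟩ := F
  simp only [sub_mul, add_mul, neg_mul, mul_assoc, C.N_e, mul_add, mul_neg]
  rw [C.L_mul_ad hF, C.L_e (by fun_prop), ← mul_assoc, C.L_e hF, C.A_e hg (by fun_prop)]
  simp only [mul_assoc, C.N_e, C.a_e, mul_add, mul_neg, C.L_add, C.L_neg]
  noncomm_ring

omit hg [CharZero K] in
/-- The contraction with a cyclic permutation of three arguments. -/
theorem A_L {Q : g → g → E} (hx : ∀ y, Lin K fun x => Q x y) (hy : ∀ x, Lin K fun y => Q x y) :
    (C.A fun x => C.L fun y => Q x y) = C.L fun x => C.A fun y => Q y x := by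
  have h1 : ∀ y z, Lin K fun x => Q (ν x y) z := fun y z => (hx z).comp (Lin.coe₂ ν y)
  have h2 : ∀ x z, Lin K fun y => Q (ν x y) z := fun x z => (hx z).comp (Lin.coe (ν x))
  simp only [A, ← C.L_smul]
  calc _ = C.L fun x => -C.L fun z => C.L fun y => (2⁻¹ : K) • Q (ν x y) z :=
        C.L_congr fun x => C.LL_swap (fun z => by have := h2 x; fun_prop) (fun y => by fun_prop)
    _ = -C.L fun x => C.L fun z => C.L fun y => (2⁻¹ : K) • Q (ν x y) z := by rw [C.L_neg]
    _ = C.L fun z => C.L fun x => C.L fun y => (2⁻¹ : K) • Q (ν x y) z := by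
      rw [C.LL_swap (fun z => by fun_prop) (fun y => by fun_prop), neg_neg]

/-- The Jacobi identity turns the double contraction into a contraction with nested brackets, which
a cyclic permutation (`A_L`) identifies with `-1/2` times the original. Thus `3/2` times it is zero.
-/
theorem L_A_jacobi {P : g → E} (hP : Lin K P) : (C.L fun x => C.A fun y => P (ν (α x) y)) = 0 := by
  have h1 : (C.L fun x => C.A fun y => P (ν (α x) y)) =
      C.A fun t => C.L fun z => (2⁻¹ : K) • P (ν t (α z)) :=
    C.LL_eq_A (fun y => by fun_prop) (fun x => by fun_prop) fun x y => by
      rw [← C.L_sub]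
      refine C.L_congr fun z => ?_
      rw [← smul_sub, ← bracket_bracket hg, sub_eq_add_neg, sub_eq_add_neg, hP.add,
        ← neg_one_smul K (ν _ _), hP.smul, neg_one_smul]
  have h2 : (C.A fun t => C.L fun z => (2⁻¹ : K) • P (ν t (α z))) =
      -((2⁻¹ : K) • C.L fun x => C.A fun y => P (ν (α x) y)) := by
    rw [C.A_L (fun y => by fun_prop) (fun x => by fun_prop), ← C.L_smul, ← C.L_neg]
    refine C.L_congr fun x => ?_
    rw [← C.A_smul, ← C.A_neg]
    refine C.A_congr fun y => ?_
    rw [hg.algebra.skew, ← neg_one_smul K (ν _ _), hP.smul, smul_comm, neg_one_smul]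
  rw [h2, eq_neg_iff_add_eq_zero] at h1
  have h3 : ((3 : K) / 2) • (C.L fun x => C.A fun y => P (ν (α x) y)) = 0 := by
    rw [← h1]; module
  exact (smul_eq_zero.mp h3).resolve_left (by norm_num)

theorem A_L_jacobi {P : g → E} (hP : Lin K P) :
    (C.A fun x => C.L fun y => P (ν x (α y))) = 0 := by
  rw [C.A_L (fun y => by fun_prop) (fun x => by fun_prop), ← neg_eq_zero, ← C.L_neg,
    ← C.L_A_jacobi hg hP]
  refine C.L_congr fun x => ?_
  rw [← C.A_neg]
  refine C.A_congr fun y => ?_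
  rw [hg.algebra.skew, ← neg_one_smul K (ν _ _), hP.smul, neg_one_smul, neg_neg]

/-- The two terms in which a bracket produced by `N` is bracketed again vanish by the Jacobi
identity, and the two signs of `L_mul_N` cancel. -/
theorem A_mul_N {P : g → E} (hP : Lin K P) : C.A P * C.N = C.A fun x => P (α x) * C.N := by
  rw [A, C.L_mul_N hg (by fun_prop)]
  have h1 : ∀ x, (C.L fun y => (2⁻¹ : K) • P (ν (α x) y)) * C.N =
      -(C.L fun y => (2⁻¹ : K) • (P (α (ν x y)) * C.N)) +
        C.A fun y => (2⁻¹ : K) • P (ν (α x) y) * C.a := fun x => by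
    rw [C.L_mul_N hg (by fun_prop)]
    simp only [hg.algebra.multiplicative, smul_mul_assoc]
  have h2 : ∀ x, (C.L fun y => (2⁻¹ : K) • P (ν x y)) * C.a =
      C.L fun y => (2⁻¹ : K) • P (ν x (α y)) * C.a := fun x => by rw [C.L_mul_a (by fun_prop)]
  simp only [h1, h2]
  rw [C.A_L_jacobi hg (P := fun x => (2⁻¹ : K) • P x * C.a) (by fun_prop), C.L_add,
    C.L_A_jacobi hg (P := fun x => (2⁻¹ : K) • P x * C.a) (by fun_prop), C.L_neg]
  simp [A]

/-! #### Contractions and coactions -/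

-- After the coaction, `L` contracts either an untouched argument, already twisted by `α`, or the
-- second leg of the cobracket.
omit hg [CharZero K] in
theorem R_L {Q : g → g → E} (hx : ∀ y, Lin K fun x => Q x y) (hy : ∀ x, Lin K fun y => Q x y) :
    (C.R fun c => C.L fun x => Q c x) =
      (C.L fun x => C.R fun c => Q c (α x)) + C.L fun v => sw (δ v) (fun u w => Q u w) * C.a := by
  rw [← sub_eq_zero]
  refine C.eq_zero (fun Q : {Q : g → g → E //
      (∀ y, Lin K fun x => Q x y) ∧ ∀ x, Lin K fun y => Q x y} =>
      (C.R fun c => C.L fun x => Q.1 c x) - ((C.L fun x => C.R fun c => Q.1 c (α x)) +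
        C.L fun v => sw (δ v) (fun u w => Q.1 u w) * C.a))
    (fun Q => sub_mem (C.R_vac _) (add_mem (C.L_vac _) (C.L_vac _)))
    (fun Q v => ⟨⟨fun x y => Q.1 x y * C.e (α v), fun y => ?_, fun x => ?_⟩, -1, ?_⟩) ⟨Q, hx, hy⟩
  · have := Q.2.1 y; fun_prop
  · have := Q.2.2 x; fun_prop
  obtain ⟨Q, hx, hy⟩ := Q
  simp only [sub_mul, add_mul]
  rw [C.R_e (by fun_prop), C.L_e (by fun_prop), C.L_e (by fun_prop)]
  have h1 : ∀ x, (C.R fun c => Q c (α x)) * C.e v =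
      sw (δ v) (fun u w => Q u (α x) * C.e w) * C.a + C.R fun c => Q c (α x) * C.e (α v) :=
    fun x => C.R_e (by fun_prop) v
  have h2 : ∀ c, (C.L fun x => Q c x) * C.e (α v) = Q c (α v) - C.L fun x => Q c x * C.e (α v) :=
    fun c => C.L_e (hy c) _
  have h3 : sw (δ v) (fun u w => (C.L fun x => Q u x) * C.e w) * C.a =
      sw (δ v) (fun u w => Q u w) * C.a -
        C.L fun x => sw (δ v) (fun u w => Q u (α x) * C.e w) * C.a := by
    have h4 : ∀ u w, (C.L fun x => Q u x) * C.e w = Q u w - C.L fun x => Q u x * C.e w :=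
      fun u w => C.L_e (hy u) w
    simp only [h4]
    rw [sw_sub, C.sw_L _ (fun x w => by fun_prop) (fun x u => by fun_prop), sub_mul,
      C.L_mul_a (by fun_prop)]
  simp only [h1, h2, h3, C.R_sub, C.L_add, mul_assoc, C.a_e, sw_mul]
  noncomm_ring

-- Expanding the cobracket of `[v, x]` by the compatibility gives four terms. Those where `v` acts
-- on a leg of `δ x` belong to the two contractions `R`; those with `δ v` are the last two summands.
omit [CharZero K] in
theorem R_mul_ad {G : g → E} (hG : Lin K G) (v : g) :
    C.R G * C.ad v = C.R (fun c => G (α c) * C.ad (α v)) + C.R (fun c => G (ν (α v) c) * C.a) +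
      C.L (fun x => sw (δ v) (fun u w => G (ν u (α x)) * C.e (α w)) * (C.a * C.a)) +
      sw (δ v) (fun u w => G (α u) * C.ad w) * C.a := by
  rw [← sub_eq_zero]
  refine C.eq_zero (fun G : {G : g → E // Lin K G} => C.R G.1 * C.ad v -
      (C.R (fun c => G.1 (α c) * C.ad (α v)) + C.R (fun c => G.1 (ν (α v) c) * C.a) +
      C.L (fun x => sw (δ v) (fun u w => G.1 (ν u (α x)) * C.e (α w)) * (C.a * C.a)) +
      sw (δ v) (fun u w => G.1 (α u) * C.ad w) * C.a))
    (fun G => sub_mem (C.mul_vac _ (C.ad_vac _)) (add_mem (add_mem (add_mem (C.R_vac _) (C.R_vac _))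
      (C.L_vac _)) (C.vac_mul_a (sw_mem _ fun u w => C.mul_vac _ (C.ad_vac _)))))
    (fun G u => ⟨⟨fun x => G.1 x * C.e (α (α u)), by have := G.2; fun_prop⟩, 1, ?_⟩) ⟨G, hG⟩
  obtain ⟨G, hG⟩ := G
  have hl : C.R G * (C.ad v * C.e u) =
      sw (δ v) (fun p q => G (α p) * C.e (ν q (α u)) * (C.a * C.a)) +
      sw (δ v) (fun p q => G (ν p (α u)) * C.e (α q) * (C.a * C.a)) +
      sw (δ u) (fun p q => G (ν (α v) p) * C.e (α q) * (C.a * C.a)) +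
      sw (δ u) (fun p q => G (α p) * C.e (ν (α v) q) * (C.a * C.a)) +
      C.R (fun c => G (α c) * C.e (ν (α v) (α u)) * C.a) +
      sw (δ u) (fun p q => G (α p) * C.e (α q) * (C.ad (α v) * C.a)) +
      C.R (fun c => G c * C.e (α (α u))) * C.ad v := by
    rw [C.ad_e, mul_add, ← mul_assoc, ← mul_assoc, C.R_e hG, C.R_e hG, add_mul, add_mul,
      C.R_mul_a hg (by fun_prop), sw_compat hg v u (fun w => by fun_prop) (fun u => by fun_prop),
      sw_alpha hg u (fun w => by fun_prop) (fun u => by fun_prop)]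
    simp only [hg.algebra.multiplicative, add_mul, sw_add, sw_mul, mul_assoc, C.a_mul_ad hg]
    abel
  have h1 : C.R (fun c => G (α c) * C.ad (α v)) * C.e u =
      sw (δ u) (fun p q => G (α p) * C.e (ν (α v) q) * (C.a * C.a)) +
      sw (δ u) (fun p q => G (α p) * C.e (α q) * (C.ad (α v) * C.a)) +
      C.R (fun c => G (α c) * C.e (ν (α v) (α u)) * C.a) +
      C.R (fun c => G (α c) * C.e (α (α u)) * C.ad (α v)) := by
    rw [C.R_e (by fun_prop)]
    simp only [mul_assoc, C.ad_e, mul_add, sw_add, C.R_add, add_mul, sw_mul]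
    abel
  have h2 : C.R (fun c => G (ν (α v) c) * C.a) * C.e u =
      sw (δ u) (fun p q => G (ν (α v) p) * C.e (α q) * (C.a * C.a)) +
      C.R (fun c => G (ν (α v) c) * C.e (α (α u)) * C.a) := by
    rw [C.R_e (by fun_prop)]
    simp only [mul_assoc, C.a_e, sw_mul]
  have h3 : C.L (fun x => sw (δ v) (fun u w => G (ν u (α x)) * C.e (α w)) * (C.a * C.a)) * C.e u =
      sw (δ v) (fun p q => G (ν p (α u)) * C.e (α q) * (C.a * C.a)) +
      C.L (fun x => sw (δ v) (fun p w => G (ν p (α x)) * C.e (α (α u)) * C.e (α w)) *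
        (C.a * C.a)) := by
    rw [C.L_e (by fun_prop), sw_mul, sub_eq_add_neg, ← C.L_neg]
    congr 1
    refine C.L_congr fun x => ?_
    rw [mul_assoc, mul_assoc, C.a_e, ← mul_assoc C.a, C.a_e, mul_assoc (C.e _), ← mul_assoc, sw_mul,
      ← neg_mul, ← sw_neg]
    congr 1
    refine sw_congr _ fun p q => ?_
    rw [mul_assoc, mul_assoc, C.e_mul_e (α q)]
    noncomm_ring
  have h4 : sw (δ v) (fun p w => G (α p) * C.ad w) * C.a * C.e u =
      sw (δ v) (fun p q => G (α p) * C.e (ν q (α u)) * (C.a * C.a)) +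
      sw (δ v) (fun p w => G (α p) * C.e (α (α u)) * C.ad w) * C.a := by
    rw [mul_assoc, C.a_e, ← mul_assoc, sw_mul]
    simp only [mul_assoc, C.ad_e, mul_add, sw_add, add_mul, sw_mul]
  simp only [sub_mul, add_mul, one_mul]
  rw [mul_assoc, hl, h1, h2, h3, h4]
  abel

-- In the cobracket of a bracket formed by `N`, the bracket lands on one of the legs. On the second
-- leg it belongs to `N` after the coaction, on the first leg it gives `B`. The proof reduces this
-- to `R_mul_ad`.
omit [CharZero K] in
theorem R_mul_N {G : g → E} (hG : Lin K G) :
    C.R G * C.N = C.R (fun c => G (α c) * C.N) + C.B fun c => G c * C.a := by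
  rw [← sub_eq_zero]
  refine C.eq_zero (fun G : {G : g → E // Lin K G} => C.R G.1 * C.N -
      (C.R (fun c => G.1 (α c) * C.N) + C.B fun c => G.1 c * C.a))
    (fun G => sub_mem (C.mul_vac _ C.N_vac) (add_mem (C.R_vac _) (C.L_vac _)))
    (fun G u => ⟨⟨fun x => G.1 x * C.e (α (α u)), by have := G.2; fun_prop⟩, -1, ?_⟩) ⟨G, hG⟩
  obtain ⟨G, hG⟩ := G
  have hl : C.R G * (C.N * C.e u) = C.R G * C.ad u -
      sw (δ u) (fun p q => G (α p) * C.e (α q) * (C.N * C.a)) -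
      C.R (fun x => G x * C.e (α (α u))) * C.N := by
    rw [C.N_e, mul_add, mul_neg, ← mul_assoc, C.R_e hG,
      sw_alpha hg u (fun w => by fun_prop) (fun u => by fun_prop), add_mul, mul_assoc,
      C.a_mul_N hg, sw_mul]
    abel
  have h1 : C.R (fun c => G (α c) * C.N) * C.e u =
      sw (δ u) (fun p q => G (α p) * C.ad q) * C.a -
      sw (δ u) (fun p q => G (α p) * C.e (α q) * (C.N * C.a)) +
      C.R (fun c => G (α c) * C.ad (α u)) - C.R (fun c => G (α c) * C.e (α (α u)) * C.N) := by
    rw [C.R_e (by fun_prop)]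
    simp only [mul_assoc, C.N_e, mul_add, mul_neg, sw_add, sw_neg, C.R_add, C.R_neg, add_mul,
      neg_mul, sw_mul]
    abel
  have h2 : (C.B fun c => G c * C.a) * C.e u = C.R (fun c => G (ν (α u) c) * C.a) +
      C.L (fun x => sw (δ u) (fun p q => G (ν p (α x)) * C.e (α q)) * (C.a * C.a)) -
      C.B fun c => G c * C.e (α (α u)) * C.a := by
    have h3 : ∀ x, (C.R fun c => G (ν (α x) c) * C.a) * C.e u =
        -(sw (δ u) (fun p q => G (ν p (α x)) * C.e (α q)) * (C.a * C.a)) +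
        C.R fun c => G (ν (α x) c) * C.e (α (α u)) * C.a := fun x => by
      rw [C.R_e (by fun_prop), ← neg_mul, ← sw_neg]
      have h4 : ∀ p, G (ν (α x) p) = -G (ν p (α x)) := fun p => by
        rw [hg.algebra.skew, ← neg_one_smul K (ν _ _), hG.smul, neg_one_smul]
      simp only [mul_assoc, C.a_e, sw_mul, h4, neg_mul]
    rw [B, C.L_e (by fun_prop)]
    simp only [h3, C.L_add, C.L_neg, B]
    abel
  simp only [sub_mul, add_mul]
  rw [mul_assoc, hl, h1, h2, C.R_mul_ad hg hG]
  simp only [neg_mul, one_mul]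
  abel

/-- Coactions on two different arguments cancel because `q` is skew. In the remaining iterated
cobracket `sw_cojacobi_of_skew` moves the inner cobracket to the first leg, whence the half. -/
theorem R_R {q : g → g → E} (hx : ∀ y, Lin K fun x => q x y) (hy : ∀ x, Lin K fun y => q x y)
    (h : ∀ x y, q x y = -q y x) :
    (C.R fun c => C.R fun c' => q (α c) c') =
      C.R fun c => (2⁻¹ : K) • sw (δ c) (fun u w => q u w) * C.a := by
  rw [← sub_eq_zero]
  refine C.eq_zero (fun q : {q : g → g → E // (∀ y, Lin K fun x => q x y) ∧
      (∀ x, Lin K fun y => q x y) ∧ ∀ x y, q x y = -q y x} =>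
      (C.R fun c => C.R fun c' => q.1 (α c) c') -
      C.R fun c => (2⁻¹ : K) • sw (δ c) (fun u w => q.1 u w) * C.a)
    (fun q => sub_mem (C.R_vac _) (C.R_vac _))
    (fun q v => ⟨⟨fun x y => q.1 x y * C.e (α (α v)), fun y => ?_, fun x => ?_, fun x y => ?_⟩, 1,
      ?_⟩) ⟨q, hx, hy, h⟩
  · have := q.2.1 y; fun_prop
  · have := q.2.2.1 x; fun_prop
  · show q.1 x y * _ = -(q.1 y x * _)
    rw [q.2.2.2 x y, neg_mul]
  obtain ⟨q, hx, hy, h⟩ := q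
  have h1 : ∀ u w, (C.R fun c' => q (α u) c') * C.e w =
      sw (δ w) (fun w₁ w₂ => q (α u) w₁ * C.e w₂) * C.a + C.R fun c' => q (α u) c' * C.e (α w) :=
    fun u w => C.R_e (hy _) w
  have h2 : sw (δ v) (fun u w => sw (δ w) (fun w₁ w₂ => q (α u) w₁ * C.e w₂)) =
      (2⁻¹ : K) • sw (δ v) fun u w => sw (δ u) fun u₁ u₂ => q u₁ u₂ * C.e (α w) :=
    sw_cojacobi_of_skew hg v (T := fun x y z => q x y * C.e z)
    (fun y z => by fun_prop) (fun x z => by fun_prop) (fun x y => by fun_prop)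
    (fun x y z => by rw [h, neg_mul])
  have h3 : (C.R fun c => C.R fun c' => q (α c) c') * C.e v =
      ((2⁻¹ : K) • sw (δ v) fun u w => sw (δ u) fun u₁ u₂ => q u₁ u₂ * C.e (α w)) * (C.a * C.a) +
      C.R fun c => C.R fun c' => q (α c) c' * C.e (α (α v)) := by
    have h5 : sw (δ v) (fun u w => C.R fun c' => q (α u) c' * C.e (α w)) * C.a =
        -C.R fun c => sw (δ v) (fun u w => q (α c) (α u) * C.e (α w)) * C.a := by
      rw [C.sw_R _ (fun x w => by fun_prop) (fun x u => by fun_prop), C.R_mul_a hg (by fun_prop),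
        ← C.R_neg]
      refine C.R_congr fun c => ?_
      rw [← neg_mul, ← sw_neg]
      refine congrArg (· * C.a) (sw_congr _ fun u w => ?_)
      rw [h, neg_mul]
    rw [C.R_e (by fun_prop)]
    simp only [h1]
    rw [sw_add, add_mul, h5, ← sw_mul C.a (δ v) fun u w => sw (δ w) _, h2, C.R_add]
    have h7 : ∀ c, sw (δ (α v)) (fun w₁ w₂ => q (α c) w₁ * C.e w₂) =
        sw (δ v) fun u w => q (α c) (α u) * C.e (α w) := fun c =>
      sw_alpha hg v (fun w => by fun_prop) (fun u => by fun_prop)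
    simp only [h7]
    rw [mul_assoc]
    abel
  simp only [sub_mul]
  rw [h3, C.R_e (by fun_prop)]
  have h6 : ∀ (T : E) u, T * C.a * C.e u = T * C.e (α u) * C.a := fun T u => by
    rw [mul_assoc, C.a_e, mul_assoc]
  simp only [h6, smul_mul_assoc, sw_smul, sw_mul, mul_assoc, one_mul]
  abel

omit [CharZero K] in
theorem B_mul_N_aux {G : g → E} (hG : Lin K G) (x y c : g) :
    G (ν (α (α x)) (ν (α y) c)) - G (ν (α (α y)) (ν (α x) c)) = G (ν (α (ν x y)) (α c)) := by
  rw [← hg.algebra.multiplicative, ← bracket_bracket hg, sub_eq_add_neg, sub_eq_add_neg, hG.add,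
    ← neg_one_smul K (ν _ _), hG.smul, neg_one_smul]

/-- Two corrections arise: `N` acting after the coaction yields a double action, and the contraction
of a bracket yields `A`. They cancel by the Jacobi identity. -/
theorem B_mul_N {G : g → E} (hG : Lin K G) :
    C.B G * C.N = -C.B fun c => G (α c) * C.N := by
  have h1 : ∀ x, (C.R fun c => G (ν (α (α x)) c)) * C.N =
      (C.R fun c => G (α (ν (α x) c)) * C.N) +
        C.L fun y => C.R fun c => G (ν (α (α x)) (ν (α y) c)) * C.a := fun x => by
    rw [C.R_mul_N hg (by fun_prop), B]
    simp only [hg.algebra.multiplicative]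
  have h2 : (C.L fun x => C.L fun y => C.R fun c => G (ν (α (α x)) (ν (α y) c)) * C.a) =
      C.A fun t => C.R fun c => G (ν (α t) (α c)) * C.a :=
    C.LL_eq_A (fun y => by fun_prop) (fun x => by fun_prop) fun x y => by
      rw [← C.R_sub]
      refine C.R_congr fun c => ?_
      rw [← sub_mul, B_mul_N_aux hg hG]
  have h3 : ∀ x, (C.R fun c => G (ν (α x) c)) * C.a = C.R fun c => G (ν (α x) (α c)) * C.a :=
    fun x => C.R_mul_a hg (by fun_prop)
  rw [B, C.L_mul_N hg (by fun_prop)]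
  simp only [h1, h3, C.L_add]
  rw [h2, B]
  abel

end OpCalculus

/-- `p` commutes with all the operations of a Hom-Lie bialgebra. -/
structure IsEndo (ν : g →ₗ[K] g →ₗ[K] g) (δ : g →ₗ[K] g ⊗[K] g) (α p : g →ₗ[K] g) : Prop where
  bracket : ∀ x y, p (ν x y) = ν (p x) (p y)
  twist : ∀ x, p (α x) = α (p x)
  cobracket : ∀ x, δ (p x) = TensorProduct.map p p (δ x)

theorem IsEndo.sw_cobracket {ν : g →ₗ[K] g →ₗ[K] g} {δ : g →ₗ[K] g ⊗[K] g} {α p : g →ₗ[K] g}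
    (hp : IsEndo ν δ α p) {W : Type*} [AddCommGroup W] [Module K W] (x : g) {B : g → g → W}
    (hu : ∀ w, Lin K fun u => B u w) (hw : ∀ u, Lin K fun w => B u w) :
    sw (δ (p x)) B = sw (δ x) fun u w => B (p u) (p w) := by
  rw [hp.cobracket, sw_map hu hw]

theorem IsEndo.id {ν : g →ₗ[K] g →ₗ[K] g} {δ : g →ₗ[K] g ⊗[K] g} {α : g →ₗ[K] g} :
    IsEndo ν δ α LinearMap.id :=
  ⟨fun _ _ => rfl, fun _ => rfl, fun x => by rw [TensorProduct.map_id]; rfl⟩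

theorem IsEndo.comp {ν : g →ₗ[K] g →ₗ[K] g} {δ : g →ₗ[K] g ⊗[K] g} {α p : g →ₗ[K] g}
    (hg : IsHomLieBialgebra ν δ α α) (hp : IsEndo ν δ α p) : IsEndo ν δ α (α ∘ₗ p) where
  bracket x y := by
    simp only [LinearMap.comp_apply, hp.bracket, hg.algebra.multiplicative]
  twist x := by simp only [LinearMap.comp_apply, hp.twist]
  cobracket x := by
    rw [TensorProduct.map_comp, LinearMap.comp_apply, LinearMap.comp_apply, ← hp.cobracket]
    exact LinearMap.congr_fun hg.cobracket_comm (p x)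

namespace OpCalculus

variable {E : Type*} [Ring E] [Algebra K E] {ν : g →ₗ[K] g →ₗ[K] g}
  {δ : g →ₗ[K] g ⊗[K] g} {α : g →ₗ[K] g} (C : OpCalculus ν δ α E)

/-! #### The components of the differential -/

/-- The composition with the bracket. -/
def lieL (p : g →ₗ[K] g) (T : E) : E := C.L fun x => C.ad (p x) * T

/-- The composition with the cobracket. -/
def lieR (p : g →ₗ[K] g) (T : E) : E := C.R fun c => C.e (p c) * T

/-- The bracket of two arguments, acting on the value. -/
def nuA (p : g →ₗ[K] g) (T : E) : E := C.A fun x => C.ad (p x) * T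

/-- The dual of `nuA`. -/
def coA (p : g →ₗ[K] g) (T : E) : E := C.R fun c => C.d (p c) * T

/-- The first half of the mixed term. -/
def kL (p : g →ₗ[K] g) (T : E) : E := C.L fun x => C.k (p x) * T

/-- The second half of the mixed term. -/
def eB (p : g →ₗ[K] g) (T : E) : E := C.B fun c => C.e (p c) * T

@[fun_prop] theorem lin_lieL (p : g →ₗ[K] g) : Lin K fun T => C.lieL p T := by
  unfold lieL; fun_prop

@[fun_prop] theorem lin_lieR (p : g →ₗ[K] g) : Lin K fun T => C.lieR p T := by
  unfold lieR; fun_prop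

@[fun_prop] theorem lin_nuA (p : g →ₗ[K] g) : Lin K fun T => C.nuA p T := by
  unfold nuA; fun_prop

@[fun_prop] theorem lin_coA (p : g →ₗ[K] g) : Lin K fun T => C.coA p T := by
  unfold coA; fun_prop

@[fun_prop] theorem lin_kL (p : g →ₗ[K] g) : Lin K fun T => C.kL p T := by
  unfold kL; fun_prop

@[fun_prop] theorem lin_eB (p : g →ₗ[K] g) : Lin K fun T => C.eB p T := by
  unfold eB B; fun_prop

variable (hg : IsHomLieBialgebra ν δ α α) {p : g →ₗ[K] g} (hp : IsEndo ν δ α p)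

include hp in
theorem d_endo (x : g) : C.d (p x) = (2⁻¹ : K) • sw (δ x) fun u w => C.e (p u) * C.e (p w) := by
  rw [d, hp.sw_cobracket x (fun w => by fun_prop) (fun u => by fun_prop)]

include hp in
theorem k_endo (x : g) : C.k (p x) = sw (δ x) fun u w => C.e (α (p u)) * C.ad (p w) := by
  rw [k, hp.sw_cobracket x (fun w => by fun_prop) (fun u => by fun_prop)]

/-! #### Commutation with the twist -/

include hg in
theorem a_mul_lieL (T : E) : C.a * C.lieL p T = C.lieL (α ∘ₗ p) (C.a * T) := by
  simp only [lieL, C.mul_L, C.a_ad_assoc hg, LinearMap.comp_apply]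

theorem a_mul_lieR (T : E) : C.a * C.lieR p T = C.lieR (α ∘ₗ p) (C.a * T) := by
  simp only [lieR, C.mul_R, C.a_e_assoc, LinearMap.comp_apply]

include hp in
theorem lieL_mul_a (T : E) : C.lieL p T * C.a = C.lieL (α ∘ₗ p) (T * C.a) := by
  rw [lieL, C.L_mul_a (by fun_prop)]
  simp only [lieL, hp.twist, mul_assoc, LinearMap.comp_apply]

include hg hp in
theorem lieR_mul_a (T : E) : C.lieR p T * C.a = C.lieR (α ∘ₗ p) (T * C.a) := by
  rw [lieR, C.R_mul_a hg (by fun_prop)]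
  simp only [lieR, hp.twist, mul_assoc, LinearMap.comp_apply]

include hg in
theorem a_mul_nuA (T : E) : C.a * C.nuA p T = C.nuA (α ∘ₗ p) (C.a * T) := by
  simp only [nuA, C.mul_A, C.a_ad_assoc hg, LinearMap.comp_apply]

include hg hp in
theorem nuA_mul_a (T : E) : C.nuA p T * C.a = C.nuA (α ∘ₗ p) (T * C.a) := by
  rw [nuA, C.A_mul_a hg (by fun_prop)]
  simp only [nuA, hp.twist, mul_assoc, LinearMap.comp_apply]

include hg hp in
theorem coA_mul_a (T : E) : C.coA p T * C.a = C.coA (α ∘ₗ p) (T * C.a) := by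
  rw [coA, C.R_mul_a hg (by fun_prop)]
  simp only [coA, hp.twist, mul_assoc, LinearMap.comp_apply]

include hp in
theorem kL_mul_a (T : E) : C.kL p T * C.a = C.kL (α ∘ₗ p) (T * C.a) := by
  rw [kL, C.L_mul_a (by fun_prop)]
  simp only [kL, hp.twist, mul_assoc, LinearMap.comp_apply]

include hg hp in
theorem eB_mul_a (T : E) : C.eB p T * C.a = C.eB (α ∘ₗ p) (T * C.a) := by
  have h1 : ∀ x, (C.R fun c => C.e (p (ν (α x) c)) * T) * C.a =
    C.R fun c => C.e (p (ν (α x) (α c))) * T * C.a := fun x => C.R_mul_a hg (by fun_prop)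
  rw [eB, B, C.L_mul_a (by fun_prop)]
  simp only [h1, hg.algebra.multiplicative]
  simp only [eB, B, hp.twist, mul_assoc, LinearMap.comp_apply]

section

variable [CharZero K]
include hg

omit [CharZero K] in
theorem a_mul_coA (T : E) : C.a * C.coA p T = C.coA (α ∘ₗ p) (C.a * T) := by
  simp only [coA, C.mul_R, ← mul_assoc C.a, C.a_mul_d hg, mul_assoc, LinearMap.comp_apply]

omit [CharZero K] in
theorem a_mul_kL (T : E) : C.a * C.kL p T = C.kL (α ∘ₗ p) (C.a * T) := by
  simp only [kL, C.mul_L, ← mul_assoc C.a, C.a_mul_k hg, mul_assoc, LinearMap.comp_apply]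

omit hg [CharZero K] in
theorem a_mul_eB (T : E) : C.a * C.eB p T = C.eB (α ∘ₗ p) (C.a * T) := by
  simp only [eB, B, C.mul_L, C.mul_R, C.a_e_assoc, LinearMap.comp_apply]

/-! #### Products of the components of degree one -/

include hp

theorem lieL_mul_N (T : E) :
    C.lieL p T * C.N = -C.lieL (α ∘ₗ p) (T * C.N) + C.nuA p (T * C.a) := by
  rw [lieL, C.L_mul_N hg (by fun_prop)]
  simp only [lieL, nuA, hp.twist, mul_assoc, LinearMap.comp_apply]

/-- The skew part of two successive actions is the action of the bracket, by `ad_mul_ad`. -/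
theorem lieL_lieL (T : E) : C.lieL (α ∘ₗ p) (C.lieL p T) = C.nuA p (C.a * T) := by
  simp only [lieL, C.mul_L]
  refine C.LL_eq_A (fun y => by fun_prop) (fun x => by fun_prop) fun x y => ?_
  rw [← mul_assoc, ← mul_assoc, ← sub_mul, LinearMap.comp_apply, LinearMap.comp_apply,
    C.ad_mul_ad hg, hp.bracket, mul_assoc]

omit hp hg [CharZero K] in
theorem M_mul_lieR (T : E) :
    C.M * C.lieR p T = -C.lieR (α ∘ₗ p) (C.M * T) + C.coA p (C.a * T) := by
  simp only [lieR, coA, C.mul_R, C.M_e_assoc, C.R_add, C.R_neg, LinearMap.comp_apply]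

theorem lieR_lieR (T : E) : C.lieR (α ∘ₗ p) (C.lieR p T) = C.coA p (T * C.a) := by
  have h := C.R_R hg (q := fun y z => C.e (p y) * (C.e (p z) * T)) (fun y => by fun_prop)
    (fun y => by fun_prop) (fun x y => by
      rw [← mul_assoc, ← mul_assoc, C.e_mul_e (p x), neg_mul])
  simp only [hp.twist] at h
  simp only [lieR, C.mul_R, LinearMap.comp_apply, h, coA, C.d_endo hp, smul_mul_assoc, sw_mul,
    mul_assoc]

omit hp in
theorem M_mul_lieL (T : E) :
    C.M * C.lieL p T = C.lieL (α ∘ₗ p) (C.M * T) + C.kL p (C.a * T) := by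
  simp only [lieL, kL, C.mul_L, ← mul_assoc C.M, C.M_mul_ad hg, add_mul, C.L_add, mul_assoc,
    LinearMap.comp_apply]

omit [CharZero K] in
theorem lieR_mul_N (T : E) :
    C.lieR p T * C.N = C.lieR (α ∘ₗ p) (T * C.N) + C.eB p (T * C.a) := by
  rw [lieR, C.R_mul_N hg (by fun_prop)]
  simp only [lieR, eB, hp.twist, mul_assoc, LinearMap.comp_apply]

-- `kL` arises when the contraction meets the second leg of the cobracket (`R_L`), and `eB` when the
-- adjoint action hits the inserted first leg.
omit hg [CharZero K] in
theorem lieR_lieL (T : E) : C.lieR (α ∘ₗ p) (C.lieL p T) =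
    C.lieL (α ∘ₗ p) (C.lieR p T) + C.kL p (T * C.a) - C.eB p (C.a * T) := by
  have h := C.R_L (Q := fun c x => C.e (α (p c)) * (C.ad (p x) * T)) (fun y => by fun_prop)
    (fun y => by fun_prop)
  simp only [lieR, lieL, C.mul_R, C.mul_L, LinearMap.comp_apply, h, kL, eB, B, C.ad_e_assoc,
    C.L_add, C.R_add, hp.bracket, hp.twist, C.k_endo hp, sw_mul, mul_assoc]
  abel

/-! #### The bracket of two arguments -/

/-- After a cyclic permutation of the three arguments the difference of the two sides is a
contraction with `[x, [y, z]]`, which vanishes by `L_A_jacobi`. -/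
theorem lieL_nuA (T : E) :
    C.lieL (α ∘ₗ α ∘ₗ p) (C.nuA p T) = C.nuA (α ∘ₗ p) (C.lieL (α ∘ₗ p) T) := by
  have h1 : (C.nuA (α ∘ₗ p) (C.lieL (α ∘ₗ p) T)) =
      C.L fun x => C.A fun y => C.ad (α (p y)) * (C.ad (α (p x)) * T) := by
    simp only [nuA, lieL, C.mul_L, LinearMap.comp_apply]
    exact C.A_L (fun y => by fun_prop) fun y => by fun_prop
  have h2 := C.L_A_jacobi hg (P := fun t => C.ad (p t) * (C.a * T)) (by fun_prop)
  rw [h1, ← sub_eq_zero, ← h2, lieL, ← C.L_sub]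
  refine C.L_congr fun x => ?_
  rw [nuA, C.mul_A, ← C.A_sub]
  refine C.A_congr fun y => ?_
  rw [← mul_assoc, ← mul_assoc, ← sub_mul, LinearMap.comp_apply, LinearMap.comp_apply,
    C.ad_mul_ad hg, hp.bracket, hp.twist, mul_assoc]

theorem nuA_mul_N (T : E) : C.nuA p T * C.N = C.nuA (α ∘ₗ p) (T * C.N) := by
  rw [nuA, C.A_mul_N hg (by fun_prop)]
  simp only [nuA, hp.twist, mul_assoc, LinearMap.comp_apply]

omit hp in
theorem M_mul_coA (T : E) : C.M * C.coA p T = C.coA (α ∘ₗ p) (C.M * T) := by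
  simp only [coA, C.mul_R, ← mul_assoc C.M, C.M_mul_d hg, mul_assoc, LinearMap.comp_apply]

theorem lieR_coA (T : E) :
    C.lieR (α ∘ₗ α ∘ₗ p) (C.coA p T) = C.coA (α ∘ₗ p) (C.lieR (α ∘ₗ p) T) := by
  -- The difference of the two sides is written as one function, which is skew since `d` commutes
  -- with `e`. Then `R_R` leaves a single cobracket, zero by the co-Jacobi identity.
  have h := C.R_R hg
    (q := fun y z => C.e (α (p y)) * (C.d (p z) * T) - C.d (p y) * (C.e (α (p z)) * T))
    (fun y => by fun_prop) (fun y => by fun_prop) (fun x y => by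
      rw [C.d_e_assoc, C.d_e_assoc]; abel)
  have h2 : ∀ c, (2⁻¹ : K) • sw (δ c) (fun u w => C.e (α (p u)) * (C.d (p w) * T) -
      C.d (p u) * (C.e (α (p w)) * T)) = 0 := fun c => by
    have h3 := C.sw_d_mul_e hg (p c)
    rw [hp.sw_cobracket c (fun w => by fun_prop) (fun u => by fun_prop)] at h3
    have h4 := half_sw hg c (B := fun u w => C.d (p u) * (C.e (α (p w)) * T))
      (fun w => by fun_prop) (fun u => by fun_prop)
    simp only [C.d_e_assoc _ (α _), sw_sub, smul_sub] at h4 ⊢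
    rw [← neg_sub, h4, neg_eq_zero]
    simp only [← C.d_e_assoc, ← mul_assoc]
    rw [← sw_mul, h3, zero_mul]
  simp only [h2, zero_mul, C.R_zero, hp.twist, C.R_sub] at h
  simp only [lieR, coA, C.mul_R, LinearMap.comp_apply]
  exact sub_eq_zero.mp h

end

end OpCalculus

namespace OpCalculus

variable {E : Type*} [Ring E] [Algebra K E] {ν : g →ₗ[K] g →ₗ[K] g}
  {δ : g →ₗ[K] g ⊗[K] g} {α : g →ₗ[K] g} (C : OpCalculus ν δ α E)
  (hg : IsHomLieBialgebra ν δ α α) {p : g →ₗ[K] g} (hp : IsEndo ν δ α p)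

/-! #### The mixed term -/

variable [CharZero K]
include hg

/-- The second leg of the cobracket can be either of the two bracketed arguments. Skewness makes
both cases equal (`h4`), which cancels the half in `A`. -/
theorem R_A {Q : g → g → E} (hx : ∀ y, Lin K fun x => Q x y) (hy : ∀ x, Lin K fun y => Q x y) :
    (C.R fun c => C.A fun x => Q c x) = (C.A fun x => C.R fun c => Q c (α x)) +
      C.L fun x => C.L fun y => sw (δ x) (fun u w => Q u (ν w (α y))) * C.a := by
  have h1 := C.R_L (Q := fun c x => C.L fun y => (2⁻¹ : K) • Q c (ν x y)) (fun y => by fun_prop)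
    (fun c => by have := hy c; fun_prop)
  have h2 : ∀ x, (C.R fun c => C.L fun y => (2⁻¹ : K) • Q c (ν (α x) y)) =
      (C.L fun y => C.R fun c => (2⁻¹ : K) • Q c (ν (α x) (α y))) +
      C.L fun y => sw (δ y) (fun u w => (2⁻¹ : K) • Q u (ν (α x) w)) * C.a := fun x =>
    C.R_L (fun y => by fun_prop) (fun y => by fun_prop)
  have h3 : ∀ x, sw (δ x) (fun u w => C.L fun y => (2⁻¹ : K) • Q u (ν w y)) * C.a =
      C.L fun y => sw (δ x) (fun u w => (2⁻¹ : K) • Q u (ν w (α y))) * C.a := fun x => by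
    rw [C.sw_L _ (fun y w => by fun_prop) (fun y u => by have := hy u; fun_prop),
      C.L_mul_a (by
        have h : ∀ u w, Lin K fun x => Q u (ν w x) := fun u w => (hy u).comp (Lin.coe (ν w))
        fun_prop)]
  have h4 : (C.L fun x => C.L fun y => sw (δ y) (fun u w => (2⁻¹ : K) • Q u (ν (α x) w)) * C.a) =
      C.L fun x => C.L fun y => sw (δ x) (fun u w => (2⁻¹ : K) • Q u (ν w (α y))) * C.a := by
    rw [C.LL_swap (fun y => by
        have h : ∀ u w, Lin K fun x => Q u (ν (α x) w) := fun u w =>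
          (hy u).comp ((Lin.coe₂ ν w).comp (Lin.coe α))
        fun_prop) (fun x => by fun_prop), ← C.L_neg]
    refine C.L_congr fun x => ?_
    rw [← C.L_neg]
    refine C.L_congr fun y => ?_
    rw [← neg_mul, ← sw_neg]
    refine congrArg (· * C.a) (sw_congr _ fun u w => ?_)
    rw [hg.algebra.skew, ← neg_one_smul K (ν _ _), (hy u).smul]
    module
  simp only [A, h1, h2, h3, C.L_add, h4, C.R_smul, hg.algebra.multiplicative, add_assoc]
  congr 1
  rw [← C.L_add]
  refine C.L_congr fun x => ?_
  rw [← C.L_add]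
  refine C.L_congr fun y => ?_
  rw [sw_smul, smul_mul_assoc]
  module

-- The commutator of `ad` with `k` acts on the legs of the cobracket, by `ad_mul_ad`;
-- antisymmetrized in `x` and `y` it yields the four terms of `k_bracket`.
omit [CharZero K] in
theorem ad_mul_k (x y : g) :
    (C.ad (α (α x)) * C.k y - C.k (α y) * C.ad (α x)) -
      (C.ad (α (α y)) * C.k x - C.k (α x) * C.ad (α y)) = C.k (ν x y) * C.a := by
  have h1 : ∀ x y, C.ad (α (α x)) * C.k y - C.k (α y) * C.ad (α x) =
      sw (δ y) (fun u w => C.e (α (ν (α x) u)) * C.ad (α w) +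
        C.e (α (α u)) * C.ad (ν (α x) w)) * C.a := fun x y => by
    rw [k, k, sw_alpha hg y (fun w => by fun_prop) (fun u => by fun_prop), mul_sw, sw_mul, sw_mul,
      ← sw_sub]
    refine sw_congr _ fun u w => ?_
    have h2 := C.ad_mul_ad hg (α x) w
    rw [C.ad_e_assoc, C.a_mul_ad hg, hg.algebra.multiplicative, add_mul, mul_assoc, mul_assoc,
      mul_assoc, ← h2]
    noncomm_ring
  rw [h1, h1, C.k_bracket hg, add_comm, add_mul, sub_eq_add_neg, ← neg_mul, ← sw_neg]
  congr 2
  refine sw_congr _ fun u w => ?_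
  rw [hg.algebra.skew w, hg.algebra.skew u]
  simp only [map_neg]
  noncomm_ring

include hp


/-- The component of `bd_conn` that adds two arguments and one output. Both halves of the mixed term
are needed for the cancellation. -/
theorem mixed_nuA (T : E) :
    C.kL p T * C.N + C.eB p T * C.N - C.lieL (α ∘ₗ α ∘ₗ p) (C.kL p T) -
      C.lieL (α ∘ₗ α ∘ₗ p) (C.eB p T) + C.M * C.nuA p T - C.lieR (α ∘ₗ α ∘ₗ p) (C.nuA p T) =
    C.nuA (α ∘ₗ p) (C.M * T) - C.nuA (α ∘ₗ p) (C.lieR (α ∘ₗ p) T) +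
      C.kL (α ∘ₗ p) (C.lieL (α ∘ₗ p) T) + C.eB (α ∘ₗ p) (C.lieL (α ∘ₗ p) T) -
      C.kL (α ∘ₗ p) (T * C.N) - C.eB (α ∘ₗ p) (T * C.N) := by
  -- After `LL_swap` both terms contract in the same order, and the skew part of the integrand is
  -- `ad_mul_k`.
  have t1 : C.lieL (α ∘ₗ α ∘ₗ p) (C.kL p T) + C.kL (α ∘ₗ p) (C.lieL (α ∘ₗ p) T) =
      C.A fun x => C.k (p x) * (C.a * T) := by
    simp only [lieL, kL, C.mul_L]
    have h := C.LL_swap (Q := fun x y => C.k (α (p x)) * (C.ad (α (p y)) * T))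
      (fun x => by fun_prop) (fun x => by fun_prop)
    simp only [LinearMap.comp_apply]
    rw [h, ← sub_eq_add_neg, ← C.L_sub]
    simp only [← C.L_sub]
    refine C.LL_eq_A (fun y => by fun_prop) (fun x => by fun_prop) fun x y => ?_
    rw [hp.bracket, ← mul_assoc (C.k (ν _ _)), ← C.ad_mul_k hg]
    noncomm_ring
  have t2 : C.lieL (α ∘ₗ α ∘ₗ p) (C.eB p T) =
      (C.A fun x => C.R fun c => C.e (α (p (ν x c))) * (C.a * T)) +
      C.L fun x => C.L fun y => C.R fun c => C.e (α (p (ν (α y) c))) * (C.ad (α (α (p x))) * T) := by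
    have h : (C.L fun x => C.L fun y => C.R fun c =>
        C.e (p (ν (α (α x)) (ν (α y) c))) * (C.a * T)) =
        C.A fun x => C.R fun c => C.e (p (ν (α x) (α c))) * (C.a * T) :=
      C.LL_eq_A (fun y => by fun_prop) (fun x => by fun_prop) fun x y => by
        rw [← C.R_sub]
        refine C.R_congr fun c => ?_
        rw [← B_mul_N_aux hg (G := fun t => C.e (p t) * (C.a * T)) (by fun_prop)]
    simp only [lieL, eB, B, C.mul_L, C.mul_R, C.ad_e_assoc, C.L_add, C.R_add,
      LinearMap.comp_apply]
    simp only [hg.algebra.multiplicative, hp.twist, hp.bracket] at h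
    simp only [hp.bracket, hp.twist, h]
  have t3 : C.kL p T * C.N = -C.kL (α ∘ₗ p) (T * C.N) + C.A fun x => C.k (p x) * (T * C.a) := by
    rw [kL, C.L_mul_N hg (by fun_prop)]
    simp only [kL, hp.twist, mul_assoc, LinearMap.comp_apply]
  have t4 : C.eB p T * C.N = -C.eB (α ∘ₗ p) (T * C.N) := by
    rw [eB, C.B_mul_N hg (by fun_prop)]
    simp only [eB, hp.twist, mul_assoc, LinearMap.comp_apply]
  have t5 : C.M * C.nuA p T = C.nuA (α ∘ₗ p) (C.M * T) + C.A fun x => C.k (p x) * (C.a * T) := by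
    simp only [nuA, C.mul_A, ← mul_assoc C.M, C.M_mul_ad hg, add_mul, C.A_add, mul_assoc,
      LinearMap.comp_apply]
  have t6 : C.lieR (α ∘ₗ α ∘ₗ p) (C.nuA p T) =
      (C.A fun x => C.R fun c => C.e (α (α (p c))) * (C.ad (α (p x)) * T)) +
      C.L fun x => C.L fun y =>
        sw (δ x) (fun u w => C.e (α (α (p u))) * (C.ad (p (ν w (α y))) * T)) * C.a := by
    have h := C.R_A hg (Q := fun c x => C.e (α (α (p c))) * (C.ad (p x) * T))
      (fun y => by fun_prop) (fun x => by fun_prop)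
    simp only [lieR, nuA, C.mul_A, LinearMap.comp_apply, h, hp.twist]
  have u1 : C.nuA (α ∘ₗ p) (C.lieR (α ∘ₗ p) T) =
      (C.A fun x => C.R fun c => C.e (α (p (ν x c))) * (C.a * T)) +
      C.A fun x => C.R fun c => C.e (α (α (p c))) * (C.ad (α (p x)) * T) := by
    simp only [lieR, nuA, C.mul_R, C.ad_e_assoc, C.R_add, C.A_add, LinearMap.comp_apply,
      hg.algebra.multiplicative, hp.bracket]
  have u3 : C.eB (α ∘ₗ p) (C.lieL (α ∘ₗ p) T) =
      -(C.L fun x => C.L fun y => C.R fun c =>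
        C.e (α (p (ν (α y) c))) * (C.ad (α (α (p x))) * T)) +
      C.L fun x => C.L fun y =>
        sw (δ y) (fun u w => C.e (α (p (ν (α x) u))) * (C.ad (α (p w)) * T)) * C.a := by
    have h : ∀ x, (C.R fun c => C.L fun y => C.e (α (p (ν (α x) c))) * (C.ad (α (p y)) * T)) =
      (C.L fun y => C.R fun c => C.e (α (p (ν (α x) c))) * (C.ad (α (p (α y))) * T)) +
      C.L fun y =>
        sw (δ y) (fun u w => C.e (α (p (ν (α x) u))) * (C.ad (α (p w)) * T)) * C.a := fun x =>
      C.R_L (fun y => by fun_prop) (fun y => by fun_prop)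
    simp only [eB, B, lieL, C.mul_L, LinearMap.comp_apply, h, C.L_add, hp.twist]
    rw [C.LL_swap (fun y => by fun_prop) (fun y => by fun_prop)]
  -- Here the compatibility enters: the four terms of `k_bracket` are the skew part of the two
  -- double contractions left over from `t6` and `u3`.
  have w : (C.A fun x => C.k (p x) * (T * C.a)) =
      (C.L fun x => C.L fun y =>
        sw (δ x) (fun u w => C.e (α (α (p u))) * (C.ad (p (ν w (α y))) * T)) * C.a) +
      C.L fun x => C.L fun y =>
        sw (δ y) (fun u w => C.e (α (p (ν (α x) u))) * (C.ad (α (p w)) * T)) * C.a := by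
    simp only [← C.L_add]
    symm
    refine C.LL_eq_A (fun y => by fun_prop) (fun x => by fun_prop) fun x y => ?_
    rw [hp.bracket, C.k_bracket hg, hp.sw_cobracket x (fun w => by fun_prop) (fun u => by fun_prop),
      hp.sw_cobracket y (fun w => by fun_prop) (fun u => by fun_prop)]
    have e1 : sw (δ x) (fun u w => C.e (α (p (ν (α y) u))) * (C.ad (α (p w)) * T)) =
        -sw (δ x) fun u w => C.e (α (ν (p u) (α (p y)))) * C.ad (α (p w)) * T := by
      rw [← sw_neg]
      refine sw_congr _ fun u w => ?_
      rw [hg.algebra.skew]; simp only [map_neg, neg_mul, mul_assoc, hp.bracket, hp.twist]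
    have e2 : sw (δ y) (fun u w => C.e (α (α (p u))) * (C.ad (p (ν w (α x))) * T)) =
        -sw (δ y) fun u w => C.e (α (α (p u))) * C.ad (ν (α (p x)) (p w)) * T := by
      rw [← sw_neg]
      refine sw_congr _ fun u w => ?_
      rw [hg.algebra.skew]; simp only [map_neg, neg_mul, mul_neg, mul_assoc, hp.bracket, hp.twist]
    rw [e1, e2]
    simp only [hp.bracket, hp.twist, add_mul, sw_add, sw_mul, mul_assoc, neg_mul]
    abel
  rw [t3, t4, t5, t6, t2, u1, u3, w, ← sub_eq_zero]
  rw [← eq_sub_iff_add_eq] at t1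
  rw [t1]
  abel

/-- The dual component, adding one argument and two outputs. -/
theorem mixed_coA (T : E) :
    C.lieL (α ∘ₗ α ∘ₗ p) (C.coA p T) - C.coA p T * C.N - C.M * C.kL p T - C.M * C.eB p T +
      C.lieR (α ∘ₗ α ∘ₗ p) (C.kL p T) + C.lieR (α ∘ₗ α ∘ₗ p) (C.eB p T) =
    C.kL (α ∘ₗ p) (C.M * T) + C.eB (α ∘ₗ p) (C.M * T) - C.kL (α ∘ₗ p) (C.lieR (α ∘ₗ p) T) -
      C.eB (α ∘ₗ p) (C.lieR (α ∘ₗ p) T) + C.coA (α ∘ₗ p) (C.lieL (α ∘ₗ p) T) -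
      C.coA (α ∘ₗ p) (T * C.N) := by
  have v1 : C.lieL (α ∘ₗ α ∘ₗ p) (C.coA p T) =
      (C.L fun x => C.R fun c =>
        sw (δ c) (fun u w => C.e (α (p u)) * C.e (ν (α (α (p x))) (p w))) * (C.a * T)) +
      C.L fun x => C.R fun c => C.d (α (p c)) * (C.ad (α (α (p x))) * T) := by
    have h : ∀ x c, C.ad (α (α (p x))) * (C.d (p c) * T) =
        sw (δ c) (fun u w => C.e (α (p u)) * C.e (ν (α (α (p x))) (p w))) * (C.a * T) +
        C.d (α (p c)) * (C.ad (α (α (p x))) * T) := fun x c => by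
      rw [← mul_assoc, C.ad_mul_d hg, add_mul, mul_assoc, mul_assoc,
        hp.sw_cobracket c (fun w => by fun_prop) (fun u => by fun_prop)]
    simp only [lieL, coA, C.mul_R, LinearMap.comp_apply, h, C.R_add, C.L_add]
  have v2 : C.coA p T * C.N = C.coA (α ∘ₗ p) (T * C.N) +
      C.L fun x => C.R fun c => C.d (p (ν (α x) c)) * (T * C.a) := by
    rw [coA, C.R_mul_N hg (by fun_prop)]
    simp only [coA, B, hp.twist, mul_assoc, LinearMap.comp_apply]
  have v3 : C.M * C.kL p T = -C.kL (α ∘ₗ p) (C.M * T) := by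
    simp only [kL, C.mul_L, ← mul_assoc C.M, C.M_mul_k hg, neg_mul, C.L_neg, mul_assoc,
      LinearMap.comp_apply]
  have v4 : C.M * C.eB p T = -C.eB (α ∘ₗ p) (C.M * T) +
      C.L fun x => C.R fun c => C.d (p (ν (α x) c)) * (C.a * T) := by
    simp only [eB, B, C.mul_L, C.mul_R, C.M_e_assoc, C.L_add, C.L_neg, C.R_add, C.R_neg,
      LinearMap.comp_apply]
  have v5 : C.lieR (α ∘ₗ α ∘ₗ p) (C.kL p T) =
      (C.L fun x => C.R fun c => C.e (α (α (p c))) * (C.k (α (p x)) * T)) +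
      C.L fun v => sw (δ v) (fun u w => C.d (α (p u)) * C.ad (α (p w))) * (T * C.a) := by
    have h := C.R_L (Q := fun c x => C.e (α (α (p c))) * (C.k (p x) * T)) (fun y => by fun_prop)
      (fun x => by fun_prop)
    have h2 : ∀ v, sw (δ v) (fun u w => C.e (α (α (p u))) * C.k (p w)) =
        sw (δ v) fun u w => C.d (α (p u)) * C.ad (α (p w)) := fun v => by
      have h3 := C.sw_e_mul_k hg (p v)
      rwa [hp.sw_cobracket v (fun w => by fun_prop) (fun u => by fun_prop),
        hp.sw_cobracket v (fun w => by fun_prop) (fun u => by fun_prop)] at h3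
    simp only [lieR, kL, C.mul_L, LinearMap.comp_apply, h, hp.twist, ← h2, sw_mul, mul_assoc]
  have v6 : C.lieR (α ∘ₗ α ∘ₗ p) (C.eB p T) =
      (C.L fun x => C.R fun c => C.R fun c' =>
        C.e (α (α (p c))) * (C.e (p (ν (α (α x)) c')) * T)) +
      C.L fun x => C.R fun c =>
        sw (δ x) (fun u w => C.e (α (α (p u))) * C.e (p (ν (α w) (α c)))) * (T * C.a) := by
    have h := C.R_L (Q := fun c x => C.R fun c' => C.e (α (α (p c))) * (C.e (p (ν (α x) c')) * T))
      (fun y => by fun_prop) (fun x => by fun_prop)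
    have h2 : ∀ x, sw (δ x) (fun u w => C.R fun c' =>
        C.e (α (α (p u))) * (C.e (p (ν (α w) c')) * T)) * C.a = C.R fun c =>
        sw (δ x) (fun u w => C.e (α (α (p u))) * C.e (p (ν (α w) (α c)))) * (T * C.a) := fun x => by
      rw [C.sw_R _ (fun x w => by fun_prop) (fun x u => by fun_prop), C.R_mul_a hg (by fun_prop)]
      simp only [sw_mul, mul_assoc]
    simp only [lieR, eB, B, C.mul_L, C.mul_R, LinearMap.comp_apply, h, h2]
  have w1 : C.kL (α ∘ₗ p) (C.lieR (α ∘ₗ p) T) =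
      (C.L fun x => C.R fun c =>
        sw (δ x) (fun u w => C.e (α (α (p u))) * C.e (ν (α (p w)) (α (p c)))) * (C.a * T)) -
      C.L fun x => C.R fun c => C.e (α (α (p c))) * (C.k (α (p x)) * T) := by
    have h : ∀ x c, C.k (α (p x)) * (C.e (α (p c)) * T) =
        sw (δ x) (fun u w => C.e (α (α (p u))) * C.e (ν (α (p w)) (α (p c)))) * (C.a * T) -
        C.e (α (α (p c))) * (C.k (α (p x)) * T) := fun x c => by
      rw [← mul_assoc, C.k_mul_e, sub_mul, mul_assoc, mul_assoc,
        sw_alpha hg (p x) (fun w => by fun_prop) (fun u => by fun_prop),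
        hp.sw_cobracket x (fun w => by fun_prop) (fun u => by fun_prop)]
    simp only [lieR, kL, C.mul_R, LinearMap.comp_apply, h, C.R_sub, C.L_sub]
  have w2 : C.eB (α ∘ₗ p) (C.lieR (α ∘ₗ p) T) =
      C.L fun x => C.R fun c => C.R fun c' =>
        C.e (α (p (ν (α x) c))) * (C.e (α (p c')) * T) := by
    simp only [lieR, eB, B, C.mul_R, LinearMap.comp_apply]
  have w3 : C.coA (α ∘ₗ p) (C.lieL (α ∘ₗ p) T) =
      (C.L fun x => C.R fun c => C.d (α (p c)) * (C.ad (α (α (p x))) * T)) +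
      C.L fun v => sw (δ v) (fun u w => C.d (α (p u)) * C.ad (α (p w))) * (T * C.a) := by
    have h := C.R_L (Q := fun c x => C.d (α (p c)) * (C.ad (α (p x)) * T)) (fun y => by fun_prop)
      (fun x => by fun_prop)
    simp only [coA, lieL, C.mul_L, LinearMap.comp_apply, h, hp.twist, sw_mul, mul_assoc]
  -- The compatibility in `Λ² g`. It is used twice, multiplied by `a * T` for the correction in `v4`
  -- and by `T * a` for that in `v2`.
  have hd : ∀ x c, C.d (p (ν (α x) c)) =
      sw (δ c) (fun u w => C.e (α (p u)) * C.e (ν (α (α (p x))) (p w))) +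
      sw (δ x) fun u w => C.e (α (α (p u))) * C.e (ν (α (p w)) (α (p c))) := fun x c => by
    rw [hp.bracket, hp.twist, C.d_bracket hg,
      hp.sw_cobracket c (fun w => by fun_prop) (fun u => by fun_prop),
      sw_alpha hg (p x) (fun w => by fun_prop) (fun u => by fun_prop),
      hp.sw_cobracket x (fun w => by fun_prop) (fun u => by fun_prop)]
  -- Neither of the two double coactions has a skew integrand, but their sum does, so that `R_R`
  -- applies to it.
  have r : ∀ x, (C.R fun c => C.R fun c' =>
        C.e (α (α (p c))) * (C.e (p (ν (α (α x)) c')) * T)) +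
      (C.R fun c => C.R fun c' => C.e (α (p (ν (α x) c))) * (C.e (α (p c')) * T)) =
      C.R fun c =>
        sw (δ c) (fun u w => C.e (α (p u)) * C.e (ν (α (α (p x))) (p w))) * (T * C.a) := fun x => by
    have h := C.R_R hg (q := fun y z => C.e (α (p y)) * (C.e (p (ν (α (α x)) z)) * T) +
        C.e (p (ν (α (α x)) y)) * (C.e (α (p z)) * T)) (fun y => by fun_prop)
      (fun y => by fun_prop) (fun y z => by
        simp only [← mul_assoc, ← add_mul, ← neg_mul]
        rw [C.e_mul_e (α (p y)), C.e_mul_e (p _) (α (p z))]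
        noncomm_ring)
    have h2 : ∀ c, (2⁻¹ : K) • sw (δ c) (fun u w =>
        C.e (α (p u)) * (C.e (p (ν (α (α x)) w)) * T) +
        C.e (p (ν (α (α x)) u)) * (C.e (α (p w)) * T)) =
        sw (δ c) (fun u w => C.e (α (p u)) * C.e (ν (α (α (p x))) (p w))) * T := fun c => by
      rw [← half_sw hg c (B := fun u w => C.e (α (p u)) * C.e (ν (α (α (p x))) (p w)))
        (fun w => by fun_prop) (fun u => by fun_prop), smul_mul_assoc, sw_mul]
      refine congrArg ((2⁻¹ : K) • ·) (sw_congr _ fun u w => ?_)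
      simp only [hp.bracket, hp.twist]
      rw [C.e_mul_e (α (p w))]
      noncomm_ring
    have h3 : ∀ c, p (ν (α (α x)) (α c)) = α (p (ν (α x) c)) := fun c => by
      rw [hg.algebra.multiplicative, hp.twist]
    simp only [h2, h3, C.R_add, hp.twist] at h
    simpa only [mul_assoc] using h
  have r' := C.L_congr r
  have hd' := C.L_congr fun x => C.R_congr fun c => congrArg (· * (C.a * T)) (hd x c)
  have hd'' := C.L_congr fun x => C.R_congr fun c => congrArg (· * (T * C.a)) (hd x c)
  simp only [add_mul, C.R_add, C.L_add] at r' hd' hd''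
  simp only [hp.bracket, hp.twist] at v6
  rw [v1, v2, v3, v4, v5, v6, w1, w2, w3, hd', hd'', ← r']
  simp only [hp.bracket, hp.twist]
  abel

end OpCalculus

/-! ### The calculus of operators on `Λ g` -/

/-- The operators on `Λ g` defined by a Hom-Lie bialgebra. -/
def opCalculus [CharZero K] {ν : g →ₗ[K] g →ₗ[K] g} {δ : g →ₗ[K] g ⊗[K] g} {α : g →ₗ[K] g}
    (hg : IsHomLieBialgebra ν δ α α) : OpCalculus ν δ α (Op K g) where
  e := wedge
  ad := ad ν α
  a := extMap α
  N := bdry ν α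
  M := cobdry δ α
  L := Lop
  R := Rop δ α
  vac :=
    { carrier := {T | T 1 = 0}
      add_mem' := fun {S T} hS hT => by
        change S 1 + T 1 = 0
        rw [show S 1 = 0 from hS, show T 1 = 0 from hT, add_zero]
      zero_mem' := rfl
      smul_mem' := fun c T hT => by
        change c • T 1 = 0
        rw [show T 1 = 0 from hT, smul_zero] }
  mul_vac T S hS := by
    change T (S 1) = 0
    rw [show S 1 = 0 from hS, map_zero]
  vac_mul_a {S} hS := by
    change S (extMap α 1) = 0
    rw [extMap_one]; exact hS
  ad_vac := ad_one ν α hg.algebra.skew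
  N_vac := bdry_one ν α
  M_vac := cobdry_one δ α
  L_vac := Lop_one
  R_vac := Rop_one δ α
  eq_zero_of_mem S h1 h2 T hT := op_eq_zero (fun T : S => T.1) (fun T => h1 T.2)
    (fun T v => by
      obtain ⟨T', hT', B, h⟩ := h2 T.1 T.2 v
      exact ⟨⟨T', hT'⟩, B, h⟩) ⟨T, hT⟩
  e_mul_self := wedge_mul_self
  a_e := extMap_mul_wedge α
  ad_e := ad_mul_wedge ν α hg.algebra.skew
  N_e := bdry_mul_wedge ν α hg.algebra.skew
  M_e v := by
    rw [← cowedge_eq]; exact cobdry_mul_wedge δ α v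
  L_e hF v := Lop_mul_wedge hF v
  R_e hF v := Rop_mul_wedge δ α hg.coalgebra.skew hF v
  mul_L := mul_Lop
  mul_R := mul_Rop δ α
  L_add := Lop_add
  R_add := Rop_add δ α

namespace OpCalculus

/-- The contraction with a coaction is a contraction with the cobracket of an argument. -/
theorem R_eq_L {E : Type*} [Ring E] [Algebra K E] {ν : g →ₗ[K] g →ₗ[K] g} {δ : g →ₗ[K] g ⊗[K] g}
    {α : g →ₗ[K] g} (C : OpCalculus ν δ α E) {F : g → E} (hF : Lin K F) :
    C.R F = C.L fun v => sw (δ v) (fun u w => F u * C.e w) * C.a := by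
  rw [← sub_eq_zero]
  refine C.eq_zero (fun F : {F : g → E // Lin K F} => C.R F.1 -
      C.L fun v => sw (δ v) (fun u w => F.1 u * C.e w) * C.a)
    (fun F => sub_mem (C.R_vac _) (C.L_vac _))
    (fun F v => ⟨⟨fun x => F.1 x * C.e (α v), by have := F.2; fun_prop⟩, 1, ?_⟩) ⟨F, hF⟩
  obtain ⟨F, hF⟩ := F
  have h : ∀ x, sw (δ x) (fun u w => F u * C.e w) * C.a * C.e v =
      -(sw (δ x) (fun u w => F u * C.e (α v) * C.e w) * C.a) := fun x => by
    rw [mul_assoc, C.a_e, ← mul_assoc, sw_mul, ← neg_mul, ← sw_neg]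
    refine congrArg (· * C.a) (sw_congr _ fun u w => ?_)
    rw [mul_assoc, C.e_mul_e, mul_neg, ← mul_assoc]
  simp only [sub_mul, one_mul]
  rw [C.R_e hF, C.L_e (by fun_prop)]
  simp only [h, C.L_neg]
  abel

end OpCalculus

/-! ### Compatibility of twist, sign and projections, and recognition of contractions -/

section

variable (ν : g →ₗ[K] g →ₗ[K] g) (δ : g →ₗ[K] g ⊗[K] g) (α : g →ₗ[K] g)

theorem extMap_pow (n : ℕ) : extMap α ^ n = extMap (α ^ n) := by
  induction n with
  | zero => exact (congrArg AlgHom.toLinearMap (ExteriorAlgebra.map_id (R := K) (M := g))).symm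
  | succ n ih =>
    rw [pow_succ, ih, pow_succ]
    exact congrArg AlgHom.toLinearMap (ExteriorAlgebra.map_comp_map α (α ^ n))

theorem extMap_wedge (v : g) (x : ExteriorAlgebra K g) :
    extMap α (wedge v x) = wedge (α v) (extMap α x) :=
  LinearMap.congr_fun (extMap_mul_wedge α v) x

theorem counit_extMap (x : ExteriorAlgebra K g) : counit (extMap α x) = counit x := by
  induction x using ext_induction with
  | h1 => rw [extMap_one]
  | smul c x hx => rw [map_smul, map_smul, hx, map_smul]
  | add x y hx hy => rw [map_add, map_add, hx, hy, map_add]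
  | mul v x hx => rw [extMap_wedge, counit_wedge, counit_wedge]

theorem ιInv_extMap (x : ExteriorAlgebra K g) :
    ExteriorAlgebra.ιInv (extMap α x) = α (ExteriorAlgebra.ιInv x) := by
  induction x using ext_induction with
  | h1 => rw [extMap_one, ιInv_one, map_zero]
  | smul c x hx => rw [map_smul, map_smul, hx, map_smul, map_smul]
  | add x y hx hy => rw [map_add, map_add, hx, hy, map_add, map_add]
  | mul v x hx => rw [extMap_wedge, ιInv_wedge, ιInv_wedge, counit_extMap, map_smul]

theorem ιInv_sgn_pow (d : ℕ) (x : ExteriorAlgebra K g) :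
    ExteriorAlgebra.ιInv ((sgn ^ d) x) = (-1 : K) ^ d • ExteriorAlgebra.ιInv x := by
  induction d generalizing x with
  | zero => rw [pow_zero, pow_zero, one_smul]; rfl
  | succ d ih =>
    rw [pow_succ', Module.End.mul_apply, ιInv_sgn, ih, pow_succ, mul_neg_one, neg_smul]

theorem counit_sgn_pow (d : ℕ) (x : ExteriorAlgebra K g) : counit ((sgn ^ d) x) = counit x := by
  induction d generalizing x with
  | zero => rfl
  | succ d ih => rw [pow_succ', Module.End.mul_apply, counit_sgn, ih]

theorem extMap_ι (v : g) : extMap α (ExteriorAlgebra.ι K v) = ExteriorAlgebra.ι K (α v) :=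
  ExteriorAlgebra.map_apply_ι α v

theorem hatBracket_sgn [CharZero K] (hν : ∀ x y, ν x y = -ν y x) (x : ExteriorAlgebra K g) :
    hatBracket ν (sgn x) = hatBracket ν x := by
  induction x using ext_induction with
  | h1 => rw [sgn_one]
  | smul c x hx => rw [map_smul, map_smul, hx, map_smul]
  | add x y hx hy => rw [map_add, map_add, hx, hy, map_add]
  | mul v x hx =>
    rw [sgn_wedge, map_neg, hatBracket_wedge ν hν, hatBracket_wedge ν hν, ιInv_sgn, map_neg,
      map_neg, neg_neg]

theorem hatBracket_sgn_pow [CharZero K] (hν : ∀ x y, ν x y = -ν y x) (d : ℕ)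
    (x : ExteriorAlgebra K g) : hatBracket ν ((sgn ^ d) x) = hatBracket ν x := by
  induction d generalizing x with
  | zero => rfl
  | succ d ih => rw [pow_succ', Module.End.mul_apply, hatBracket_sgn ν hν, ih]

theorem ι_ιInv_hatBracket (x : ExteriorAlgebra K g) :
    ExteriorAlgebra.ι K (ExteriorAlgebra.ιInv (hatBracket ν x)) = hatBracket ν x := by
  simp only [hatBracket, LinearMap.smul_apply, LinearMap.comp_apply, map_smul, ιInv_ι]

theorem hatCobracket_ι_ιInv (x : ExteriorAlgebra K g) :
    hatCobracket δ (ExteriorAlgebra.ι K (ExteriorAlgebra.ιInv x)) = hatCobracket δ x := by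
  simp only [hatCobracket, LinearMap.smul_apply, LinearMap.comp_apply, ιInv_ι]

theorem hatCobracket_mul_ι (x : ExteriorAlgebra K g) (w : g) :
    hatCobracket δ (x * ExteriorAlgebra.ι K w) = counit x • hatCobracket δ (ExteriorAlgebra.ι K w) := by
  rw [mul_ι, hatCobracket_wedge, counit_sgn]

/-- The bridge from the formulas with coproducts to the calculus: only the degree-one part of the
first tensor factor enters. -/
theorem Lop_eq {F : g → Op K g} (hF : Lin K F)
    {Φ : ExteriorAlgebra K g ⊗[K] ExteriorAlgebra K g →ₗ[K] ExteriorAlgebra K g}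
    (h : ∀ b c, Φ (b ⊗ₜ c) = F (ExteriorAlgebra.ιInv b) c) : Φ ∘ₗ comul = Lop F := by
  rw [Lop, split, ← LinearMap.comp_assoc]
  refine congrArg (· ∘ₗ comul) (TensorProduct.ext' fun b c => ?_)
  rw [h, LinearMap.comp_apply, TensorProduct.map_tmul, TensorProduct.lift.tmul, lin_apply hF]
  rfl

/-- The contraction with the last argument. -/
theorem Lop_eq_right {F : g → Op K g} (hF : Lin K F)
    {Φ : ExteriorAlgebra K g ⊗[K] ExteriorAlgebra K g →ₗ[K] ExteriorAlgebra K g}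
    (h : ∀ b c, Φ (b ⊗ₜ c) = F (ExteriorAlgebra.ιInv c) (sgn b)) : Φ ∘ₗ comul = Lop F := by
  -- `Ψ F` is defined for every `F`, so the induction can run over all linear functions; it has the
  -- same recursion as `Lop F`.
  let Ψ (F : g → Op K g) : ExteriorAlgebra K g ⊗[K] ExteriorAlgebra K g →ₗ[K]
      ExteriorAlgebra K g := TensorProduct.lift ((lin F ∘ₗ ExteriorAlgebra.ιInv).flip ∘ₗ sgn)
  have h0 : ∀ {F : g → Op K g} (_ : Lin K F) (b c), Ψ F (b ⊗ₜ c) = F (ExteriorAlgebra.ιInv c) (sgn b) :=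
    fun hF b c => by simp only [Ψ, TensorProduct.lift.tmul, LinearMap.comp_apply,
      LinearMap.flip_apply, lin_apply hF]
  have h1 : Φ = Ψ F := TensorProduct.ext' fun b c => by rw [h, h0 hF]
  rw [h1, ← sub_eq_zero]
  refine op_eq_zero (fun F : {F : g → Op K g // Lin K F} => Ψ F.1 ∘ₗ comul - Lop F.1) (fun F => ?_)
    (fun F v => ⟨⟨fun x => F.1 x * wedge v, by have := F.2; fun_prop⟩, -1, ?_⟩) ⟨F, hF⟩
  · rw [LinearMap.sub_apply, Lop_one, LinearMap.comp_apply, comul_one, h0 F.2, ιInv_one]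
    rw [← zero_smul K (0 : g), F.2.smul, zero_smul]
    simp
  · obtain ⟨F, hF⟩ := F
    have h2 : (Ψ F ∘ₗ comul : Op K g) * wedge v =
        F v - Ψ (fun x => F x * wedge v) ∘ₗ comul := by
      refine LinearMap.ext fun x => ?_
      have hw : Lin K fun x => F x * wedge v := by fun_prop
      have e1 : ∀ t, Ψ F (TensorProduct.map (wedge v) LinearMap.id t) =
          -Ψ (fun x => F x * wedge v) t := fun t => by
        induction t with
        | zero => simp
        | add s t hs ht => rw [map_add, map_add, hs, ht, map_add, neg_add]
        | tmul b c =>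
          rw [TensorProduct.map_tmul, h0 hF, h0 hw, sgn_wedge, map_neg]
          rfl
      have e2 : ∀ t, Ψ F (TensorProduct.map sgn (wedge v) t) =
          F v (TensorProduct.rid K _ (TensorProduct.map LinearMap.id counit t)) := fun t => by
        induction t with
        | zero => simp
        | add s t hs ht => simp only [map_add, hs, ht]
        | tmul b c =>
          rw [TensorProduct.map_tmul, h0 hF, ιInv_wedge, hF.smul, sgn_sgn, TensorProduct.map_tmul,
            TensorProduct.rid_tmul, map_smul]
          rfl
      change Ψ F (comul (wedge v x)) = F v x - Ψ (fun x => F x * wedge v) (comul x)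
      rw [comul_wedge, map_add, e1, e2, comul_counit, TensorProduct.rid_tmul, one_smul]
      abel
    have h3 := Lop_mul_wedge hF v
    have h4 := congrArg₂ (fun S T : Op K g => S - T) h2 h3
    refine Eq.trans (sub_mul (Ψ F ∘ₗ comul : Op K g) (Lop F) (wedge v)) (h4.trans ?_)
    refine LinearMap.ext fun x => ?_
    simp only [LinearMap.sub_apply, Module.End.mul_apply, LinearMap.neg_apply, Module.End.one_apply]
    abel

end

/-! ### The components of the differential as contractions -/

theorem IsEndo.pow {ν : g →ₗ[K] g →ₗ[K] g} {δ : g →ₗ[K] g ⊗[K] g} {α : g →ₗ[K] g}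
    (hg : IsHomLieBialgebra ν δ α α) (n : ℕ) : IsEndo ν δ α (α ^ n) := by
  induction n with
  | zero => exact IsEndo.id
  | succ n ih =>
    rw [pow_succ']
    exact ih.comp hg

section

variable [CharZero K] {ν : g →ₗ[K] g →ₗ[K] g} {δ : g →ₗ[K] g ⊗[K] g} {α : g →ₗ[K] g}
  (hg : IsHomLieBialgebra ν δ α α)

/-- The outer bracket uses the first tensor factor only through its degree-one part, where the
Koszul sign is the scalar `(-1) ^ d`. -/
theorem circ_hatBracket (n d : ℕ) (φ : Op K g) :
    circ α 1 (hatBracket ν) n d φ = (-1 : K) ^ d • (opCalculus hg).lieL (α ^ n) φ := by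
  rw [OpCalculus.lieL, ← OpCalculus.L_smul]
  change (act ν α ∘ₗ TensorProduct.map ((extMap α ^ n) ∘ₗ sgn ^ d) φ) ∘ₗ comul =
    Lop fun x => (-1 : K) ^ d • (ad ν α ((α ^ n) x) * φ)
  refine Lop_eq (by fun_prop) fun b c => ?_
  rw [LinearMap.comp_apply, TensorProduct.map_tmul, act_eq ν α hg.algebra.skew,
    LinearMap.comp_apply, extMap_pow, ιInv_extMap, ιInv_sgn_pow, map_smul, map_smul]
  rfl

omit [CharZero K] in
theorem comul_ι (v : g) : comul (ExteriorAlgebra.ι K v) =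
    ExteriorAlgebra.ι K v ⊗ₜ[K] (1 : ExteriorAlgebra K g) + 1 ⊗ₜ ExteriorAlgebra.ι K v := by
  have h := comul_wedge (K := K) v 1
  simp only [comul_one, TensorProduct.map_tmul, sgn_one, wedge_apply, mul_one,
    LinearMap.id_apply] at h
  exact h

omit [CharZero K] in
theorem contract_ι (b : ExteriorAlgebra K g) (v : g) :
    contract (b ⊗ₜ ExteriorAlgebra.ι K v) = (b * ExteriorAlgebra.ι K v) ⊗ₜ[K] 1 := by
  simp only [contract, LinearMap.comp_apply, TensorProduct.map_tmul, LinearMap.id_apply, comul_ι,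
    map_add, pr, ιInv_ι, ιInv_one, map_zero, TensorProduct.zero_tmul, add_zero,
    LinearEquiv.coe_coe, TensorProduct.assoc_symm_tmul, mul, LinearMap.mul'_apply]

-- A bracket lies in `g`, so the contraction consumes it entirely and the power of `α` acts on `1`
-- only.
omit [CharZero K] in
theorem circ_hatBracket_right (n : ℕ) (φ : Op K g) :
    circ α n φ 1 1 (hatBracket ν) = φ * bdry ν α := by
  have h : (mul ∘ₗ TensorProduct.map φ (extMap α ^ n) ∘ₗ contract ∘ₗ
      koszul 1 (extMap α) (hatBracket ν) : _ →ₗ[K] ExteriorAlgebra K g) =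
      φ ∘ₗ mul ∘ₗ koszul 1 (extMap α) (hatBracket ν) := by
    refine TensorProduct.ext' fun b c => ?_
    simp only [LinearMap.comp_apply, koszul, TensorProduct.map_tmul]
    rw [← ι_ιInv_hatBracket, contract_ι, TensorProduct.map_tmul, extMap_pow, extMap_one]
    simp only [mul, LinearMap.mul'_apply, mul_one]
  exact congrArg (· ∘ₗ comul) h

omit [CharZero K] in
theorem map_hatCobracket_contract (b c : ExteriorAlgebra K g) :
    mul (TensorProduct.map (hatCobracket δ) (extMap α) (contract (b ⊗ₜ c))) =
      counit b • cobdry δ α c := by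
  simp only [contract, cobdry, LinearMap.comp_apply, TensorProduct.map_tmul, LinearMap.id_apply]
  induction comul c with
  | zero => simp
  | add s t hs ht => simp only [map_add, TensorProduct.tmul_add, hs, ht, smul_add]
  | tmul x y =>
    simp only [TensorProduct.map_tmul, LinearEquiv.coe_coe, TensorProduct.assoc_symm_tmul, mul,
      LinearMap.mul'_apply, pr, LinearMap.comp_apply, hatCobracket_mul_ι, LinearMap.id_apply,
      hatCobracket_ι_ιInv, smul_mul_assoc]

-- The outer cobracket vanishes outside degree one, so in `b ∧ pr c₁` the factor `b` must be a
-- scalar; the counit axiom then leaves `cobdry` applied to the values of `φ`.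
omit [CharZero K] in
theorem circ_hatCobracket (n d : ℕ) (φ : Op K g) :
    circ α 1 (hatCobracket δ) n d φ = cobdry δ α * φ := by
  refine LinearMap.ext fun x => ?_
  have h : ∀ t, mul (TensorProduct.map (hatCobracket δ) (extMap α)
      (contract (koszul d (extMap α ^ n) φ t))) = (cobdry δ α * φ)
      (TensorProduct.lid K _ (TensorProduct.map counit LinearMap.id t)) := fun t => by
    induction t with
    | zero => simp
    | add s t hs ht => simp only [map_add, hs, ht]
    | tmul b c =>
      rw [koszul, TensorProduct.map_tmul, map_hatCobracket_contract, LinearMap.comp_apply,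
        extMap_pow, counit_extMap, counit_sgn_pow, TensorProduct.map_tmul, TensorProduct.lid_tmul,
        map_smul]
      rfl
  refine Eq.trans (h (comul x)) ?_
  rw [counit_comul, TensorProduct.lid_tmul, one_smul]

omit [CharZero K] in
theorem map_pr_comul (x : ExteriorAlgebra K g) :
    TensorProduct.map pr LinearMap.id (comul x) =
      TensorProduct.map (ExteriorAlgebra.ι K) LinearMap.id (split x) := by
  rw [split, LinearMap.comp_apply]
  generalize comul x = t
  induction t with
  | zero => simp
  | add s t hs ht => simp only [map_add, hs, ht]
  | tmul b c => rfl

omit [CharZero K] in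
theorem sw_tensor {W V U : Type*} [AddCommGroup W] [Module K W] [AddCommGroup V] [Module K V]
    [AddCommGroup U] [Module K U] (f : g →ₗ[K] W) (h : g →ₗ[K] V) (T : W ⊗[K] V →ₗ[K] U)
    (t : g ⊗[K] g) : T (TensorProduct.map f h t) = sw t fun u w => T (f u ⊗ₜ h w) := by
  induction t with
  | zero => simp [sw]
  | add s t hs ht => rw [map_add, map_add, hs, ht, (Lin.sw_left Lin.id _).add]
  | tmul u w =>
    rw [sw_tmul]
    · rfl
    · exact fun w => ⟨fun x y => by simp [TensorProduct.add_tmul], fun c x => by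
        simp [← TensorProduct.smul_tmul']⟩
    · exact fun w => ⟨fun x y => by simp [TensorProduct.tmul_add], fun c x => by simp⟩

include hg in
theorem map_pr_hatCobracket (v : g) : TensorProduct.map (pr : Op K g) LinearMap.id
    (comul (hatCobracket δ (ExteriorAlgebra.ι K v))) =
    TensorProduct.map (ExteriorAlgebra.ι K) (ExteriorAlgebra.ι K) (δ v) := by
  rw [map_pr_comul, split_hatCobracket δ hg.coalgebra.skew, ← LinearMap.comp_apply,
    ← TensorProduct.map_comp]
  rfl

include hg in
theorem contract_hatCobracket {U : Type*} [AddCommGroup U] [Module K U]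
    (T : ExteriorAlgebra K g ⊗[K] ExteriorAlgebra K g →ₗ[K] U)
    (b : ExteriorAlgebra K g) (v : g) :
    T (contract (b ⊗ₜ hatCobracket δ (ExteriorAlgebra.ι K v))) =
      sw (δ v) fun u w => T ((b * ExteriorAlgebra.ι K u) ⊗ₜ ExteriorAlgebra.ι K w) := by
  have h : ∀ t : g ⊗[K] g, (TensorProduct.map mul LinearMap.id ∘ₗ
      (TensorProduct.assoc K _ _ _).symm.toLinearMap) (b ⊗ₜ TensorProduct.map (ExteriorAlgebra.ι K)
      (ExteriorAlgebra.ι K) t) = TensorProduct.map (LinearMap.mulLeft K b ∘ₗ ExteriorAlgebra.ι K)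
      (ExteriorAlgebra.ι K) t := fun t => by
    induction t with
    | zero => simp
    | add s t hs ht => simp only [map_add, TensorProduct.tmul_add, hs, ht]
    | tmul u w => simp [mul]
  have h3 : contract (b ⊗ₜ hatCobracket δ (ExteriorAlgebra.ι K v)) =
      TensorProduct.map (LinearMap.mulLeft K b ∘ₗ ExteriorAlgebra.ι K) (ExteriorAlgebra.ι K) (δ v) := by
    rw [← h, ← map_pr_hatCobracket hg]
    rfl
  rw [h3, sw_tensor]
  rfl

/-- One leg of the cobracket enters `φ`, the other is multiplied from the right. Moving it to the
left of the value of `φ` applies `sgn`, which is why the parity of `φ` is needed. -/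
theorem circ_hatCobracket_right (n d : ℕ) (φ : Op K g) (hφ : sgn * φ = (-1 : K) ^ d • (φ * sgn)) :
    circ α n φ 1 1 (hatCobracket δ) = (-1 : K) ^ d • (opCalculus hg).lieR (α ^ n) φ := by
  rw [OpCalculus.lieR, OpCalculus.R_eq_L _ (by fun_prop), ← OpCalculus.L_smul]
  change (mul ∘ₗ TensorProduct.map φ (extMap α ^ n) ∘ₗ contract ∘ₗ
      koszul 1 (extMap α) (hatCobracket δ)) ∘ₗ comul = Lop fun v => (-1 : K) ^ d •
        (sw (δ v) (fun u w => wedge ((α ^ n) u) * φ * wedge w) * extMap α)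
  refine Lop_eq_right (by fun_prop) fun b c => ?_
  have h1 := contract_hatCobracket hg (mul ∘ₗ TensorProduct.map φ (extMap α ^ n))
    (extMap α (sgn b)) (ExteriorAlgebra.ιInv c)
  rw [hatCobracket_ι_ιInv] at h1
  have h2 : (mul ∘ₗ TensorProduct.map φ (extMap α ^ n) ∘ₗ contract ∘ₗ
      koszul 1 (extMap α) (hatCobracket δ)) (b ⊗ₜ c) =
      sw (δ (ExteriorAlgebra.ιInv c)) fun u w => (mul ∘ₗ TensorProduct.map φ (extMap α ^ n))
        ((extMap α (sgn b) * ExteriorAlgebra.ι K u) ⊗ₜ ExteriorAlgebra.ι K w) := h1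
  rw [h2]
  generalize ExteriorAlgebra.ιInv c = v
  have h3 : ∀ u w, (mul ∘ₗ TensorProduct.map φ (extMap α ^ n))
      ((extMap α (sgn b) * ExteriorAlgebra.ι K u) ⊗ₜ ExteriorAlgebra.ι K w) =
      -((-1 : K) ^ d • (wedge ((α ^ n) w) * φ * wedge u * extMap α : Op K g) (sgn b)) := fun u w => by
    have h4 : ∀ y, sgn (φ y) = (-1 : K) ^ d • φ (sgn y) := fun y => LinearMap.congr_fun hφ y
    rw [LinearMap.comp_apply, TensorProduct.map_tmul, extMap_pow, extMap_ι, mul,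
      LinearMap.mul'_apply, mul_ι, mul_ι, h4, sgn_wedge, sgn_sgn, map_neg, smul_neg, map_neg,
      map_smul]
    rfl
  simp only [h3]
  have h5 := sw_skew hg v (B := fun u w => (wedge ((α ^ n) u) * φ * wedge w * extMap α : Op K g))
    (fun w => by fun_prop) (fun u => by fun_prop)
  have h6 : sw (δ v) (fun u w => (wedge ((α ^ n) u) * φ * wedge w * extMap α : Op K g) (sgn b)) =
      -sw (δ v) fun u w => (wedge ((α ^ n) w) * φ * wedge u * extMap α : Op K g) (sgn b) := by
    rw [← sw_apply, ← sw_apply, h5]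
    rfl
  rw [sw_neg, sw_smul, LinearMap.smul_apply, ← smul_neg, sw_mul, sw_apply, h6]

theorem dLie_eq (n d : ℕ) (φ : Op K g) : dLie ν α n d φ =
    (-1 : K) ^ d • ((opCalculus hg).lieL (α ^ n) φ - φ * (opCalculus hg).N) := by
  rw [dLie, crochet, circ_hatBracket hg, circ_hatBracket_right, one_mul, smul_sub]
  rfl

theorem dCoLie_eq (n d : ℕ) (φ : Op K g) (hφ : sgn * φ = (-1 : K) ^ d • (φ * sgn)) :
    dCoLie δ α n d φ = (opCalculus hg).M * φ - (opCalculus hg).lieR (α ^ n) φ := by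
  rw [dCoLie, crochet, circ_hatCobracket, circ_hatCobracket_right hg n d φ hφ, one_mul, smul_smul,
    ← mul_pow]
  norm_num
  rfl

theorem dAlphaNu_eq (h : ℕ) (ψ : Op K g) :
    dAlphaNu ν α h ψ = (opCalculus hg).nuA (α ^ (h - 1)) ψ := by
  let Φ (P : g → Op K g) : ExteriorAlgebra K g ⊗[K] ExteriorAlgebra K g →ₗ[K]
      ExteriorAlgebra K g :=
    TensorProduct.lift (lin P ∘ₗ ExteriorAlgebra.ιInv ∘ₗ hatBracket ν)
  have h0 : ∀ {P : g → Op K g} (_ : Lin K P) (b c),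
      Φ P (b ⊗ₜ c) = P (ExteriorAlgebra.ιInv (hatBracket ν b)) c :=
    fun hP b c => by simp only [Φ, TensorProduct.lift.tmul, LinearMap.comp_apply, lin_apply hP]
  -- `Φ P ∘ₗ comul` obeys the recursion `A_e`, so the comparison runs over all linear `P`.
  have h1 : ∀ {P : g → Op K g} (_ : Lin K P), Φ P ∘ₗ comul = (opCalculus hg).A P := fun {P} hP => by
    rw [← sub_eq_zero]
    refine op_eq_zero (fun P : {P : g → Op K g // Lin K P} =>
      Φ P.1 ∘ₗ comul - (opCalculus hg).A P.1) (fun P => ?_)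
      (fun P v => ⟨⟨fun x => P.1 x * wedge v, by have := P.2; fun_prop⟩, 1, ?_⟩) ⟨P, hP⟩
    · rw [LinearMap.sub_apply, show (opCalculus hg).A P.1 1 = 0 from Lop_one _,
        LinearMap.comp_apply, comul_one, h0 P.2, hatBracket_one, map_zero, ← zero_smul K (0 : g),
        P.2.smul, zero_smul]
      simp
    · obtain ⟨P, hP⟩ := P
      have hw : Lin K fun x => P x * wedge v := by fun_prop
      have h2 : (Φ P ∘ₗ comul : Op K g) * wedge v =
          Φ (fun x => P x * wedge v) ∘ₗ comul + Lop fun y => P (ν v y) := by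
        rw [← Lop_eq (F := fun y => P (ν v y)) (by fun_prop)
          (Φ := Φ P ∘ₗ TensorProduct.map (wedge v) LinearMap.id) fun b c => by
            rw [LinearMap.comp_apply, TensorProduct.map_tmul, h0 hP,
              hatBracket_wedge ν hg.algebra.skew, ιInv_ι]
            rfl]
        have e2 : Φ P ∘ₗ TensorProduct.map sgn (wedge v) = Φ (fun x => P x * wedge v) :=
          TensorProduct.ext' fun b c => by
            rw [LinearMap.comp_apply, TensorProduct.map_tmul, h0 hP, h0 hw,
              hatBracket_sgn ν hg.algebra.skew]
            rfl
        refine LinearMap.ext fun x => ?_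
        change Φ P (comul (wedge v x)) = _
        rw [comul_wedge, map_add, add_comm, ← e2]
        rfl
      have h3 := (opCalculus hg).A_e hg hP v
      have h4 := congrArg₂ (fun S T : Op K g => S - T) h2 h3
      refine Eq.trans (sub_mul (Φ P ∘ₗ comul : Op K g) _ (wedge v)) (h4.trans ?_)
      refine LinearMap.ext fun x => ?_
      simp only [LinearMap.sub_apply, LinearMap.add_apply, Module.End.mul_apply,
        Module.End.one_apply]
      exact add_sub_add_right_eq_sub _ _ _
  have hP : Lin K fun x => (opCalculus hg).ad ((α ^ (h - 1)) x) * ψ := by fun_prop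
  rw [OpCalculus.nuA, ← h1 hP, dAlphaNu, ← LinearMap.comp_assoc]
  refine congrArg (· ∘ₗ comul) (TensorProduct.ext' fun b c => ?_)
  rw [h0 hP, LinearMap.comp_apply,
    TensorProduct.map_tmul, act_eq ν α hg.algebra.skew,
    LinearMap.comp_apply, extMap_pow, ιInv_extMap]
  rfl

include hg in
omit [CharZero K] in
theorem extMap_hatCobracket (n : ℕ) (v : g) : extMap (α ^ n) (hatCobracket δ (ExteriorAlgebra.ι K v)) =
    hatCobracket δ (ExteriorAlgebra.ι K ((α ^ n) v)) := by
  rw [hatCobracket_ι, hatCobracket_ι, (IsEndo.pow hg n).sw_cobracket v, map_smul, ← sw_comp]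
  · refine congrArg ((2⁻¹ : K) • ·) (sw_congr _ fun u w => ?_)
    rw [← extMap_ι, ← extMap_ι]
    exact map_mul (ExteriorAlgebra.map (α ^ n)) (ExteriorAlgebra.ι K u) (ExteriorAlgebra.ι K w)
  · fun_prop
  · fun_prop

theorem dAlphaNuCo_eq (h : ℕ) (ψ : Op K g) :
    dAlphaNuCo δ α h ψ = (opCalculus hg).coA (α ^ (h - 1)) ψ := by
  have h1 : ∀ v, (opCalculus hg).d v = cowedge δ v := fun v => (cowedge_eq δ v).symm
  simp only [OpCalculus.coA, h1]
  change _ = TensorProduct.lift (lin fun c => cowedge δ ((α ^ (h - 1)) c) * ψ) ∘ₗ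
    TensorProduct.map ExteriorAlgebra.ιInv LinearMap.id ∘ₗ coact δ α
  rw [dAlphaNuCo, ← LinearMap.comp_assoc, ← LinearMap.comp_assoc]
  refine congrArg (· ∘ₗ coact δ α) (TensorProduct.ext' fun b c => ?_)
  rw [LinearMap.comp_apply, LinearMap.comp_apply, TensorProduct.map_tmul, TensorProduct.map_tmul,
    TensorProduct.lift.tmul, lin_apply (by fun_prop), mul, LinearMap.mul'_apply,
    LinearMap.comp_apply, ← hatCobracket_ι_ιInv, extMap_pow, extMap_hatCobracket hg]
  rfl

omit [CharZero K] in
theorem hatCobracket_twist (n d : ℕ) (b : ExteriorAlgebra K g) :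
    hatCobracket δ ((extMap α ^ n) ((sgn ^ d) b)) = (-1 : K) ^ d •
      hatCobracket δ (ExteriorAlgebra.ι K ((α ^ n) (ExteriorAlgebra.ιInv b))) := by
  rw [← hatCobracket_ι_ιInv, extMap_pow, ιInv_extMap, ιInv_sgn_pow]
  simp only [map_smul]

/-- The factor `(-1) ^ d` is the Koszul sign of `ψ` on the cobracketed element of degree one; the
extra minus is the sign of the odd `ν` passing the first leg. -/
theorem dMixed₁_eq (h d : ℕ) (ψ : Op K g) :
    dMixed₁ ν δ α h d ψ = (-1 : K) ^ (d + 1) • (opCalculus hg).kL (α ^ (h - 1)) ψ := by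
  rw [OpCalculus.kL, ← OpCalculus.L_smul, dMixed₁]
  simp only [← LinearMap.comp_assoc]
  refine Lop_eq (by fun_prop) fun b c => ?_
  let X : ExteriorAlgebra K g ⊗[K] (ExteriorAlgebra K g ⊗[K] ExteriorAlgebra K g) →ₗ[K]
      ExteriorAlgebra K g ⊗[K] ExteriorAlgebra K g := TensorProduct.map mul LinearMap.id ∘ₗ
      (TensorProduct.assoc K _ _ _).symm.toLinearMap
  let Φ : (ExteriorAlgebra K g ⊗[K] ExteriorAlgebra K g) ⊗[K]
      (ExteriorAlgebra K g ⊗[K] ExteriorAlgebra K g) →ₗ[K] ExteriorAlgebra K g :=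
    mul ∘ₗ TensorProduct.map LinearMap.id mul ∘ₗ
    koszul 1 (extMap α) (TensorProduct.map (hatBracket ν) (extMap α)) ∘ₗ
    TensorProduct.map LinearMap.id X ∘ₗ (TensorProduct.assoc K _ _ _).toLinearMap
  have h1 : ∀ s t : ExteriorAlgebra K g ⊗[K] ExteriorAlgebra K g, TensorProduct.map pr X ((TensorProduct.assoc K _ _ _) (s ⊗ₜ t)) =
      TensorProduct.map LinearMap.id X ((TensorProduct.assoc K _ _ _)
        (TensorProduct.map pr LinearMap.id s ⊗ₜ t)) := fun s t => by
    induction s with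
    | zero => simp
    | add s s' hs hs' => simp only [map_add, TensorProduct.add_tmul, hs, hs']
    | tmul p q => simp
  have h2 : ∀ u w t, Φ ((ExteriorAlgebra.ι K u ⊗ₜ ExteriorAlgebra.ι K w) ⊗ₜ t) =
      -wedge (α u) (mul (TensorProduct.map (ExteriorAlgebra.ι K ∘ₗ ν w) (extMap α)
        (TensorProduct.map ExteriorAlgebra.ιInv LinearMap.id t))) := fun u w t => by
    induction t with
    | zero => simp
    | add s t hs ht => simp only [map_add, TensorProduct.tmul_add, hs, ht, neg_add]
    | tmul p q =>
      simp only [Φ, X, LinearMap.comp_apply, LinearEquiv.coe_coe, TensorProduct.assoc_tmul,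
        TensorProduct.map_tmul, LinearMap.id_apply, TensorProduct.assoc_symm_tmul, koszul, mul,
        LinearMap.mul'_apply, pow_one, sgn_ι, map_neg, extMap_ι, ← wedge_apply w,
        hatBracket_wedge ν hg.algebra.skew, neg_mul, ← wedge_apply (α u)]
  have h3 : ∀ v y, Φ (TensorProduct.map pr LinearMap.id (comul (hatCobracket δ
      (ExteriorAlgebra.ι K v))) ⊗ₜ comul y) = -((opCalculus hg).k v) y := fun v y => by
    have h4 := sw_tensor (ExteriorAlgebra.ι K) (ExteriorAlgebra.ι K)
      (Φ ∘ₗ (TensorProduct.mk K _ _).flip (comul y)) (δ v)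
    rw [map_pr_hatCobracket hg]
    refine h4.trans ?_
    have h5 : ∀ u w, (Φ ∘ₗ (TensorProduct.mk K _ _).flip (comul y))
        (ExteriorAlgebra.ι K u ⊗ₜ ExteriorAlgebra.ι K w) =
        -((wedge (α u) * ad ν α w : Op K g) y) := fun u w => by
      refine (h2 u w (comul y)).trans ?_
      rw [Module.End.mul_apply, ad_apply ν α hg.algebra.skew]
      rfl
    simp only [h5, sw_neg, ← sw_apply]
    rfl
  simp only [LinearMap.comp_apply, TensorProduct.map_tmul, koszul]
  rw [hatCobracket_twist]
  simp only [map_smul, ← TensorProduct.smul_tmul']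
  rw [show (-1 : K) ^ (d + 1) = -(-1) ^ d by rw [pow_succ, mul_neg_one], LinearMap.smul_apply,
    neg_smul, ← smul_neg]
  refine congrArg _ (Eq.trans ?_ (h3 _ _))
  exact congrArg (fun z => mul (TensorProduct.map LinearMap.id mul
    (koszul 1 (extMap α) (TensorProduct.map (hatBracket ν) (extMap α)) z))) (h1 _ _)

/-- The explicit `(-1) ^ d` remains, the sign of `ψ` being trivial on the bracketed elements of
degree two; the extra minus comes from the odd `δ` passing an element of degree one. The two nested
uses of `Lop_eq` correspond to the two factors of `Δ³` that are contracted. -/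
theorem dMixed₂_eq (h d : ℕ) (ψ : Op K g) :
    dMixed₂ ν δ α h d ψ = (-1 : K) ^ (d + 1) • (opCalculus hg).eB (α ^ (h - 1)) ψ := by
  rw [dMixed₂, pow_succ, mul_smul]
  refine congrArg _ ?_
  rw [OpCalculus.eB, OpCalculus.B, ← OpCalculus.L_smul]
  have h0 : ∀ x, (-1 : K) • ((opCalculus hg).R fun c =>
      (opCalculus hg).e ((α ^ (h - 1)) (ν (α x) c)) * ψ) =
      Lop fun v => (-1 : K) • (sw (δ v) (fun u w => wedge ((α ^ (h - 1)) (ν (α x) u)) * ψ *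
        wedge w) * extMap α) := fun x => by
    rw [OpCalculus.R_eq_L _ (by fun_prop), ← OpCalculus.L_smul]
    rfl
  have hR : Lin K fun x => (opCalculus hg).R fun c =>
      (opCalculus hg).e ((α ^ (h - 1)) (ν (α x) c)) * ψ :=
    OpCalculus.lin_R _ fun c => by fun_prop
  simp only [← LinearMap.comp_assoc]
  refine Lop_eq (hR.const_smul _) fun b c => ?_
  rw [h0]
  let Φ : ExteriorAlgebra K g ⊗[K] (ExteriorAlgebra K g ⊗[K] ExteriorAlgebra K g) →ₗ[K]
      ExteriorAlgebra K g := mul ∘ₗ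
    koszul d ((extMap α ^ (h - 1)) ∘ₗ hatBracket ν) ψ ∘ₗ
    TensorProduct.map mul mul ∘ₗ
    (TensorProduct.assoc K _ _ _).symm.toLinearMap ∘ₗ
    TensorProduct.map pr ((TensorProduct.assoc K _ _ _).toLinearMap ∘ₗ
      TensorProduct.map comul LinearMap.id) ∘ₗ
    koszul 1 (extMap α) (TensorProduct.map (hatCobracket δ) (extMap α))
  rw [← Lop_eq (Φ := Φ ∘ₗ TensorProduct.mk K _ _ b) (by fun_prop)]
  · rfl
  intro b' c'
  have h1 : ∀ z y s, mul (koszul d ((extMap α ^ (h - 1)) ∘ₗ hatBracket ν) ψ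
      (TensorProduct.map mul mul ((TensorProduct.assoc K _ _ _).symm (ExteriorAlgebra.ι K z ⊗ₜ
        (TensorProduct.assoc K _ _ _) (s ⊗ₜ y))))) =
      (mul ∘ₗ TensorProduct.map (ExteriorAlgebra.ι K ∘ₗ (α ^ (h - 1)) ∘ₗ ν z)
        (ψ ∘ₗ LinearMap.mulRight K y)) (TensorProduct.map ExteriorAlgebra.ιInv LinearMap.id s) :=
    fun z y s => by
      induction s with
      | zero => simp
      | add s t hs ht => simp only [map_add, TensorProduct.add_tmul, TensorProduct.tmul_add, hs, ht]
      | tmul p q =>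
        simp only [LinearMap.comp_apply, TensorProduct.assoc_tmul, TensorProduct.assoc_symm_tmul,
          TensorProduct.map_tmul, LinearMap.id_apply, koszul, mul, LinearMap.mul'_apply,
          hatBracket_sgn_pow ν hg.algebra.skew, LinearMap.mulRight_apply]
        rw [← wedge_apply z, hatBracket_wedge ν hg.algebra.skew, extMap_pow, extMap_ι]
  have h2 : pr (extMap α (sgn b)) = -ExteriorAlgebra.ι K (α (ExteriorAlgebra.ιInv b)) := by
    rw [pr, LinearMap.comp_apply, ιInv_extMap, ιInv_sgn, map_neg, map_neg]
  have h3 : split (hatCobracket δ b') =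
      TensorProduct.map LinearMap.id (ExteriorAlgebra.ι K) (δ (ExteriorAlgebra.ιInv b')) := by
    rw [← hatCobracket_ι_ιInv, split_hatCobracket δ hg.coalgebra.skew]
  have h4 := h1 (α (ExteriorAlgebra.ιInv b)) (extMap α c') (comul (hatCobracket δ b'))
  have h5 : (Φ ∘ₗ TensorProduct.mk K _ _ b) (b' ⊗ₜ c') =
      mul (koszul d ((extMap α ^ (h - 1)) ∘ₗ hatBracket ν) ψ
      (TensorProduct.map mul mul ((TensorProduct.assoc K _ _ _).symm (pr (extMap α (sgn b)) ⊗ₜ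
        (TensorProduct.assoc K _ _ _) (comul (hatCobracket δ b') ⊗ₜ extMap α c'))))) := by
    simp only [Φ, LinearMap.comp_apply, TensorProduct.mk_apply, koszul, TensorProduct.map_tmul,
      pow_one, LinearEquiv.coe_coe, LinearMap.id_apply]
  rw [h5, h2, TensorProduct.neg_tmul]
  simp only [map_neg]
  rw [h4, ← neg_one_smul K]
  refine congrArg ((-1 : K) • ·) ?_
  refine Eq.trans (congrArg _ h3) ?_
  rw [sw_tensor, sw_mul, sw_apply]
  rfl

end

namespace Lin

variable {V W : Type*} [AddCommGroup V] [Module K V] [AddCommGroup W] [Module K W] {f : V → W}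

theorem neg (hf : Lin K f) (x : V) : f (-x) = -f x := by
  rw [← neg_one_smul K, hf.smul, neg_one_smul]

theorem sub (hf : Lin K f) (x y : V) : f (x - y) = f x - f y := by
  rw [sub_eq_add_neg, hf.add, hf.neg, sub_eq_add_neg]

end Lin

namespace OpCalculus

variable {E : Type*} [Ring E] [Algebra K E] {ν : g →ₗ[K] g →ₗ[K] g}
  {δ : g →ₗ[K] g ⊗[K] g} {α : g →ₗ[K] g} (C : OpCalculus ν δ α E)

/-! #### The differential -/

/-- The bracket with `ν + δ` of an operator of degree `d`. -/
def bd (p : g →ₗ[K] g) (d : ℕ) (T : E) : E :=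
  (-1 : K) ^ d • (C.lieL p T - T * C.N) + (C.M * T - C.lieR p T)

/-- The connecting part of the differential, for an operator of degree `d`. -/
def conn (p : g →ₗ[K] g) (d : ℕ) (T : E) : E :=
  C.nuA p T + (-1 : K) ^ (d + 1) • (C.kL p T + C.eB p T) + C.coA p T

@[fun_prop] theorem lin_bd (p : g →ₗ[K] g) (d : ℕ) : Lin K fun T => C.bd p d T := by
  unfold bd
  have h1 : Lin K fun T => T * C.N := Lin.id.mul_const _
  have h2 : Lin K fun T => C.M * T := Lin.id.const_mul _
  exact ((C.lin_lieL p).fun_sub h1).const_smul _ |>.fun_add (h2.fun_sub (C.lin_lieR p))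

@[fun_prop] theorem lin_conn (p : g →ₗ[K] g) (d : ℕ) : Lin K fun T => C.conn p d T := by
  unfold conn
  exact ((C.lin_nuA p).fun_add (((C.lin_kL p).fun_add (C.lin_eB p)).const_smul _)).fun_add
    (C.lin_coA p)

variable (hg : IsHomLieBialgebra ν δ α α) {p : g →ₗ[K] g} (hp : IsEndo ν δ α p)
include hg

theorem a_mul_bd (d : ℕ) (T : E) : C.a * C.bd p d T = C.bd (α ∘ₗ p) d (C.a * T) := by
  simp only [bd, mul_add, mul_sub, mul_smul_comm, C.a_mul_lieL hg, C.a_mul_lieR,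
    ← mul_assoc C.a C.M, C.a_mul_M hg, mul_assoc]

theorem a_mul_conn (d : ℕ) (T : E) : C.a * C.conn p d T = C.conn (α ∘ₗ p) d (C.a * T) := by
  simp only [conn, mul_add, mul_smul_comm, C.a_mul_nuA hg, C.a_mul_kL hg, C.a_mul_eB,
    C.a_mul_coA hg]

include hp

theorem bd_mul_a (d : ℕ) (T : E) : C.bd p d T * C.a = C.bd (α ∘ₗ p) d (T * C.a) := by
  simp only [bd, add_mul, sub_mul, smul_mul_assoc, C.lieL_mul_a hp, C.lieR_mul_a hg hp, mul_assoc,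
    C.a_mul_N hg]

theorem conn_mul_a (d : ℕ) (T : E) : C.conn p d T * C.a = C.conn (α ∘ₗ p) d (T * C.a) := by
  simp only [conn, add_mul, smul_mul_assoc, C.nuA_mul_a hg hp, C.kL_mul_a hp, C.eB_mul_a hg hp,
    C.coA_mul_a hg hp]

variable [CharZero K]

/-- The plain products cancel in pairs. Each of `nuA`, `kL`, `eB` and `coA` survives once on `a * T`
and once, with the opposite sign, on `T * a`. -/
theorem bd_bd (d : ℕ) (T : E) :
    C.bd (α ∘ₗ p) (d + 1) (C.bd p d T) = -C.conn p d (C.a * T - T * C.a) := by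
  have h1 := C.lieL_lieL hg hp T
  have h2 := C.lieL_mul_N hg hp T
  have h3 := C.M_mul_lieR (p := p) T
  have h4 := C.lieR_lieR hg hp T
  have h5 := C.M_mul_lieL hg (p := p) T
  have h6 := C.lieR_mul_N hg hp T
  have h7 := C.lieR_lieL hp T
  have h8 : T * C.N * C.N = 0 := by rw [mul_assoc, C.N_mul_N hg, mul_zero]
  have h9 : C.M * (C.M * T) = 0 := by rw [← mul_assoc, C.M_mul_M hg, zero_mul]
  rcases neg_one_pow_eq_or K d with hd | hd <;>
  · simp only [bd, conn, pow_succ, hd, one_mul, neg_mul, neg_neg, neg_one_smul, one_smul,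
      (C.lin_lieL _).add, (C.lin_lieR _).add, (C.lin_nuA _).sub,
      (C.lin_lieL _).sub, (C.lin_lieL _).neg, (C.lin_lieR _).sub, (C.lin_lieR _).neg,
      (C.lin_kL _).sub, (C.lin_eB _).sub, (C.lin_coA _).sub, mul_add, mul_sub, mul_neg,
      add_mul, sub_mul, h1, h2, h3, h4, h5, h6, h7, h8, h9]
    simp only [mul_assoc]
    abel

theorem bd_conn (d : ℕ) (T : E) :
    C.bd (α ∘ₗ α ∘ₗ p) d (C.conn p d T) = C.conn (α ∘ₗ p) (d + 1) (C.bd (α ∘ₗ p) d T) := by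
  have h1 := C.lieL_nuA hg hp T
  have h2 := C.nuA_mul_N hg hp T
  have h3 := C.M_mul_coA hg (p := p) T
  have h4 := C.lieR_coA hg hp T
  have h5 := C.mixed_nuA hg hp T
  have h6 := C.mixed_coA hg hp T
  -- The parity of `d` decides only the relative sign of the two mixed components `h5` and `h6`.
  rcases neg_one_pow_eq_or K d with hd | hd
  · simp only [bd, conn, pow_succ, hd, one_mul, neg_mul, neg_neg, neg_one_smul, one_smul,
      (C.lin_lieL _).add, (C.lin_lieR _).add, (C.lin_lieL _).neg, (C.lin_lieR _).neg,
      (C.lin_nuA _).add, (C.lin_nuA _).sub, (C.lin_kL _).add, (C.lin_kL _).sub, (C.lin_eB _).add,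
      (C.lin_eB _).sub, (C.lin_coA _).add, (C.lin_coA _).sub, mul_add, mul_neg, add_mul,
      h1, h2, h3, h4]
    linear_combination (norm := abel) h5 + h6
  · simp only [bd, conn, pow_succ, hd, one_mul, neg_mul, neg_neg, neg_one_smul, one_smul,
      (C.lin_lieL _).add, (C.lin_lieR _).add, (C.lin_nuA _).neg, (C.lin_kL _).neg, (C.lin_eB _).neg,
      (C.lin_coA _).neg,
      (C.lin_nuA _).add, (C.lin_nuA _).sub, (C.lin_kL _).add, (C.lin_kL _).sub, (C.lin_eB _).add,
      (C.lin_eB _).sub, (C.lin_coA _).add, (C.lin_coA _).sub, mul_add, add_mul,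
      h1, h2, h3, h4]
    linear_combination (norm := abel) h5 - h6

end OpCalculus

namespace OpCalculus

variable {E : Type*} [Ring E] [Algebra K E] {ν : g →ₗ[K] g →ₗ[K] g}
  {δ : g →ₗ[K] g ⊗[K] g} {α : g →ₗ[K] g} (C : OpCalculus ν δ α E)

/-! #### Degrees -/

/-- The properties of the operator that multiplies elements of degree `n` by `2 ^ n`. -/
structure IsScaling (c : E) : Prop where
  vac_mul : ∀ {S}, S ∈ C.vac → S * c ∈ C.vac
  mul_e : ∀ v, c * C.e v = (2 : K) • (C.e v * c)
  mul_a : c * C.a = C.a * c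
  L_mul : ∀ {F : g → E}, Lin K F → C.L F * c = C.L fun x => (2 : K) • (F x * c)

/-- `T` maps elements of degree `i` to elements of degree `j`, and other elements to zero. -/
def HasDegree (_ : OpCalculus ν δ α E) (c : E) (i j : ℕ) (T : E) : Prop :=
  T * c = (2 : K) ^ i • T ∧ c * T = (2 : K) ^ j • T

variable {C} {c : E}

theorem HasDegree.add {i j : ℕ} {S T : E} (hS : C.HasDegree c i j S) (hT : C.HasDegree c i j T) :
    C.HasDegree c i j (S + T) :=
  ⟨by rw [add_mul, hS.1, hT.1, smul_add], by rw [mul_add, hS.2, hT.2, smul_add]⟩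

theorem HasDegree.smul {i j : ℕ} {T : E} (hT : C.HasDegree c i j T) (r : K) :
    C.HasDegree c i j (r • T) :=
  ⟨by rw [smul_mul_assoc, hT.1, smul_comm], by rw [mul_smul_comm, hT.2, smul_comm]⟩

theorem HasDegree.sub {i j : ℕ} {S T : E} (hS : C.HasDegree c i j S) (hT : C.HasDegree c i j T) :
    C.HasDegree c i j (S - T) :=
  ⟨by rw [sub_mul, hS.1, hT.1, smul_sub], by rw [mul_sub, hS.2, hT.2, smul_sub]⟩

variable (hc : C.IsScaling c)
include hc

theorem scaling_mul_ad (x : g) : c * C.ad x = C.ad x * c := by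
  rw [← sub_eq_zero]
  refine C.eq_zero (fun x => c * C.ad x - C.ad x * c)
    (fun x => sub_mem (C.mul_vac _ (C.ad_vac x)) (hc.vac_mul (C.ad_vac _)))
    (fun x v => ⟨x, (2 : K) • C.e (α v), ?_⟩) x
  simp only [sub_mul, mul_sub, mul_assoc, hc.mul_e, C.ad_e, mul_add, mul_smul_comm, smul_mul_assoc]
  simp only [← mul_assoc, hc.mul_e, C.ad_e, smul_mul_assoc, add_mul, smul_add]
  simp only [mul_assoc, hc.mul_a]
  abel

theorem scaling_mul_d (x : g) : c * C.d x = (4 : K) • (C.d x * c) := by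
  have h : ∀ u w, c * (C.e u * C.e w) = (4 : K) • (C.e u * C.e w * c) := fun u w => by
    rw [← mul_assoc, hc.mul_e, smul_mul_assoc, mul_assoc, hc.mul_e, mul_smul_comm, smul_smul,
      mul_assoc]
    norm_num
  rw [d, mul_smul_comm, smul_mul_assoc, smul_comm, mul_sw, sw_mul]
  simp only [h, sw_smul, smul_comm (2⁻¹ : K)]

theorem scaling_mul_k (x : g) : c * C.k x = (2 : K) • (C.k x * c) := by
  rw [k, mul_sw, sw_mul, ← sw_smul]
  refine sw_congr _ fun u w => ?_
  rw [← mul_assoc, hc.mul_e, smul_mul_assoc, mul_assoc, scaling_mul_ad hc, mul_assoc]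

theorem N_mul_scaling : C.N * c = (2 : K) • (c * C.N) := by
  rw [← sub_eq_zero]
  refine C.eq_zero (fun _ : Unit => C.N * c - (2 : K) • (c * C.N))
    (fun _ => sub_mem (hc.vac_mul C.N_vac) (Submodule.smul_mem _ _ (C.mul_vac _ C.N_vac)))
    (fun _ v => ⟨(), -((2 : K) • C.e (α v)), ?_⟩) ()
  simp only [sub_mul, mul_sub, mul_assoc, hc.mul_e, C.N_e, mul_add, mul_smul_comm, smul_mul_assoc,
    smul_add, mul_neg, neg_mul, scaling_mul_ad hc]
  simp only [← mul_assoc, hc.mul_e, C.N_e, smul_mul_assoc, add_mul, smul_add, neg_mul]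
  module

theorem scaling_mul_M : c * C.M = (2 : K) • (C.M * c) := by
  rw [← sub_eq_zero]
  refine C.eq_zero (fun _ : Unit => c * C.M - (2 : K) • (C.M * c))
    (fun _ => sub_mem (C.mul_vac _ C.M_vac) (Submodule.smul_mem _ _ (hc.vac_mul C.M_vac)))
    (fun _ v => ⟨(), -((2 : K) • C.e (α v)), ?_⟩) ()
  simp only [sub_mul, mul_sub, mul_assoc, hc.mul_e, C.M_e', mul_add, mul_smul_comm, smul_mul_assoc,
    mul_neg, neg_mul]
  simp only [← mul_assoc, hc.mul_e, C.M_e', scaling_mul_d hc, smul_mul_assoc, add_mul, smul_add,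
    neg_mul]
  simp only [mul_assoc, hc.mul_a]
  module

namespace HasDegree

variable {i j : ℕ}

theorem mul_N {T : E} (hT : C.HasDegree c i j T) : C.HasDegree c (i + 1) j (T * C.N) :=
  ⟨by rw [mul_assoc, N_mul_scaling hc, mul_smul_comm, ← mul_assoc, hT.1, smul_mul_assoc, smul_smul,
      pow_succ'], by rw [← mul_assoc, hT.2, smul_mul_assoc]⟩

theorem M_mul {T : E} (hT : C.HasDegree c i j T) : C.HasDegree c i (j + 1) (C.M * T) :=
  ⟨by rw [mul_assoc, hT.1, mul_smul_comm], by
    rw [← mul_assoc, scaling_mul_M hc, smul_mul_assoc, mul_assoc, hT.2, mul_smul_comm, smul_smul,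
      pow_succ']⟩

theorem a_mul {T : E} (hT : C.HasDegree c i j T) : C.HasDegree c i j (C.a * T) :=
  ⟨by rw [mul_assoc, hT.1, mul_smul_comm], by
    rw [← mul_assoc, hc.mul_a, mul_assoc, hT.2, mul_smul_comm]⟩

theorem mul_a {T : E} (hT : C.HasDegree c i j T) : C.HasDegree c i j (T * C.a) :=
  ⟨by rw [mul_assoc, ← hc.mul_a, ← mul_assoc, hT.1, smul_mul_assoc], by
    rw [← mul_assoc, hT.2, smul_mul_assoc]⟩

theorem e_mul {T : E} (hT : C.HasDegree c i j T) (v : g) : C.HasDegree c i (j + 1) (C.e v * T) :=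
  ⟨by rw [mul_assoc, hT.1, mul_smul_comm], by
    rw [← mul_assoc, hc.mul_e, smul_mul_assoc, mul_assoc, hT.2, mul_smul_comm, smul_smul,
      pow_succ']⟩

theorem ad_mul {T : E} (hT : C.HasDegree c i j T) (v : g) : C.HasDegree c i j (C.ad v * T) :=
  ⟨by rw [mul_assoc, hT.1, mul_smul_comm], by
    rw [← mul_assoc, scaling_mul_ad hc, mul_assoc, hT.2, mul_smul_comm]⟩

theorem d_mul {T : E} (hT : C.HasDegree c i j T) (v : g) : C.HasDegree c i (j + 2) (C.d v * T) :=
  ⟨by rw [mul_assoc, hT.1, mul_smul_comm], by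
    rw [← mul_assoc, scaling_mul_d hc, smul_mul_assoc, mul_assoc, hT.2, mul_smul_comm, smul_smul,
      pow_add, mul_comm]
    norm_num⟩

theorem k_mul {T : E} (hT : C.HasDegree c i j T) (v : g) : C.HasDegree c i (j + 1) (C.k v * T) :=
  ⟨by rw [mul_assoc, hT.1, mul_smul_comm], by
    rw [← mul_assoc, scaling_mul_k hc, smul_mul_assoc, mul_assoc, hT.2, mul_smul_comm, smul_smul,
      pow_succ']⟩

theorem L {F : g → E} (hF : Lin K F) (h : ∀ x, C.HasDegree c i j (F x)) :
    C.HasDegree c (i + 1) j (C.L F) := by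
  refine ⟨?_, ?_⟩
  · rw [hc.L_mul hF, ← C.L_smul]
    refine C.L_congr fun x => ?_
    rw [(h x).1, smul_smul, pow_succ']
  · rw [C.mul_L, ← C.L_smul]
    exact C.L_congr fun x => (h x).2

/-- In the form `R_eq_L` the contraction consumes an argument and the second leg `e w` restores one,
so the input degree is unchanged. -/
theorem R {F : g → E} (hF : Lin K F) (h : ∀ x, C.HasDegree c i j (F x)) :
    C.HasDegree c i j (C.R F) := by
  refine ⟨?_, ?_⟩
  · rw [C.R_eq_L hF, hc.L_mul (by fun_prop), ← C.L_smul]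
    refine C.L_congr fun x => ?_
    rw [mul_assoc, ← hc.mul_a, ← mul_assoc, sw_mul, ← smul_mul_assoc, ← smul_mul_assoc, ← sw_smul,
      ← sw_smul]
    refine congrArg (· * C.a) (sw_congr _ fun u w => ?_)
    rw [mul_assoc, ← mul_smul_comm, ← hc.mul_e, ← mul_assoc, (h u).1, smul_mul_assoc]
  · rw [C.mul_R, ← C.R_smul]
    exact C.R_congr fun x => (h x).2

theorem A {F : g → E} (hF : Lin K F) (h : ∀ x, C.HasDegree c i j (F x)) :
    C.HasDegree c (i + 2) j (C.A F) :=
  HasDegree.L hc (i := i + 1) (by fun_prop) fun x =>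
    HasDegree.L hc (by fun_prop) fun y => (h _).smul _

theorem B {F : g → E} (hF : Lin K F) (h : ∀ x, C.HasDegree c i j (F x)) :
    C.HasDegree c (i + 1) j (C.B F) :=
  HasDegree.L hc (by fun_prop) fun x => HasDegree.R hc (by fun_prop) fun y => h _

variable {p : g →ₗ[K] g} {T : E} (hT : C.HasDegree c i j T)
include hT

theorem lieL : C.HasDegree c (i + 1) j (C.lieL p T) :=
  HasDegree.L hc (by fun_prop) fun _ => hT.ad_mul hc _

theorem lieR : C.HasDegree c i (j + 1) (C.lieR p T) :=
  HasDegree.R hc (by fun_prop) fun _ => hT.e_mul hc _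

theorem nuA : C.HasDegree c (i + 2) j (C.nuA p T) :=
  HasDegree.A hc (by fun_prop) fun _ => hT.ad_mul hc _

theorem coA : C.HasDegree c i (j + 2) (C.coA p T) :=
  HasDegree.R hc (by fun_prop) fun _ => hT.d_mul hc _

theorem mixed : C.HasDegree c (i + 1) (j + 1) (C.kL p T + C.eB p T) :=
  (HasDegree.L hc (by fun_prop) fun _ => hT.k_mul hc _).add
    (HasDegree.B hc (by fun_prop) fun _ => hT.e_mul hc _)

end HasDegree

end OpCalculus

/-! ### The grading of the operators on `Λ g` -/

/-- The operator that multiplies elements of degree `n` by `2 ^ n`. -/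
def scaling (K : Type*) [Field K] (g : Type*) [AddCommGroup g] [Module K g] : Op K g :=
  extMap ((2 : K) • LinearMap.id)

/-- `Lop` does not depend on the bialgebra. The trivial structure makes the rule `L_mul_a` available
for an arbitrary twist, in particular for multiplication by `2`. -/
theorem isHomLieBialgebra_zero (β : g →ₗ[K] g) :
    IsHomLieBialgebra (0 : g →ₗ[K] g →ₗ[K] g) 0 β β where
  algebra := ⟨by simp, by simp, by simp⟩
  coalgebra := ⟨by simp, by simp, by simp⟩
  compat := by simp
  bracket_comm := by simp
  cobracket_comm := by simp
  comm := rfl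

theorem Lop_mul_extMap [CharZero K] (β : g →ₗ[K] g) {F : g → Op K g} (hF : Lin K F) :
    Lop F * extMap β = Lop fun x => F (β x) * extMap β :=
  (opCalculus (isHomLieBialgebra_zero β)).L_mul_a hF

theorem isScaling [CharZero K] {ν : g →ₗ[K] g →ₗ[K] g} {δ : g →ₗ[K] g ⊗[K] g} {α : g →ₗ[K] g}
    (hg : IsHomLieBialgebra ν δ α α) : (opCalculus hg).IsScaling (scaling K g) where
  vac_mul {S} hS := by
    change S (extMap _ 1) = 0
    rw [extMap_one]; exact hS
  mul_e v := by
    change extMap _ * wedge v = _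
    rw [extMap_mul_wedge, LinearMap.smul_apply, map_smul, smul_mul_assoc]
    rfl
  mul_a := by
    refine (congrArg AlgHom.toLinearMap (ExteriorAlgebra.map_comp_map α ((2 : K) • LinearMap.id))).trans
      (Eq.trans ?_
      (congrArg AlgHom.toLinearMap (ExteriorAlgebra.map_comp_map ((2 : K) • LinearMap.id) α)).symm)
    rw [LinearMap.smul_comp, LinearMap.comp_smul]
    rfl
  L_mul {F} hF := by
    have h : Lop F * extMap ((2 : K) • LinearMap.id) =
        Lop fun x => F ((2 : K) • x) * extMap ((2 : K) • LinearMap.id) :=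
      Lop_mul_extMap _ hF
    refine h.trans ?_
    refine congrArg Lop (funext fun x => ?_)
    rw [hF.smul, smul_mul_assoc]
    rfl

theorem scaling_of_mem {n : ℕ} {x : ExteriorAlgebra K g} (hx : x ∈ ⋀[K]^n g) :
    scaling K g x = (2 : K) ^ n • x := by
  induction hx using Submodule.pow_induction_on_left' with
  | algebraMap r => rw [Algebra.algebraMap_eq_smul_one, map_smul, scaling, extMap_one]; simp
  | add x y i _ _ hx hy => rw [map_add, hx, hy, smul_add]
  | mem_mul m hm i x _ hx =>
    obtain ⟨v, rfl⟩ := hm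
    rw [← wedge_apply, scaling, extMap_wedge, ← scaling, hx, LinearMap.smul_apply, map_smul,
      map_smul, LinearMap.smul_apply, smul_smul, pow_succ]
    rfl

theorem two_pow_injective (K : Type*) [Field K] [CharZero K] {m n : ℕ}
    (h : (2 : K) ^ m = (2 : K) ^ n) : m = n :=
  Nat.pow_right_injective le_rfl (by exact_mod_cast h)

/-- The component of `x` in degree `m` is annihilated by `2 ^ n - 2 ^ m`, hence is zero for `m ≠ n`.
-/
theorem mem_of_scaling [CharZero K] {n : ℕ} {x : ExteriorAlgebra K g}
    (hx : scaling K g x = (2 : K) ^ n • x) : x ∈ ⋀[K]^n g := by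
  classical
  let π (m : ℕ) : ExteriorAlgebra K g →ₗ[K] ⋀[K]^m g :=
    DirectSum.component K ℕ (fun m => ⋀[K]^m g) m ∘ₗ
      (DirectSum.decomposeLinearEquiv (fun m : ℕ => ⋀[K]^m g)).toLinearMap
  have hπ : ∀ m y, π m y = DirectSum.decompose (fun m : ℕ => ⋀[K]^m g) y m := fun _ _ => rfl
  have h1 : ∀ m, π m ∘ₗ scaling K g = (2 : K) ^ m • π m := fun m => by
    refine DirectSum.decompose_lhom_ext (fun m : ℕ => ⋀[K]^m g) fun l => LinearMap.ext fun y => ?_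
    simp only [LinearMap.comp_apply, LinearMap.smul_apply, Submodule.subtype_apply]
    rw [scaling_of_mem y.2, map_smul]
    by_cases hl : l = m
    · subst hl; rfl
    · rw [hπ, DirectSum.decompose_of_mem (fun m : ℕ => ⋀[K]^m g) y.2, DirectSum.of_eq_of_ne _ _ _ (Ne.symm hl), smul_zero,
        smul_zero]
  have h2 : ∀ m, m ≠ n → DirectSum.decompose (fun m : ℕ => ⋀[K]^m g) x m = 0 := fun m hm => by
    have h3 := LinearMap.congr_fun (h1 m) x
    rw [LinearMap.comp_apply, hx, map_smul, LinearMap.smul_apply] at h3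
    have h4 : (2 : K) ^ n • (π m x : ExteriorAlgebra K g) = (2 : K) ^ m • (π m x : _) :=
      congrArg Subtype.val h3
    rw [← sub_eq_zero, ← sub_smul] at h4
    exact Subtype.ext ((smul_eq_zero.mp h4).resolve_left fun h =>
      hm (two_pow_injective K (sub_eq_zero.mp h)).symm)
  rw [← DirectSum.sum_support_decompose (fun m : ℕ => ⋀[K]^m g) x]
  refine Submodule.sum_mem _ fun m _ => ?_
  by_cases hm : m = n
  · rw [← hm]; exact Subtype.coe_prop _
  · rw [h2 m hm]; exact zero_mem _

theorem mem_homSub_iff [CharZero K] {i j : ℕ} {f : Op K g} : f ∈ homSub K g i j ↔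
    f * scaling K g = (2 : K) ^ i • f ∧ scaling K g * f = (2 : K) ^ j • f := by
  classical
  constructor
  · rintro ⟨h1, h2⟩
    constructor <;>
    refine DirectSum.decompose_lhom_ext (fun m : ℕ => ⋀[K]^m g) fun m => LinearMap.ext fun x => ?_
    · change f (scaling K g x) = (2 : K) ^ i • f x
      rw [scaling_of_mem x.2, map_smul]
      by_cases hm : m = i
      · subst hm; rfl
      · rw [h2 m hm x x.2, smul_zero, smul_zero]
    · change scaling K g (f x) = (2 : K) ^ j • f x
      by_cases hm : m = i
      · exact scaling_of_mem (h1 x (hm ▸ x.2))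
      · rw [h2 m hm x x.2, map_zero, smul_zero]
  · rintro ⟨h1, h2⟩
    refine ⟨fun x _ => mem_of_scaling (LinearMap.congr_fun h2 x), fun m hm x hx => ?_⟩
    have h3 : f (scaling K g x) = (2 : K) ^ i • f x := LinearMap.congr_fun h1 x
    rw [scaling_of_mem hx, map_smul, ← sub_eq_zero, ← sub_smul] at h3
    exact (smul_eq_zero.mp h3).resolve_left fun h => hm (two_pow_injective K (sub_eq_zero.mp h))

theorem sgn_mul_of_mem {i j : ℕ} {f : Op K g} (hf : f ∈ homSub K g i j) :
    sgn * f = (-1 : K) ^ (i + j) • (f * sgn) := by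
  classical
  obtain ⟨h1, h2⟩ := hf
  refine DirectSum.decompose_lhom_ext (fun m : ℕ => ⋀[K]^m g) fun m => LinearMap.ext fun x => ?_
  change sgn (f x) = (-1 : K) ^ (i + j) • f (sgn x)
  by_cases hm : m = i
  · subst hm
    rw [sgn_of_mem (h1 x x.2), sgn_of_mem x.2, map_smul, smul_smul, ← pow_add,
      show m + j + m = j + 2 * m by ring, pow_add, pow_mul]
    simp
  · rw [h2 m hm x x.2, sgn_of_mem x.2, map_smul, h2 m hm x x.2, map_zero, smul_zero, smul_zero]

theorem hasDegree_iff [CharZero K] {ν : g →ₗ[K] g →ₗ[K] g} {δ : g →ₗ[K] g ⊗[K] g} {α : g →ₗ[K] g}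
    (hg : IsHomLieBialgebra ν δ α α) {i j : ℕ} {f : Op K g} :
    (opCalculus hg).HasDegree (scaling K g) i j f ↔ f ∈ homSub K g i j :=
  mem_homSub_iff.symm

theorem homSub_le_cochainNu {k i j : ℕ} (hi : 1 ≤ i) (hj : 1 ≤ j) (h : i + j = k + 1) :
    homSub K g i j ≤ cochainNu K g k := by
  obtain rfl : j = k + 1 - i := by omega
  exact le_iSup₂_of_le (f := fun l (_ : l ∈ Set.Icc 1 k) => homSub K g l (k + 1 - l)) i
    ⟨hi, by omega⟩ le_rfl

theorem homSub_le_cochainAlpha {k i j : ℕ} (hi : 1 ≤ i) (hj : 1 ≤ j) (h : i + j = k) :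
    homSub K g i j ≤ cochainAlpha K g k := by
  obtain rfl : j = k - i := by omega
  exact le_iSup₂_of_le (f := fun l (_ : l ∈ Set.Icc 1 (k - 1)) => homSub K g l (k - l)) i
    ⟨hi, by omega⟩ le_rfl

theorem cochainNu_le {k : ℕ} {S : Submodule K (Op K g)}
    (h : ∀ i j, 1 ≤ i → 1 ≤ j → i + j = k + 1 → homSub K g i j ≤ S) : cochainNu K g k ≤ S :=
  iSup₂_le fun l hl => h l _ hl.1 (by have := hl.2; omega) (by have := hl.2; omega)

theorem cochainAlpha_le {k : ℕ} {S : Submodule K (Op K g)}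
    (h : ∀ i j, 1 ≤ i → 1 ≤ j → i + j = k → homSub K g i j ≤ S) : cochainAlpha K g k ≤ S :=
  iSup₂_le fun l hl => h l _ hl.1 (by have := hl.1; have := hl.2; omega)
    (by have := hl.1; have := hl.2; omega)

theorem Lin.zero {V W : Type*} [AddCommGroup V] [Module K V] [AddCommGroup W] [Module K W]
    {f : V → W} (hf : Lin K f) : f 0 = 0 := by
  rw [← zero_smul K (0 : V), hf.smul, zero_smul]

namespace OpCalculus

variable {E : Type*} [Ring E] [Algebra K E] {ν : g →ₗ[K] g →ₗ[K] g}
  {δ : g →ₗ[K] g ⊗[K] g} {α : g →ₗ[K] g} (C : OpCalculus ν δ α E)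
  (hg : IsHomLieBialgebra ν δ α α) {p : g →ₗ[K] g} (hp : IsEndo ν δ α p)
include hg hp

/-! #### The square of the differential -/

theorem commutator_bd (d : ℕ) (T : E) : (C.a * C.bd p d T - C.bd p d T * C.a) -
    C.bd (α ∘ₗ p) d (C.a * T - T * C.a) = 0 := by
  rw [C.a_mul_bd hg, C.bd_mul_a hg hp, (C.lin_bd _ _).sub, sub_self]

variable [CharZero K]

theorem bd_bd_add_conn (d : ℕ) (T : E) : C.bd (α ∘ₗ p) (d + 1) (C.bd p d T) +
    C.conn p d (C.a * T - T * C.a) = 0 := by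
  rw [C.bd_bd hg hp, neg_add_cancel]

theorem bd_conn_sub (d : ℕ) (T : E) : C.bd (α ∘ₗ α ∘ₗ p) (d + 1 + 1) (C.conn p d T) +
    C.conn (α ∘ₗ p) (d + 1) (-C.bd (α ∘ₗ p) d T) = 0 := by
  have h : C.bd (α ∘ₗ α ∘ₗ p) (d + 1 + 1) (C.conn p d T) =
      C.bd (α ∘ₗ α ∘ₗ p) d (C.conn p d T) := by
    -- `bd` depends on the degree only through its parity.
    simp only [bd, pow_succ, mul_neg_one, neg_neg]
  rw [h, C.bd_conn hg hp, (C.lin_conn _ _).neg, add_neg_cancel]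

theorem commutator_conn (d : ℕ) (T : E) : (C.a * C.conn p d T - C.conn p d T * C.a) -
    C.bd (α ∘ₗ α ∘ₗ p) (d + 1) (-C.bd (α ∘ₗ p) d T) = 0 := by
  rw [C.a_mul_conn hg, C.conn_mul_a hg hp, (C.lin_bd _ _).neg, C.bd_bd hg (hp.comp hg),
    ← (C.lin_conn _ _).sub, neg_neg, sub_self]

end OpCalculus

/-! ### The differential maps cochains to cochains -/

section

variable [CharZero K] {ν : g →ₗ[K] g →ₗ[K] g} {δ : g →ₗ[K] g ⊗[K] g} {α : g →ₗ[K] g}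
  (hg : IsHomLieBialgebra ν δ α α)

-- These are the degrees in which the exponent `h - 1 = k - 1 - 1` is truncated; with no cochains
-- there, the truncation is harmless.
omit [CharZero K] in
theorem cochainAlpha_eq_bot {k : ℕ} (hk : k ≤ 1) : cochainAlpha K g k = ⊥ :=
  le_bot_iff.mp (cochainAlpha_le fun i j hi hj h => absurd h (by omega))

omit [CharZero K] in
theorem cochainNu_zero : cochainNu K g 0 = ⊥ :=
  le_bot_iff.mp (cochainNu_le fun i j hi hj h => absurd h (by omega))

/-- A linear function as a linear map. -/
def Lin.toLinearMap {V W : Type*} [AddCommGroup V] [Module K V] [AddCommGroup W] [Module K W]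
    {f : V → W} (hf : Lin K f) : V →ₗ[K] W := ⟨⟨f, hf.add⟩, hf.smul⟩

theorem bd_mem_cochainNu {p : g →ₗ[K] g} {d k : ℕ} {φ : Op K g} (hφ : φ ∈ cochainNu K g k) :
    (opCalculus hg).bd p d φ ∈ cochainNu K g (k + 1) := by
  refine cochainNu_le (S := (cochainNu K g (k + 1)).comap
    ((opCalculus hg).lin_bd p d).toLinearMap) (fun i j hi hj h f hf => ?_) hφ
  have hc := isScaling hg
  have hf := (hasDegree_iff hg).mpr hf
  have h1 := homSub_le_cochainNu (k := k + 1) (by omega) hj (by omega)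
    ((hasDegree_iff hg).mp ((hf.lieL hc (p := p)).sub (hf.mul_N hc)))
  have h2 := homSub_le_cochainNu (k := k + 1) hi (by omega) (by omega)
    ((hasDegree_iff hg).mp ((hf.M_mul hc).sub (hf.lieR hc (p := p))))
  exact (cochainNu K g (k + 1)).add_mem ((cochainNu K g (k + 1)).smul_mem _ h1) h2

theorem bd_mem_cochainAlpha {p : g →ₗ[K] g} {d k : ℕ} {ψ : Op K g} (hψ : ψ ∈ cochainAlpha K g k) :
    (opCalculus hg).bd p d ψ ∈ cochainAlpha K g (k + 1) := by
  refine cochainAlpha_le (S := (cochainAlpha K g (k + 1)).comap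
    ((opCalculus hg).lin_bd p d).toLinearMap) (fun i j hi hj h f hf => ?_) hψ
  have hc := isScaling hg
  have hf := (hasDegree_iff hg).mpr hf
  have h1 := homSub_le_cochainAlpha (k := k + 1) (by omega) hj (by omega)
    ((hasDegree_iff hg).mp ((hf.lieL hc (p := p)).sub (hf.mul_N hc)))
  have h2 := homSub_le_cochainAlpha (k := k + 1) hi (by omega) (by omega)
    ((hasDegree_iff hg).mp ((hf.M_mul hc).sub (hf.lieR hc (p := p))))
  exact (cochainAlpha K g (k + 1)).add_mem ((cochainAlpha K g (k + 1)).smul_mem _ h1) h2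

theorem conn_mem_cochainNu {p : g →ₗ[K] g} {d k : ℕ} {ψ : Op K g} (hψ : ψ ∈ cochainAlpha K g k) :
    (opCalculus hg).conn p d ψ ∈ cochainNu K g (k + 1) := by
  refine cochainAlpha_le (S := (cochainNu K g (k + 1)).comap
    ((opCalculus hg).lin_conn p d).toLinearMap) (fun i j hi hj h f hf => ?_) hψ
  have hc := isScaling hg
  have hf := (hasDegree_iff hg).mpr hf
  have h1 := homSub_le_cochainNu (k := k + 1) (by omega) hj (by omega)
    ((hasDegree_iff hg).mp (hf.nuA hc (p := p)))
  have h2 := homSub_le_cochainNu (k := k + 1) (by omega) (by omega) (by omega)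
    ((hasDegree_iff hg).mp (hf.mixed hc (p := p)))
  have h3 := homSub_le_cochainNu (k := k + 1) hi (by omega) (by omega)
    ((hasDegree_iff hg).mp (hf.coA hc (p := p)))
  exact (cochainNu K g (k + 1)).add_mem ((cochainNu K g (k + 1)).add_mem h1
    ((cochainNu K g (k + 1)).smul_mem _ h2)) h3

omit [CharZero K] in
theorem lin_commutator {E : Type*} [Ring E] [Algebra K E] (a : E) :
    Lin K fun T : E => a * T - T * a :=
  (Lin.id.const_mul a).fun_sub (Lin.id.mul_const a)

include hg in
theorem dAlpha_mem_cochainAlpha {k : ℕ} {φ : Op K g} (hφ : φ ∈ cochainNu K g k) :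
    dAlpha α φ ∈ cochainAlpha K g (k + 1) := by
  refine cochainNu_le (S := (cochainAlpha K g (k + 1)).comap
    (lin_commutator (opCalculus hg).a).toLinearMap) (fun i j hi hj h f hf => ?_) hφ
  have hc := isScaling hg
  have hf := (hasDegree_iff hg).mpr hf
  exact homSub_le_cochainAlpha hi hj h ((hasDegree_iff hg).mp ((hf.a_mul hc).sub (hf.mul_a hc)))

/-- The operators `T` with `sgn * T = (-1) ^ d • (T * sgn)`. -/
def ofParity (K : Type*) [Field K] (g : Type*) [AddCommGroup g] [Module K g] (d : ℕ) :
    Submodule K (Op K g) where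
  carrier := {T | sgn * T = (-1 : K) ^ d • (T * sgn)}
  add_mem' {S T} hS hT := by
    change _ = _ at hS hT ⊢
    rw [mul_add, add_mul, hS, hT, smul_add]
  zero_mem' := by
    change _ = _
    rw [mul_zero, zero_mul, smul_zero]
  smul_mem' c T hT := by
    change _ = _ at hT ⊢
    rw [mul_smul_comm, hT, smul_mul_assoc, smul_comm]

omit [CharZero K] in
theorem cochainNu_le_ofParity (k : ℕ) : cochainNu K g k ≤ ofParity K g (k + 1) :=
  cochainNu_le fun _ _ _ _ h _ hf => h ▸ sgn_mul_of_mem hf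

omit [CharZero K] in
theorem cochainAlpha_le_ofParity (k : ℕ) : cochainAlpha K g k ≤ ofParity K g k :=
  cochainAlpha_le fun _ _ _ _ h _ hf => h ▸ sgn_mul_of_mem hf

theorem dLie_add_dCoLie {n d : ℕ} {φ : Op K g} (hφ : φ ∈ ofParity K g d) :
    dLie ν α n d φ + dCoLie δ α n d φ = (opCalculus hg).bd (α ^ n) d φ := by
  rw [dLie_eq hg, dCoLie_eq hg n d φ hφ]
  rfl

theorem dAlphaNu_add_dMixed_add_dAlphaNuCo (h d : ℕ) (ψ : Op K g) :
    dAlphaNu ν α h ψ + dMixed ν δ α h d ψ + dAlphaNuCo δ α h ψ =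
      (opCalculus hg).conn (α ^ (h - 1)) d ψ := by
  rw [dAlphaNu_eq hg, dMixed, dMixed₁_eq hg, dMixed₂_eq hg, dAlphaNuCo_eq hg, ← smul_add]
  rfl

/-- The differential on pairs of operators. -/
def diffLin (k : ℕ) : Op K g × Op K g →ₗ[K] Op K g × Op K g :=
  let b (d : ℕ) := ((opCalculus hg).lin_bd (α ^ (k - 1)) d).toLinearMap
  ((b (k + 1)).coprod ((opCalculus hg).lin_conn (α ^ (k - 1 - 1)) k).toLinearMap).prod
    ((lin_commutator (opCalculus hg).a).toLinearMap.coprod (-b k))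

theorem diffLin_apply (k : ℕ) (φ ψ : Op K g) : diffLin hg k (φ, ψ) =
    ((opCalculus hg).bd (α ^ (k - 1)) (k + 1) φ + (opCalculus hg).conn (α ^ (k - 1 - 1)) k ψ,
      ((opCalculus hg).a * φ - φ * (opCalculus hg).a) - (opCalculus hg).bd (α ^ (k - 1)) k ψ) :=
  Prod.ext rfl (sub_eq_add_neg _ _).symm

/-- The restriction to cochains supplies the parity needed to identify the cobracket terms. -/
theorem diff_eq {k : ℕ} {c : Op K g × Op K g} (hc : c ∈ cochain K g k) :
    diff ν δ α k c = diffLin hg k c := by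
  obtain ⟨φ, ψ⟩ := c
  rw [diffLin_apply, ← dAlphaNu_add_dMixed_add_dAlphaNuCo,
    ← dLie_add_dCoLie hg (cochainNu_le_ofParity k hc.1),
    ← dLie_add_dCoLie hg (cochainAlpha_le_ofParity k hc.2)]
  refine Prod.ext ?_ ?_
  · simp only [diff]
    abel
  · exact sub_sub _ _ _

theorem diffLin_mem {k : ℕ} {c : Op K g × Op K g} (hc : c ∈ cochain K g k) :
    diffLin hg k c ∈ cochain K g (k + 1) := by
  obtain ⟨φ, ψ⟩ := c
  rw [diffLin_apply]
  exact ⟨add_mem (bd_mem_cochainNu hg hc.1) (conn_mem_cochainNu hg hc.2),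
    sub_mem (dAlpha_mem_cochainAlpha hg hc.1) (bd_mem_cochainAlpha hg hc.2)⟩

theorem diffLin_left (k : ℕ) (φ : Op K g) : diffLin hg k (φ, 0) =
    ((opCalculus hg).bd (α ^ (k - 1)) (k + 1) φ,
      (opCalculus hg).a * φ - φ * (opCalculus hg).a) := by
  rw [diffLin_apply, ((opCalculus hg).lin_conn _ _).zero, ((opCalculus hg).lin_bd _ _).zero]
  exact Prod.ext (add_zero _) (sub_zero _)

/-- With `k = m + 1` the first step has height `m`, and the connecting term of the second step, of
height `m + 1`, again carries the exponent `m`; this is the match of twists that `bd_bd` requires.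
-/
theorem diffLin_diffLin_left (m : ℕ) (φ : Op K g) :
    diffLin hg (m + 1 + 1) (diffLin hg (m + 1) (φ, 0)) = 0 := by
  have hp := IsEndo.pow hg m
  have e1 : α ^ (m + 1) = α ∘ₗ α ^ m := pow_succ' α m
  rw [diffLin_left, diffLin_apply]
  simp only [Nat.add_sub_cancel, e1]
  exact Prod.ext ((opCalculus hg).bd_bd_add_conn hg hp (m + 1 + 1) φ)
    ((opCalculus hg).commutator_bd hg hp (m + 1 + 1) φ)

theorem diffLin_diffLin_right (n : ℕ) (ψ : Op K g) :
    diffLin hg (n + 2 + 1) (diffLin hg (n + 2) (0, ψ)) = 0 := by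
  have hp := IsEndo.pow hg n
  have e1 : α ^ (n + 1) = α ∘ₗ α ^ n := pow_succ' α n
  have e2 : α ^ (n + 2) = α ∘ₗ α ∘ₗ α ^ n := by rw [← e1]; exact pow_succ' α (n + 1)
  have h : diffLin hg (n + 2) (0, ψ) = ((opCalculus hg).conn (α ^ n) (n + 2) ψ,
      -(opCalculus hg).bd (α ^ (n + 1)) (n + 2) ψ) := by
    rw [diffLin_apply, ((opCalculus hg).lin_bd _ _).zero]
    refine Prod.ext (zero_add _) ?_
    exact (congrArg (· - _) ((lin_commutator (K := K) (opCalculus hg).a).zero)).trans (zero_sub _)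
  rw [h, diffLin_apply]
  have s1 : n + 2 + 1 - 1 = n + 2 := rfl
  have s2 : n + 2 - 1 = n + 1 := rfl
  simp only [s1, s2, e2, e1]
  exact Prod.ext ((opCalculus hg).bd_conn_sub hg hp (n + 2) ψ)
    ((opCalculus hg).commutator_conn hg hp (n + 2) ψ)

theorem diffLin_diffLin {k : ℕ} {c : Op K g × Op K g} (hc : c ∈ cochain K g k) :
    diffLin hg (k + 1) (diffLin hg k c) = 0 := by
  obtain ⟨φ, ψ⟩ := c
  rw [show (φ, ψ) = (φ, 0) + (0, ψ) by simp, map_add, map_add]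
  have h1 : diffLin hg (k + 1) (diffLin hg k (φ, 0)) = 0 := by
    cases k with
    | zero =>
      have h : φ ∈ cochainNu K g 0 := hc.1
      rw [cochainNu_zero, Submodule.mem_bot] at h
      rw [h, Prod.mk_zero_zero, map_zero, map_zero]
    | succ m => exact diffLin_diffLin_left hg m φ
  have h2 : diffLin hg (k + 1) (diffLin hg k (0, ψ)) = 0 := by
    -- For `k ≤ 1` the component `ψ` is zero; otherwise `k = n + 2` and all exponents are honest
    -- differences.
    rcases le_or_gt k 1 with hk | hk
    · have h : ψ ∈ cochainAlpha K g k := hc.2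
      rw [cochainAlpha_eq_bot hk, Submodule.mem_bot] at h
      rw [h, Prod.mk_zero_zero, map_zero, map_zero]
    · obtain ⟨n, rfl⟩ := Nat.exists_eq_add_of_le' hk
      exact diffLin_diffLin_right hg n ψ
  rw [h1, h2, add_zero]

end

end HomLie

end

theorem mainTheorem12 {K : Type*} [Field K] [CharZero K] {g : Type*} [AddCommGroup g] [Module K g]
    (ν : g →ₗ[K] g →ₗ[K] g) (δ : g →ₗ[K] TensorProduct K g g) (α : g →ₗ[K] g)
    (hg : HomLie.IsHomLieBialgebra ν δ α α) :
    ∃ D : ∀ k : ℕ, HomLie.cochain K g k →ₗ[K] HomLie.cochain K g (k + 1),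
      (∀ (k : ℕ) (c : HomLie.cochain K g k),
        (D k c : (ExteriorAlgebra K g →ₗ[K] ExteriorAlgebra K g) ×
          (ExteriorAlgebra K g →ₗ[K] ExteriorAlgebra K g)) = HomLie.diff ν δ α k c) ∧
      ∀ k : ℕ, D (k + 1) ∘ₗ D k = 0 :=
  ⟨fun k => (HomLie.diffLin hg k).restrict fun _ hc => HomLie.diffLin_mem hg hc,
    fun _ c => (HomLie.diff_eq hg c.2).symm,
    fun _ => LinearMap.ext fun c => Subtype.ext (HomLie.diffLin_diffLin hg c.2)⟩
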